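/- **Setting.** An insertion-only distributed stream over the universe $[n]$ and $k$ servers is a sequence of updates $(i_1,j_1),\dots,(i_m,j_m)\in[n]\times[k]$, where update $(i_t,j_t)$ reaches server $j_t$ only and inserts one copy of item $i_t$. Let $f^{(t)}_i(j)$ be the number of copies of $i$ inserted at server $j$ up to time $t$, $f^{(t)}=\sum_{j\in[k]} f^{(t)}(j)$ and $\|f\|_p^p=\sum_i f_i^p$. In the distributed monitoring model, $k$ servers and a central coordinator share public randomness and have independent private randomness; each server exchanges self-delimiting messages of bits with the coordinator over a private two-way channel. On receiving an update a server may report to the coordinator, who may then in several rounds send messages to servers and receive their replies. The coordinator holds an output at every time. The communication is the total number of bits sent over all channels during the whole stream. **Theorem.** Let $p\ge 1$, let $a\in\mathbb N$ and let $C>0$. There are constants $K,B,d$, depending only on $p,a,C$, such that for all $n\ge 2$ and $k\ge 1$ there is a protocol for the distributed monitoring model, whose public randomness contains, for some $R,N\in\mathbb N$, independent standard exponential variables $e^{(r)}_{i,l}$ ($r\in[R]$, $i\in[n]$, $l\in[N]$), with the following properties on every fixed insertion-only distributed stream of length $m\le n^a$. 1. (Communication.) The expected communication is at most $K\,(k+k^{p-1})\,(\log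 n)^d$ bits. 2. (Continuous perfect $L_p$ sampling.) At every time $t\in\{1,\dots,m\}$ the coordinator outputs a triple $(r^*,i^*,l^*)\in[R]\times[n]\times[N]$ and a real number $\widehat G$, and for every $i\in[n]$ $$\left|\Pr[i^*=i]-\frac{(f^{(t)}_i)^p}{\|f^{(t)}\|_p^p}\right|\le n^{-C}.$$ Moreover, with $G^{(r)}_{i,l}=f^{(t)}_i/(e^{(r)}_{i,l})^{1/p}$ (instance $r$ of the vector that has $N$ copies of every coordinate of $f^{(t)}$, scaled by exponential variables), with probability at least $1-n^{-C}$ the sampled coordinate is a largest one of its instance: $G^{(r^*)}_{i^*,l^*}=\max_{i,l}G^{(r^*)}_{i,l}$. 3. (Estimate of the sampled coordinate.) At every time $t\in\{1,\dots,m\}$, for almost every value of the public randomness (which determines $G$) and every $(r,i,l)$ that is then sampled with positive probability, $$\mathbb E\big[\widehat G\mid (r^*,i^*,l^*)=(r,i,l)\big]=G^{(r)}_{i,l},\qquad \mathbb E\big[\widehat G^2\mid (r^*,i^*,l^*)=(r,i,l)\big]\le B\cdot\big(G^{(r)}_{i,l}\big)^2,$$ the expectations being over the private randomness. Consequently $\widehat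 f=\widehat G\cdot(e^{(r^*)}_{i^*,l^*})^{1/p}$ estimates the frequency of the sampled index: for every $i$ with $\Pr[i^*=i]>0$, over all the randomness, $\mathbb E[\widehat f\mid i^*=i]=f^{(t)}_i$, and moreover $\mathrm{Var}[\widehat f\mid i^*=i]\le (f^{(t)}_i)^2$. -/

import Mathlib

open MeasureTheory ProbabilityTheory
open scoped ENNReal

/-! ### Distributed insertion-only streams -/

/-- A distributed insertion-only stream over the universe `Fin n` and the servers `Fin k`: the
update `(i, j)` inserts one copy of item `i` at server `j`. -/
abbrev DStream (n k : ℕ) : Type := List (Fin n × Fin k)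

/-- `f_i(j)`: the number of occurrences of item `i` at server `j`. -/
def localFreq {n k : ℕ} (s : DStream n k) (j : Fin k) (i : Fin n) : ℕ := s.count (i, j)

/-- The global frequency vector `f = ∑_j f(j)`. -/
def freq {n k : ℕ} (s : DStream n k) (i : Fin n) : ℕ := ∑ j, localFreq s j i

/-- The `L_p` sampling probability `f_i^p / ‖f‖_p^p`. -/
noncomputable def lpProb {n k : ℕ} (p : ℝ) (s : DStream n k) (i : Fin n) : ℝ :=
  (freq s i : ℝ) ^ p / ∑ i', (freq s i' : ℝ) ^ p

/-! ### Protocols in the distributed monitoring (coordinator) model -/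

/-- A randomized distributed monitoring protocol with `k` servers and a central coordinator.

All parties see the public randomness; the coordinator and every server have in addition private
randomness, independent of everything else. Parties are computationally unbounded, and the initial
state of a party may record all the randomness that it sees.

A party only reacts to what reaches it: a server to an update of its own stream or to a message of
the coordinator, the coordinator to messages of the servers. In particular nobody sees the clock
or the updates that arrive at other servers. Messages are non-empty bit strings from a prefix-free
code, so that they are self-delimiting.

When an update arrives at a server, this server may send a report to the coordinator. A report is
followed by rounds of communication: in each round the coordinator sends messages to some set of
servers, and each of them replies. The coordinator ends this by sending no message, at the latest
after `maxRounds` rounds. -/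
structure Protocol (n k : ℕ) (Out : Type) where
  /-- public randomness -/
  Pub : Type
  /-- private randomness of the coordinator -/
  CoordPriv : Type
  /-- private randomness of one server -/
  ServerPriv : Type
  [mPub : MeasurableSpace Pub]
  [mCoordPriv : MeasurableSpace CoordPriv]
  [mServerPriv : MeasurableSpace ServerPriv]
  pubLaw : Measure Pub
  coordPrivLaw : Measure CoordPriv
  serverPrivLaw : Measure ServerPriv
  [probPub : IsProbabilityMeasure pubLaw]
  [probCoordPriv : IsProbabilityMeasure coordPrivLaw]
  [probServerPriv : IsProbabilityMeasure serverPrivLaw]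
  /-- the bit strings that may be sent as a message -/
  code : Set (List Bool)
  nil_notMem_code : [] ∉ code
  code_prefixFree : ∀ u ∈ code, ∀ v ∈ code, u <+: v → u = v
  CoordState : Type
  ServerState : Type
  coordInit : Pub → CoordPriv → CoordState
  serverInit : Fin k → Pub → ServerPriv → ServerState
  /-- a server receives a stream update, and sends a report or nothing -/
  onUpdate : ServerState → Fin n → ServerState × Option code
  /-- a server receives a message of the coordinator, and replies -/
  onQuery : ServerState → code → ServerState × code
  /-- the coordinator receives a report -/
  onReport : CoordState → Fin k → code → CoordState
  /-- the messages that the coordinator sends next -/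
  queries : CoordState → Fin k → Option code
  /-- the coordinator receives the replies of the servers that it has contacted -/
  onReplies : CoordState → (Fin k → Option code) → CoordState
  maxRounds : ℕ
  /-- the current output of the coordinator -/
  output : CoordState → Out

attribute [instance] Protocol.mPub Protocol.mCoordPriv Protocol.mServerPriv
  Protocol.probPub Protocol.probCoordPriv Protocol.probServerPriv

namespace Protocol

variable {n k : ℕ} {Out : Type} (P : Protocol n k Out)

/-- The private randomness of all parties. -/
abbrev Priv : Type := P.CoordPriv × (Fin k → P.ServerPriv)

/-- All the randomness of the protocol. -/
abbrev Rand : Type := P.Pub × P.Priv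

/-- The private random sources are independent of each other. -/
noncomputable def privLaw : Measure P.Priv :=
  P.coordPrivLaw.prod (Measure.pi fun _ : Fin k => P.serverPrivLaw)

/-- The private randomness is independent of the public randomness. -/
noncomputable def law : Measure P.Rand := P.pubLaw.prod P.privLaw

/-- Global configuration, with the number of bits sent so far over all channels in both
directions. -/
structure Config where
  coord : P.CoordState
  server : Fin k → P.ServerState
  bits : ℕ

/-- Length of an optional message; no message costs nothing. -/
def msgBits : Option P.code → ℕ
  | none => 0
  | some w => w.1.length

/-- Reaction of one server to the optional message of the coordinator. -/
def answer (st : P.ServerState) : Option P.code → P.ServerState × Option P.code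
  | none => (st, none)
  | some q => ((P.onQuery st q).1, some (P.onQuery st q).2)

open Classical in
/-- One round of communication; nothing happens if the coordinator has nothing to send. -/
noncomputable def round (c : P.Config) : P.Config :=
  if ∀ j, P.queries c.coord j = none then c
  else
    { coord := P.onReplies c.coord fun j => (P.answer (c.server j) (P.queries c.coord j)).2
      server := fun j => (P.answer (c.server j) (P.queries c.coord j)).1
      bits := c.bits + ∑ j, (P.msgBits (P.queries c.coord j)
        + P.msgBits (P.answer (c.server j) (P.queries c.coord j)).2) }

/-- Processing of one stream update `(i, j)`. -/
noncomputable def step (c : P.Config) (u : Fin n × Fin k) : P.Config :=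
  match P.onUpdate (c.server u.2) u.1 with
  | (st, none) => { c with server := Function.update c.server u.2 st }
  | (st, some w) =>
    P.round^[P.maxRounds]
      { coord := P.onReport c.coord u.2 w
        server := Function.update c.server u.2 st
        bits := c.bits + w.1.length }

/-- Configuration before the first update. -/
def init (ω : P.Rand) : P.Config where
  coord := P.coordInit ω.1 ω.2.1
  server j := P.serverInit j ω.1 (ω.2.2 j)
  bits := 0

/-- Configuration after a stream. -/
noncomputable def run (s : DStream n k) (ω : P.Rand) : P.Config := s.foldl P.step (P.init ω)

/-- The output of the coordinator after a stream. -/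
noncomputable def result (s : DStream n k) (ω : P.Rand) : Out := P.output (P.run s ω).coord

/-- The total communication, in bits, on a stream. -/
noncomputable def comm (s : DStream n k) (ω : P.Rand) : ℕ := (P.run s ω).bits

end Protocol

/-! ### Samplers -/

/-- A coordinate `(r, i, l)` of the scaled duplicated vectors: instance `r`, item `i`, copy `l`. -/
abbrev Coord (R n N : ℕ) : Type := Fin R × Fin n × Fin N

/-- The output of a sampler: the sampled coordinate and an estimate of its scaled value. -/
abbrev SampleOut (R n N : ℕ) : Type := Coord R n N × ℝ

/-- `G_{i,l} = f_i / e_{i,l}^{1/p}` in instance `r`, for given values of the scaling variables. -/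
noncomputable def scaled {R n k N : ℕ} (p : ℝ) (s : DStream n k) (e : Coord R n N → ℝ)
    (x : Coord R n N) : ℝ :=
  (freq s x.2.1 : ℝ) / e x ^ (1 / p)

namespace Protocol

variable {R n k N : ℕ} (P : Protocol n k (SampleOut R n N))

/-- The sampled coordinate after a stream. -/
noncomputable def sample (s : DStream n k) (ω : P.Rand) : Coord R n N := (P.result s ω).1

/-- The sampled index `i* ∈ [n]` after a stream. -/
noncomputable def index (s : DStream n k) (ω : P.Rand) : Fin n := (P.sample s ω).2.1

/-- The estimate `Ĝ` of the scaled value of the sampled coordinate. -/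
noncomputable def est (s : DStream n k) (ω : P.Rand) : ℝ := (P.result s ω).2

/-- The estimate of the frequency of the sampled index that results from `Ĝ` by undoing the
scaling, which is public. -/
noncomputable def freqEst (p : ℝ) (e : Coord R n N → P.Pub → ℝ) (s : DStream n k) (ω : P.Rand) :
    ℝ :=
  P.est s ω * e (P.sample s ω) ω.1 ^ (1 / p)

/-- The scaling variables are independent standard exponential variables. -/
def StdExponentials (e : Coord R n N → P.Pub → ℝ) : Prop :=
  (∀ x, Measurable (e x)) ∧ iIndepFun e P.pubLaw ∧ ∀ x, P.pubLaw.map (e x) = expMeasure 1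

/-- After the stream `s`, the sampled index has the `L_p` distribution up to `ε` in every
probability. -/
def PerfectAt (p ε : ℝ) (s : DStream n k) : Prop :=
  ∀ i, |P.law.real {ω | P.index s ω = i} - lpProb p s i| ≤ ε

/-- After the stream `s`, except with probability `ε`, the sampled coordinate is a largest
coordinate of the scaled vector of its instance. -/
def MaximizesAt (p ε : ℝ) (e : Coord R n N → P.Pub → ℝ) (s : DStream n k) : Prop :=
  1 - ε ≤ P.law.real {ω | ∀ i l, scaled p s (fun x => e x ω.1) ((P.sample s ω).1, i, l)
    ≤ scaled p s (fun x => e x ω.1) (P.sample s ω)}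

/-- After the stream `s`, given the public randomness (which fixes `G`) and that the coordinate `x`
is sampled, `E[Ĝ] = G_x` and `E[Ĝ²] ≤ B * G_x²`. -/
def EstimatesScaledAt (p B : ℝ) (e : Coord R n N → P.Pub → ℝ) (s : DStream n k) : Prop :=
  ∀ᵐ ω₀ ∂P.pubLaw, ∀ x, P.privLaw {ω₁ | P.sample s (ω₀, ω₁) = x} ≠ 0 →
    MemLp (fun ω₁ => P.est s (ω₀, ω₁)) 2 P.privLaw[|{ω₁ | P.sample s (ω₀, ω₁) = x}] ∧
    ∫ ω₁, P.est s (ω₀, ω₁) ∂P.privLaw[|{ω₁ | P.sample s (ω₀, ω₁) = x}]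
      = scaled p s (fun y => e y ω₀) x ∧
    ∫ ω₁, P.est s (ω₀, ω₁) ^ 2 ∂P.privLaw[|{ω₁ | P.sample s (ω₀, ω₁) = x}]
      ≤ B * scaled p s (fun y => e y ω₀) x ^ 2

/-- After the stream `s`, given that the index `i` is sampled, the estimate of its frequency is
unbiased and has variance at most `f_i²`. -/
def EstimatesFreqAt (p : ℝ) (e : Coord R n N → P.Pub → ℝ) (s : DStream n k) : Prop :=
  ∀ i, P.law {ω | P.index s ω = i} ≠ 0 →
    MemLp (P.freqEst p e s) 2 P.law[|{ω | P.index s ω = i}] ∧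
    ∫ ω, P.freqEst p e s ω ∂P.law[|{ω | P.index s ω = i}] = freq s i ∧
    ∫ ω, (P.freqEst p e s ω - freq s i) ^ 2 ∂P.law[|{ω | P.index s ω = i}] ≤ (freq s i : ℝ) ^ 2

end Protocol

set_option linter.unusedSectionVars false

/-! ### A prefix-free code for finite sets -/

/-- Self-delimiting concatenation: every block is preceded by `true`, and the end marked by
`false`. -/
def encodeBlocks : List (List Bool) → List Bool
  | [] => [false]
  | b :: bs => true :: (b ++ encodeBlocks bs)

theorem encodeBlocks_ne_nil (bs : List (List Bool)) : encodeBlocks bs ≠ [] := by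
  cases bs <;> simp [encodeBlocks]

theorem length_encodeBlocks {w : ℕ} {bs : List (List Bool)} (h : ∀ b ∈ bs, b.length = w) :
    (encodeBlocks bs).length = (w + 1) * bs.length + 1 := by
  induction bs with
  | nil => simp [encodeBlocks]
  | cons b bs ih =>
    have hb : b.length = w := h b (by simp)
    have := ih fun b hb => h b (by simp [hb])
    simp only [encodeBlocks, List.length_cons, List.length_append, hb, this]
    ring

theorem encodeBlocks_prefix {w : ℕ} {bs cs : List (List Bool)} (hb : ∀ b ∈ bs, b.length = w)
    (hc : ∀ c ∈ cs, c.length = w) (h : encodeBlocks bs <+: encodeBlocks cs) : bs = cs := by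
  induction bs generalizing cs with
  | nil =>
    cases cs with
    | nil => rfl
    | cons c cs => simp [encodeBlocks] at h
  | cons b bs ih =>
    cases cs with
    | nil => simp [encodeBlocks] at h
    | cons c cs =>
      simp only [encodeBlocks, List.cons_prefix_cons, true_and] at h
      have hlen : b.length = c.length := by rw [hb b (by simp), hc c (by simp)]
      obtain ⟨t, ht⟩ := h
      rw [List.append_assoc] at ht
      obtain ⟨h1, h2⟩ := List.append_inj ht hlen
      rw [h1, ih (fun b h => hb b (by simp [h])) (fun c h => hc c (by simp [h])) ⟨t, h2⟩]

/-- The code words made of blocks of length `w`. -/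
def blockCode (w : ℕ) : Set (List Bool) :=
  {u | ∃ bs : List (List Bool), (∀ b ∈ bs, b.length = w) ∧ encodeBlocks bs = u}

theorem exists_blocks {α : Type} [Fintype α] {w : ℕ} (h : Fintype.card α ≤ 2 ^ w) :
    Nonempty (α ↪ List.Vector Bool w) :=
  Function.Embedding.nonempty_of_card_le (by simpa using h)

/-- The code word of a finite set. -/
noncomputable def encodeFinset {α : Type} {w : ℕ} (φ : α ↪ List.Vector Bool w) (s : Finset α) :
    blockCode w :=
  ⟨encodeBlocks (s.toList.map fun a => (φ a).1), s.toList.map fun a => (φ a).1,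
    by simp, rfl⟩

theorem length_encodeFinset {α : Type} {w : ℕ} (φ : α ↪ List.Vector Bool w) (s : Finset α) :
    (encodeFinset φ s).1.length = (w + 1) * s.card + 1 := by
  have := length_encodeBlocks (w := w) (bs := s.toList.map fun a => (φ a).1) (by simp)
  simpa [encodeFinset] using this

open Classical in
theorem encodeFinset_injective {α : Type} {w : ℕ} (φ : α ↪ List.Vector Bool w) :
    Function.Injective (encodeFinset φ) := by
  intro s t h
  have h1 : encodeBlocks (s.toList.map fun a => (φ a).1)
      = encodeBlocks (t.toList.map fun a => (φ a).1) := congrArg Subtype.val h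
  have h2 : (s.toList.map fun a => (φ a).1) = t.toList.map fun a => (φ a).1 :=
    encodeBlocks_prefix (w := w) (by simp) (by simp) (by rw [h1])
  have h3 : Function.Injective fun a => (φ a).1 := fun a b hab => φ.injective (Subtype.ext hab)
  have h4 : s.toList = t.toList := h3.list_map h2
  rw [← Finset.toList_toFinset s, ← Finset.toList_toFinset t, h4]

/-- Decoding of the code word of a finite set. -/
noncomputable def decodeFinset {α : Type} {w : ℕ} (φ : α ↪ List.Vector Bool w) :
    blockCode w → Finset α :=
  Function.invFun (encodeFinset φ)

@[simp]
theorem decodeFinset_encodeFinset {α : Type} {w : ℕ} (φ : α ↪ List.Vector Bool w)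
    (s : Finset α) : decodeFinset φ (encodeFinset φ s) = s :=
  Function.leftInverse_invFun (encodeFinset_injective φ) s

/-! ### Reporting schemes -/

/-- A reporting scheme: servers announce facts (`Atom`), the coordinator broadcasts commands
(`Cmd`). Given its static information, its frequencies and the commands issued so far, `cur` is the
set of facts that a server has to announce now; given the facts announced by each server and the
commands issued so far, `due` is the set of commands that have to be issued. -/
structure Scheme (n k : ℕ) (Atom Cmd SInfo CInfo : Type) [Fintype Atom] [Fintype Cmd] where
  cur : SInfo → (Fin n → ℕ) → Finset Cmd → Finset Atom
  due : CInfo → (Fin k → Finset Atom) → Finset Cmd → Finset Cmd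
  width : ℕ
  card_atom_le : Fintype.card Atom ≤ 2 ^ width
  card_cmd_le : Fintype.card Cmd ≤ 2 ^ width

namespace Scheme

/-- Local frequencies, announced facts, issued commands and bits sent. -/
structure State (n k : ℕ) (Atom Cmd : Type) where
  F : Fin k → Fin n → ℕ
  K : Fin k → Finset Atom
  cmds : Finset Cmd
  bits : ℕ

/-- The state before the first update. -/
def start {n k : ℕ} {Atom Cmd : Type} : State n k Atom Cmd :=
  ⟨fun _ _ => 0, fun _ => ∅, ∅, 0⟩

variable {n k : ℕ} {Atom Cmd SInfo CInfo : Type} [Fintype Atom] [Fintype Cmd]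
  [DecidableEq Atom] [DecidableEq Cmd] (S : Scheme n k Atom Cmd SInfo CInfo)
  (si : Fin k → SInfo) (ci : CInfo)

/-- Commands that are due and have not been issued. -/
def fresh (c : State n k Atom Cmd) : Finset Cmd := S.due ci c.K c.cmds \ c.cmds

/-- The coordinator broadcasts the due commands and the servers answer. -/
def exchange (c : State n k Atom Cmd) : State n k Atom Cmd where
  F := c.F
  K j := c.K j ∪ S.cur (si j) (c.F j) (c.cmds ∪ S.fresh ci c)
  cmds := c.cmds ∪ S.fresh ci c
  bits := c.bits + ∑ j, (((S.width + 1) * (S.fresh ci c).card + 1)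
    + ((S.width + 1) * (S.cur (si j) (c.F j) (c.cmds ∪ S.fresh ci c) \ c.K j).card + 1))

/-- One round of communication. -/
def round (c : State n k Atom Cmd) : State n k Atom Cmd := if S.fresh ci c = ∅ then c else S.exchange si ci c

/-- Local frequencies after an update. -/
def bump (F : Fin k → Fin n → ℕ) (u : Fin n × Fin k) : Fin k → Fin n → ℕ :=
  Function.update F u.2 (Function.update (F u.2) u.1 (F u.2 u.1 + 1))

/-- The facts that a server newly announces on an update. -/
def news (c : State n k Atom Cmd) (u : Fin n × Fin k) : Finset Atom :=
  S.cur (si u.2) (bump c.F u u.2) c.cmds \ c.K u.2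

/-- A server processes an update and reports. -/
def report (c : State n k Atom Cmd) (u : Fin n × Fin k) : State n k Atom Cmd where
  F := bump c.F u
  K := Function.update c.K u.2 (c.K u.2 ∪ S.cur (si u.2) (bump c.F u u.2) c.cmds)
  cmds := c.cmds
  bits := c.bits + if S.news si c u = ∅ then 0 else (S.width + 1) * (S.news si c u).card + 1

/-- Enough rounds to issue all commands. -/
def rounds (_ : Scheme n k Atom Cmd SInfo CInfo) : ℕ := Fintype.card Cmd

/-- Processing of one update. -/
def step (c : State n k Atom Cmd) (u : Fin n × Fin k) : State n k Atom Cmd :=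
  if S.news si c u = ∅ then S.report si c u
  else (S.round si ci)^[S.rounds] (S.report si c u)

/-- The state after a stream. -/
def run (s : DStream n k) : State n k Atom Cmd := s.foldl (S.step si ci) start

variable {S si ci}

@[simp]
theorem run_append (s t : DStream n k) :
    S.run si ci (s ++ t) = t.foldl (S.step si ci) (S.run si ci s) := by
  simp [run, List.foldl_append]

/-- No communication is pending. -/
structure Rest (S : Scheme n k Atom Cmd SInfo CInfo) (si : Fin k → SInfo) (ci : CInfo)
    (c : State n k Atom Cmd) : Prop where
  cur_subset : ∀ j, S.cur (si j) (c.F j) c.cmds ⊆ c.K j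
  due_subset : S.due ci c.K c.cmds ⊆ c.cmds

theorem fresh_eq_empty {c : State n k Atom Cmd} : S.fresh ci c = ∅ ↔ S.due ci c.K c.cmds ⊆ c.cmds := by
  simp [fresh, Finset.sdiff_eq_empty_iff_subset]

theorem card_cmds_lt_exchange {c : State n k Atom Cmd} (h : S.fresh ci c ≠ ∅) :
    c.cmds.card < (S.exchange si ci c).cmds.card := by
  obtain ⟨a, ha⟩ := Finset.nonempty_iff_ne_empty.2 h
  refine Finset.card_lt_card ⟨Finset.subset_union_left, fun hs => ?_⟩
  exact (Finset.mem_sdiff.1 ha).2 (hs (Finset.mem_union_right _ ha))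

theorem iterate_round_due (m : ℕ) (c : State n k Atom Cmd) (hm : Fintype.card Cmd ≤ c.cmds.card + m) :
    S.fresh ci ((S.round si ci)^[m] c) = ∅ := by
  induction m generalizing c with
  | zero =>
    have hu : c.cmds = Finset.univ := Finset.eq_univ_of_card _
      (le_antisymm (Finset.card_le_univ _) (by simpa using hm))
    rw [fresh_eq_empty]
    simp [hu]
  | succ m ih =>
    rw [Function.iterate_succ_apply]
    by_cases h : S.fresh ci c = ∅
    · have hr : S.round si ci c = c := by simp [round, h]
      rw [hr, Function.iterate_fixed hr]
      exact h
    · apply ih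
      have := card_cmds_lt_exchange (si := si) h
      simp only [round, h, if_false]
      omega

/-- Induction over the run of a scheme from a state at rest. The frequencies may be assumed to stay
below `b`. -/
theorem foldl_induction {b : ℕ} (Inv : State n k Atom Cmd → Prop) (c : State n k Atom Cmd) (hrest : S.Rest si ci c)
    (h0 : Inv c)
    (hrep : ∀ c u, S.Rest si ci c → (∀ j i, bump c.F u j i < b) → Inv c → Inv (S.report si c u))
    (hround : ∀ c, (∀ j, S.cur (si j) (c.F j) c.cmds ⊆ c.K j) → (∀ j i, c.F j i < b) →
      S.fresh ci c ≠ ∅ → Inv c → Inv (S.exchange si ci c))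
    (s : DStream n k) (hb : ∀ j i, c.F j i + s.length < b) :
    Inv (s.foldl (S.step si ci) c) ∧ S.Rest si ci (s.foldl (S.step si ci) c) := by
  induction s generalizing c with
  | nil => exact ⟨h0, hrest⟩
  | cons u s ih =>
    rw [List.foldl_cons]
    have hF : ∀ j i, bump c.F u j i ≤ c.F j i + 1 := by
      intro j i
      by_cases hj : j = u.2
      · subst hj
        by_cases hi : i = u.1
        · subst hi; simp [bump]
        · simp [bump, hi]
      · simp [bump, hj]
    have hF' : ∀ j i, bump c.F u j i < b := fun j i => by
      have := hb j i; have := hF j i; simp only [List.length_cons] at *; omega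
    have hI := hrep c u hrest hF' h0
    have hcur : ∀ j, S.cur (si j) ((S.report si c u).F j) (S.report si c u).cmds
        ⊆ (S.report si c u).K j := by
      intro j
      by_cases hj : j = u.2
      · subst hj; simp [report]
      · simpa [report, bump, Function.update_of_ne hj] using hrest.cur_subset j
    have key : ∀ m (c : State n k Atom Cmd), (∀ j, S.cur (si j) (c.F j) c.cmds ⊆ c.K j) →
        (∀ j i, c.F j i < b) → Inv c →
        Inv ((S.round si ci)^[m] c) ∧
        (∀ j, S.cur (si j) (((S.round si ci)^[m] c).F j) ((S.round si ci)^[m] c).cmds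
          ⊆ ((S.round si ci)^[m] c).K j) ∧ ((S.round si ci)^[m] c).F = c.F := by
      intro m
      induction m with
      | zero => exact fun c h _ hi => ⟨hi, h, rfl⟩
      | succ m ihm =>
        intro c h hlt hi
        rw [Function.iterate_succ_apply]
        by_cases hf : S.fresh ci c = ∅
        · simp only [round, hf, if_true]
          exact ihm c h hlt hi
        · simp only [round, hf, if_false]
          exact ihm (S.exchange si ci c) (fun j => Finset.subset_union_right) hlt
            (hround c h hlt hf hi)
    have hstep : Inv (S.step si ci c u) ∧ S.Rest si ci (S.step si ci c u)
        ∧ (S.step si ci c u).F = bump c.F u := by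
      unfold step
      split_ifs with hn
      · refine ⟨hI, ⟨hcur, ?_⟩, rfl⟩
        have hK : (S.report si c u).K = c.K := by
          have : S.cur (si u.2) (bump c.F u u.2) c.cmds ⊆ c.K u.2 := by
            simpa [news, Finset.sdiff_eq_empty_iff_subset] using hn
          simp [report, Finset.union_eq_left.2 this]
        rw [hK]
        exact hrest.due_subset
      · obtain ⟨h1, h2, h3⟩ := key S.rounds _ hcur hF' hI
        exact ⟨h1, ⟨h2, fresh_eq_empty.1 (iterate_round_due _ _ (by simp [rounds]))⟩, h3⟩
    refine ih _ hstep.2.1 hstep.1 fun j i => ?_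
    rw [hstep.2.2]
    have := hb j i; have := hF j i; simp only [List.length_cons] at *; omega

/-- Nothing is to be announced or commanded before the first update. -/
structure Quiet (S : Scheme n k Atom Cmd SInfo CInfo) (si : Fin k → SInfo) (ci : CInfo) :
    Prop where
  cur_zero : ∀ j, S.cur (si j) (fun _ => 0) ∅ = ∅
  due_empty : S.due ci (fun _ => ∅) ∅ = ∅

theorem Quiet.rest_start (h : S.Quiet si ci) : S.Rest si ci start :=
  ⟨fun j => by simp [start, h.cur_zero], by simp [start, h.due_empty]⟩

theorem run_induction {b : ℕ} (hq : S.Quiet si ci) (Inv : State n k Atom Cmd → Prop) (h0 : Inv start)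
    (hrep : ∀ c u, S.Rest si ci c → (∀ j i, bump c.F u j i < b) → Inv c → Inv (S.report si c u))
    (hround : ∀ c, (∀ j, S.cur (si j) (c.F j) c.cmds ⊆ c.K j) → (∀ j i, c.F j i < b) →
      S.fresh ci c ≠ ∅ → Inv c → Inv (S.exchange si ci c))
    (s : DStream n k) (hb : s.length < b) :
    Inv (S.run si ci s) :=
  (foldl_induction Inv _ hq.rest_start h0 hrep hround s (fun _ _ => by simpa [start] using hb)).1

theorem run_rest (hq : S.Quiet si ci) (s : DStream n k) : S.Rest si ci (S.run si ci s) :=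
  (foldl_induction (b := s.length + 1) (fun _ => True) _ hq.rest_start trivial
    (fun _ _ _ _ _ => trivial) (fun _ _ _ _ _ => trivial) s (by simp [start])).2

theorem round_iterate_F (m : ℕ) (c : State n k Atom Cmd) : ((S.round si ci)^[m] c).F = c.F := by
  induction m generalizing c with
  | zero => rfl
  | succ m ih =>
    rw [Function.iterate_succ_apply, ih]
    unfold round
    split_ifs <;> rfl

theorem localFreq_append_singleton (s : DStream n k) (u : Fin n × Fin k) :
    localFreq (s ++ [u]) = bump (localFreq s) u := by
  funext j i
  obtain ⟨i', j'⟩ := u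
  simp only [localFreq, bump, Function.update_apply, List.count_append, List.count_singleton]
  by_cases hj : j = j'
  · subst hj
    by_cases hi : i = i'
    · subst hi; simp
    · simp [hi, Ne.symm hi, localFreq]
  · simp [hj, Ne.symm hj, localFreq]

theorem run_F (s : DStream n k) : (S.run si ci s).F = localFreq s := by
  induction s using List.reverseRecOn with
  | nil => funext j i; simp [run, start, localFreq]
  | append_singleton s u ih =>
    rw [run_append, localFreq_append_singleton, ← ih]
    simp only [List.foldl_cons, List.foldl_nil, step]
    split_ifs
    · rfl
    · rw [round_iterate_F]; rfl

/-- Communication is proportional to the facts announced and the commands issued. -/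
theorem bits_run_le (hq : S.Quiet si ci) (s : DStream n k) :
    (S.run si ci s).bits ≤ (S.width + 3) *
      ((∑ j, ((S.run si ci s).K j).card) + k * (S.run si ci s).cmds.card) := by
  refine run_induction (b := s.length + 1) hq
    (fun c => c.bits ≤ (S.width + 3) * ((∑ j, (c.K j).card) + k * c.cmds.card))
    (by simp [start]) ?_ ?_ s (by simp)
  · intro c u _ _ h
    have hs : ∑ j, ((S.report si c u).K j).card = (∑ j, (c.K j).card) + (S.news si c u).card := by
      have hu : (c.K u.2 ∪ S.cur (si u.2) (bump c.F u u.2) c.cmds).card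
          = (c.K u.2).card + (S.news si c u).card := by
        rw [news, ← Finset.card_union_of_disjoint Finset.disjoint_sdiff,
          Finset.union_sdiff_self_eq_union]
      rw [← Finset.add_sum_erase _ _ (Finset.mem_univ u.2),
        ← Finset.add_sum_erase Finset.univ (fun j => (c.K j).card) (Finset.mem_univ u.2)]
      have : ∀ j ∈ Finset.univ.erase u.2, ((S.report si c u).K j).card = (c.K j).card := by
        intro j hj
        simp [report, Function.update_of_ne (Finset.ne_of_mem_erase hj)]
      rw [Finset.sum_congr rfl this]
      simp only [report, Function.update_self, hu]
      ring
    rw [hs]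
    simp only [report]
    split_ifs with hn
    · simp only [hn, Finset.card_empty, add_zero]; exact h
    · have h1 : 1 ≤ (S.news si c u).card :=
        Finset.card_pos.2 (Finset.nonempty_iff_ne_empty.2 hn)
      nlinarith
  · intro c _ _ hf h
    have h1 : 1 ≤ (S.fresh ci c).card := Finset.card_pos.2 (Finset.nonempty_iff_ne_empty.2 hf)
    have hc : (S.exchange si ci c).cmds.card = c.cmds.card + (S.fresh ci c).card := by
      simp only [exchange, fresh]
      rw [← Finset.card_union_of_disjoint Finset.disjoint_sdiff]
    have hK : ∀ j, ((S.exchange si ci c).K j).card = (c.K j).card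
        + (S.cur (si j) (c.F j) (c.cmds ∪ S.fresh ci c) \ c.K j).card := by
      intro j
      simp only [exchange]
      rw [← Finset.card_union_of_disjoint Finset.disjoint_sdiff,
        Finset.union_sdiff_self_eq_union]
    rw [hc, Finset.sum_congr rfl fun j _ => hK j, Finset.sum_add_distrib]
    simp only [exchange]
    have h2 : ∑ j : Fin k, (((S.width + 1) * (S.fresh ci c).card + 1)
        + ((S.width + 1) * (S.cur (si j) (c.F j) (c.cmds ∪ S.fresh ci c) \ c.K j).card + 1))
        ≤ (S.width + 3) * (k * (S.fresh ci c).card) + (S.width + 3) *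
          ∑ j, (S.cur (si j) (c.F j) (c.cmds ∪ S.fresh ci c) \ c.K j).card := by
      rw [Finset.mul_sum, show (S.width + 3) * (k * (S.fresh ci c).card)
        = ∑ _j : Fin k, (S.width + 3) * (S.fresh ci c).card by simp; ring,
        ← Finset.sum_add_distrib]
      refine Finset.sum_le_sum fun j _ => ?_
      nlinarith
    nlinarith

theorem step_of_rest {c : State n k Atom Cmd} (h : S.Rest si ci c) (u : Fin n × Fin k) :
    S.step si ci c u = (S.round si ci)^[S.rounds] (S.report si c u) := by
  unfold step
  split_ifs with hn
  · have hs : S.cur (si u.2) (bump c.F u u.2) c.cmds ⊆ c.K u.2 := by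
      simpa [news, Finset.sdiff_eq_empty_iff_subset] using hn
    have hf : S.fresh ci (S.report si c u) = ∅ := by
      rw [fresh_eq_empty]
      simpa [report, Finset.union_eq_left.2 hs] using h.due_subset
    exact (Function.iterate_fixed (by simp [round, hf]) _).symm
  · rfl

open Classical in
/-- If the commands depend on visible facts only, then facts that are not visible do not influence
the run. -/
theorem run_congr_visible {si' : Fin k → SInfo} (vis : Atom → Prop)
    (hq : S.Quiet si ci) (hq' : S.Quiet si' ci)
    (hcur : ∀ j f c, (S.cur (si j) f c).filter vis = (S.cur (si' j) f c).filter vis)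
    (hdue : ∀ K K' c, (∀ j, (K j).filter vis = (K' j).filter vis) →
      S.due ci K c = S.due ci K' c) (s : DStream n k) :
    (S.run si ci s).cmds = (S.run si' ci s).cmds := by
  let Rel : State n k Atom Cmd → State n k Atom Cmd → Prop := fun c c' =>
    c.F = c'.F ∧ c.cmds = c'.cmds ∧ ∀ j, (c.K j).filter vis = (c'.K j).filter vis
  have hround : ∀ c c', Rel c c' → Rel (S.round si ci c) (S.round si' ci c') := by
    rintro c c' ⟨h1, h2, h3⟩
    have hf : S.fresh ci c = S.fresh ci c' := by
      rw [fresh, fresh, hdue _ _ _ h3, h2]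
    unfold round
    rw [hf]
    split_ifs
    · exact ⟨h1, h2, h3⟩
    · refine ⟨h1, by simp [exchange, h2, hf], fun j => ?_⟩
      simp only [exchange, Finset.filter_union, h3, hf, h2, h1, hcur]
  have hiter : ∀ m c c', Rel c c' →
      Rel ((S.round si ci)^[m] c) ((S.round si' ci)^[m] c') := by
    intro m
    induction m with
    | zero => exact fun _ _ h => h
    | succ m ih =>
      intro c c' h
      rw [Function.iterate_succ_apply, Function.iterate_succ_apply]
      exact ih _ _ (hround _ _ h)
  suffices Rel (S.run si ci s) (S.run si' ci s) from this.2.1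
  induction s using List.reverseRecOn with
  | nil => exact ⟨rfl, rfl, fun _ => rfl⟩
  | append_singleton s u ih =>
    rw [run_append, run_append]
    simp only [List.foldl_cons, List.foldl_nil]
    rw [step_of_rest (run_rest hq s), step_of_rest (run_rest hq' s)]
    apply hiter
    obtain ⟨h1, h2, h3⟩ := ih
    refine ⟨by simp [report, h1], h2, fun j => ?_⟩
    by_cases hj : j = u.2
    · subst hj
      simp only [report, Function.update_self, Finset.filter_union, h1, h2, h3, hcur]
    · simp [report, hj, h3]

/-! ### The protocol of a scheme -/

variable (S)

/-- The encoding of facts. -/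
noncomputable def atomBlock : Atom ↪ List.Vector Bool S.width :=
  (exists_blocks S.card_atom_le).some

/-- The encoding of commands. -/
noncomputable def cmdBlock : Cmd ↪ List.Vector Bool S.width :=
  (exists_blocks S.card_cmd_le).some

/-- The protocol that runs a reporting scheme with randomized static information. The coordinator
has no private randomness. -/
noncomputable def protocol {Out Pub Priv : Type} [MeasurableSpace Pub] [MeasurableSpace Priv]
    (pubLaw : Measure Pub) (privLaw : Measure Priv) [IsProbabilityMeasure pubLaw]
    [IsProbabilityMeasure privLaw] (sinfo : Fin k → Pub → Priv → SInfo)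
    (cinfo : Pub → CInfo) (out : Pub → (Fin k → Finset Atom) → Finset Cmd → Out) :
    Protocol n k Out where
  Pub := Pub
  CoordPriv := Unit
  ServerPriv := Priv
  pubLaw := pubLaw
  coordPrivLaw := Measure.dirac ()
  serverPrivLaw := privLaw
  code := blockCode S.width
  nil_notMem_code := by
    rintro ⟨bs, _, h⟩
    exact encodeBlocks_ne_nil bs h
  code_prefixFree := by
    rintro u ⟨bs, hb, rfl⟩ v ⟨cs, hc, rfl⟩ h
    rw [encodeBlocks_prefix hb hc h]
  CoordState := Pub × (Fin k → Finset Atom) × Finset Cmd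
  ServerState := SInfo × (Fin n → ℕ) × Finset Atom × Finset Cmd
  coordInit ω _ := (ω, fun _ => ∅, ∅)
  serverInit j ω ω' := (sinfo j ω ω', fun _ => 0, ∅, ∅)
  onUpdate := fun (σ, f, K, c) i =>
    let f' := Function.update f i (f i + 1)
    ((σ, f', K ∪ S.cur σ f' c, c),
      if S.cur σ f' c \ K = ∅ then none
      else some (encodeFinset S.atomBlock (S.cur σ f' c \ K)))
  onQuery := fun (σ, f, K, c) q =>
    let c' := c ∪ decodeFinset S.cmdBlock q
    ((σ, f, K ∪ S.cur σ f c', c'), encodeFinset S.atomBlock (S.cur σ f c' \ K))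
  onReport := fun (ω, K, c) j w =>
    (ω, Function.update K j (K j ∪ decodeFinset S.atomBlock w), c)
  queries := fun (ω, K, c) _ =>
    if S.due (cinfo ω) K c \ c = ∅ then none
    else some (encodeFinset S.cmdBlock (S.due (cinfo ω) K c \ c))
  onReplies := fun (ω, K, c) w =>
    (ω, fun j => K j ∪ (w j).elim ∅ (decodeFinset S.atomBlock),
      c ∪ (S.due (cinfo ω) K c \ c))
  maxRounds := S.rounds
  output := fun (ω, K, c) => out ω K c

variable {S}

section
variable {Out Pub Priv : Type} [MeasurableSpace Pub] [MeasurableSpace Priv]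
    {pubLaw : Measure Pub} {privLaw : Measure Priv} [IsProbabilityMeasure pubLaw]
    [IsProbabilityMeasure privLaw] {sinfo : Fin k → Pub → Priv → SInfo}
    {cinfo : Pub → CInfo} {out : Pub → (Fin k → Finset Atom) → Finset Cmd → Out}

/-- The configuration of the protocol that corresponds to a state of the scheme. -/
def toConfig (ω : (S.protocol pubLaw privLaw sinfo cinfo out).Rand) (c : State n k Atom Cmd) :
    (S.protocol pubLaw privLaw sinfo cinfo out).Config where
  coord := (ω.1, c.K, c.cmds)
  server j := (sinfo j ω.1 (ω.2.2 j), c.F j, c.K j, c.cmds)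
  bits := c.bits

theorem protocol_round (hk : 1 ≤ k) (ω : (S.protocol pubLaw privLaw sinfo cinfo out).Rand)
    (c : State n k Atom Cmd) :
    (S.protocol pubLaw privLaw sinfo cinfo out).round (toConfig ω c)
      = toConfig ω (S.round (fun j => sinfo j ω.1 (ω.2.2 j)) (cinfo ω.1) c) := by
  have : Nonempty (Fin k) := ⟨⟨0, hk⟩⟩
  by_cases h : S.fresh (cinfo ω.1) c = ∅
  · have h' : S.due (cinfo ω.1) c.K c.cmds \ c.cmds = ∅ := h
    simp [Protocol.round, round, h, protocol, toConfig, h']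
  · have h' : ¬ S.due (cinfo ω.1) c.K c.cmds \ c.cmds = ∅ := h
    have hq : ∀ j, (S.protocol pubLaw privLaw sinfo cinfo out).queries (toConfig ω c).coord j
        = some (encodeFinset S.cmdBlock (S.fresh (cinfo ω.1) c)) := by
      intro j
      simp [protocol, toConfig, h', fresh]
    unfold Protocol.round
    rw [if_neg (by simp [hq]), round, if_neg h]
    simp only [hq]
    simp only [Protocol.answer, Protocol.msgBits, toConfig, protocol, exchange,
      decodeFinset_encodeFinset, length_encodeFinset, Option.elim]
    congr 2
    refine Prod.ext (funext fun j => ?_) rfl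
    simp

theorem protocol_run (hk : 1 ≤ k) (ω : (S.protocol pubLaw privLaw sinfo cinfo out).Rand)
    (s : DStream n k) :
    (S.protocol pubLaw privLaw sinfo cinfo out).run s ω
      = toConfig ω (S.run (fun j => sinfo j ω.1 (ω.2.2 j)) (cinfo ω.1) s) := by
  induction s using List.reverseRecOn with
  | nil => rfl
  | append_singleton s u ih =>
    have h1 : (S.protocol pubLaw privLaw sinfo cinfo out).run (s ++ [u]) ω
        = (S.protocol pubLaw privLaw sinfo cinfo out).step
          ((S.protocol pubLaw privLaw sinfo cinfo out).run s ω) u := by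
      simp [Protocol.run, List.foldl_append]
    rw [h1, ih, run_append]
    simp only [List.foldl_cons, List.foldl_nil]
    generalize S.run (fun j => sinfo j ω.1 (ω.2.2 j)) (cinfo ω.1) s = c
    have hround : ∀ m (c : State n k Atom Cmd), (S.protocol pubLaw privLaw sinfo cinfo out).round^[m]
        (toConfig ω c)
        = toConfig ω ((S.round (fun j => sinfo j ω.1 (ω.2.2 j)) (cinfo ω.1))^[m] c) := by
      intro m
      induction m with
      | zero => exact fun _ => rfl
      | succ m ihm =>
        intro c
        rw [Function.iterate_succ_apply, Function.iterate_succ_apply, protocol_round hk, ihm]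
    have hserver : Function.update (toConfig ω c).server u.2
        (sinfo u.2 ω.1 (ω.2.2 u.2), bump c.F u u.2,
          c.K u.2 ∪ S.cur (sinfo u.2 ω.1 (ω.2.2 u.2)) (bump c.F u u.2) c.cmds, c.cmds)
        = (toConfig ω (S.report (fun j => sinfo j ω.1 (ω.2.2 j)) c u)).server := by
      funext j
      by_cases hj : j = u.2
      · subst hj
        refine (Function.update_self _ _ _).trans ?_
        simp only [toConfig, report, Function.update_self]
        rfl
      · refine (Function.update_of_ne hj _ _).trans ?_
        simp only [toConfig, report, bump, Function.update_of_ne hj]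
        rfl
    have hbump : bump c.F u u.2 = Function.update (c.F u.2) u.1 (c.F u.2 u.1 + 1) := by
      simp [bump]
    by_cases hn : S.news (fun j => sinfo j ω.1 (ω.2.2 j)) c u = ∅
    · have hn' := hn
      simp only [news, hbump] at hn'
      have hup : (S.protocol pubLaw privLaw sinfo cinfo out).onUpdate
          ((toConfig ω c).server u.2) u.1
          = ((sinfo u.2 ω.1 (ω.2.2 u.2), bump c.F u u.2,
          c.K u.2 ∪ S.cur (sinfo u.2 ω.1 (ω.2.2 u.2)) (bump c.F u u.2) c.cmds, c.cmds),
            none) := by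
        simp [protocol, toConfig, hbump, hn']
      simp only [Protocol.step, hup]
      rw [hserver, step, if_pos hn]
      have hsub : S.cur (sinfo u.2 ω.1 (ω.2.2 u.2)) (bump c.F u u.2) c.cmds ⊆ c.K u.2 := by
        simpa [news, Finset.sdiff_eq_empty_iff_subset] using hn
      simp [toConfig, report, hn, Finset.union_eq_left.2 hsub]
    · have hn' := hn
      simp only [news, hbump] at hn'
      have hup : (S.protocol pubLaw privLaw sinfo cinfo out).onUpdate
          ((toConfig ω c).server u.2) u.1
          = ((sinfo u.2 ω.1 (ω.2.2 u.2), bump c.F u u.2,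
          c.K u.2 ∪ S.cur (sinfo u.2 ω.1 (ω.2.2 u.2)) (bump c.F u u.2) c.cmds, c.cmds),
            some (encodeFinset S.atomBlock (S.news (fun j => sinfo j ω.1 (ω.2.2 j)) c u))) := by
        simp [protocol, toConfig, hbump, hn', news]
      simp only [Protocol.step, hup]
      rw [hserver, step, if_neg hn, ← hround]
      congr 1
      simp [toConfig, report, hn, protocol, length_encodeFinset]
      simp [news]

theorem protocol_comm (hk : 1 ≤ k) (ω : Pub) (u : Unit) (U : Fin k → Priv) (s : DStream n k) :
    (S.protocol pubLaw privLaw sinfo cinfo out).comm s (ω, u, U)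
      = (S.run (fun j => sinfo j ω (U j)) (cinfo ω) s).bits := by
  unfold Protocol.comm
  rw [protocol_run hk]
  rfl

theorem protocol_result (hk : 1 ≤ k) (ω : Pub) (u : Unit) (U : Fin k → Priv) (s : DStream n k) :
    (S.protocol pubLaw privLaw sinfo cinfo out).result s (ω, u, U)
      = out ω (S.run (fun j => sinfo j ω (U j)) (cinfo ω) s).K
          (S.run (fun j => sinfo j ω (U j)) (cinfo ω) s).cmds := by
  unfold Protocol.result
  rw [protocol_run hk]
  rfl

end

end Scheme

namespace Scheme

variable {n k : ℕ} {Atom Cmd SInfo CInfo : Type} [Fintype Atom] [Fintype Cmd]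
  [DecidableEq Atom] [DecidableEq Cmd] {S : Scheme n k Atom Cmd SInfo CInfo}
  {si : Fin k → SInfo} {ci : CInfo}

theorem le_bump (F : Fin k → Fin n → ℕ) (u : Fin n × Fin k) : F ≤ bump F u := by
  intro j i
  by_cases hj : j = u.2
  · subst hj
    by_cases hi : i = u.1
    · subst hi; simp [bump]
    · simp [bump, hi]
  · simp [bump, hj]

theorem mem_report_K {c : State n k Atom Cmd} {u : Fin n × Fin k} {j : Fin k} {a : Atom} :
    a ∈ (S.report si c u).K j ↔
      a ∈ c.K j ∨ (j = u.2 ∧ a ∈ S.cur (si j) (bump c.F u j) c.cmds) := by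
  by_cases hj : j = u.2
  · subst hj; simp [report]
  · simp [report, hj]

theorem mem_exchange_K {c : State n k Atom Cmd} {j : Fin k} {a : Atom} :
    a ∈ (S.exchange si ci c).K j ↔
      a ∈ c.K j ∨ a ∈ S.cur (si j) (c.F j) (c.cmds ∪ S.fresh ci c) := by
  simp [exchange]

end Scheme

/-! ### The tracking scheme -/

/-- A coordinate of a scaled vector together with a level. -/
abbrev Key (R n N Q : ℕ) : Type := Coord R n N × Fin (Q + 1)

/-- The item of a key. -/
abbrev Key.item {R n N Q : ℕ} (κ : Key R n N Q) : Fin n := κ.1.2.1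

/-- Facts: a key is hit in a group, a local count at some granularity, a randomly rounded count. -/
abbrev TAtom (R n N Q H G : ℕ) : Type :=
  (Key R n N Q × Fin H) ⊕ (Key R n N Q × Fin (G + 1) × Fin (2 ^ G)) ⊕ (Fin n × Fin (G + 2))

/-- Commands: `(κ, last)` starts the tracking of a key, `(κ, g + 1)` asks for its counts at
granularity `2 ^ g`, and `(κ, 0)` announces that it has reached its threshold. -/
abbrev TCmd (R n N Q G : ℕ) : Type := Key R n N Q × Fin (G + 2)

/-- The states of the tracking scheme. -/
abbrev TState (R n N Q H G k : ℕ) : Type :=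
  Scheme.State n k (TAtom R n N Q H G) (TCmd R n N Q G)

/-- The exponent, increased by one, of the power of two to which `f` is rounded with the random
number `U`; zero for `f = 0`. -/
def roundExp (G U f : ℕ) : ℕ :=
  if f = 0 then 0
  else Nat.log 2 f + 1 + if U * 2 ^ Nat.log 2 f < (f - 2 ^ Nat.log 2 f) * 2 ^ G then 1 else 0

theorem roundExp_mono (G U : ℕ) : Monotone (roundExp G U) := by
  intro f f' h
  unfold roundExp
  by_cases hf : f = 0
  · simp [hf]
  have hf' : f' ≠ 0 := by omega
  simp only [hf, hf', if_false]
  have hlog : Nat.log 2 f ≤ Nat.log 2 f' := Nat.log_mono_right h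
  rcases hlog.lt_or_eq with hlt | heq
  · split_ifs <;> omega
  · rw [heq]
    split_ifs with h1 h2
    · omega
    · exact absurd (lt_of_lt_of_le h1 (Nat.mul_le_mul_right _ (by omega))) h2
    · omega
    · omega

theorem roundExp_lt {G U f : ℕ} (hf : f < 2 ^ G) : roundExp G U f < G + 2 := by
  unfold roundExp
  by_cases h : f = 0
  · simp [h]
  have := Nat.log_lt_of_lt_pow h hf
  simp only [h, if_false]
  split_ifs <;> omega

section Track

variable {R n N Q H G k : ℕ}

/-- The level of the key is below a level of its instance that has been reached. -/
def DeadKey (c : Finset (TCmd R n N Q G)) (κ : Key R n N Q) : Prop :=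
  ∃ κ₁ : Key R n N Q, (κ₁, 0) ∈ c ∧ κ₁.1.1 = κ.1.1 ∧ κ.2 < κ₁.2

/-- The facts that a server has to announce: `θ` are the hitting thresholds, `U` is the random
number for rounding, and `i₀` is an item that is always watched. -/
def Announced (i₀ : Fin n) (θ : Key R n N Q → Fin H → ℕ) (U : ℕ) (f : Fin n → ℕ)
    (c : Finset (TCmd R n N Q G)) : TAtom R n N Q H G → Prop
  | Sum.inl (κ, h) =>
      1 ≤ f κ.item ∧ θ κ h ≤ f κ.item ∧ (κ, Fin.last (G + 1)) ∉ c ∧ ¬ DeadKey c κ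
  | Sum.inr (Sum.inl (κ, g, v)) =>
      1 ≤ v.1 ∧ v.1 = f κ.item / 2 ^ g.1 ∧ (κ, g.succ) ∈ c ∧ (κ, g.castSucc) ∉ c
  | Sum.inr (Sum.inr (i, ν)) =>
      1 ≤ ν.1 ∧ ν.1 = roundExp G U (f i) ∧ (i = i₀ ∨ ∃ κ γ, (κ, γ) ∈ c ∧ κ.item = i)

/-- The largest count of a key announced at granularity `2 ^ g`. -/
def topCount (A : Finset (TAtom R n N Q H G)) (κ : Key R n N Q) (g : Fin (G + 1)) :
    ℕ :=
  (Finset.univ.filter fun v => (Sum.inr (Sum.inl (κ, g, v)) : TAtom R n N Q H G) ∈ A).sup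
    fun v : Fin (2 ^ G) => v.1

/-- The commands that are due, with `τ` the thresholds of the keys. -/
def Due (τ : Key R n N Q → ℕ) (K : Fin k → Finset (TAtom R n N Q H G))
    (c : Finset (TCmd R n N Q G)) (a : TCmd R n N Q G) : Prop :=
  (a.2 = Fin.last (G + 1) ∧ ∀ h, ∃ j, Sum.inl (a.1, h) ∈ K j) ∨
  ∃ g : Fin (G + 1), a.2 = g.castSucc ∧ (a.1, g.succ) ∈ c ∧
    τ a.1 ≤ 2 ^ g.1 * ((∑ j, topCount (K j) a.1 g) + if g.1 = 0 then 0 else k)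

open Classical in
/-- The scheme that finds the keys that reach their thresholds. -/
noncomputable def trackScheme (R N Q H G : ℕ) (k : ℕ) (i₀ : Fin n) (w : ℕ)
    (hA : Fintype.card (TAtom R n N Q H G) ≤ 2 ^ w)
    (hC : Fintype.card (TCmd R n N Q G) ≤ 2 ^ w) :
    Scheme n k (TAtom R n N Q H G) (TCmd R n N Q G)
      ((Key R n N Q → Fin H → ℕ) × Fin (2 ^ G)) (Key R n N Q → ℕ) where
  cur σ f c := Finset.univ.filter (Announced i₀ σ.1 σ.2.1 f c)
  due τ K c := Finset.univ.filter (Due τ K c)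
  width := w
  card_atom_le := hA
  card_cmd_le := hC

variable {i₀ : Fin n} {w : ℕ} {hA : Fintype.card (TAtom R n N Q H G) ≤ 2 ^ w}
  {hC : Fintype.card (TCmd R n N Q G) ≤ 2 ^ w}
  {θ : Fin k → Key R n N Q → Fin H → ℕ} {U : Fin k → Fin (2 ^ G)} {τ : Key R n N Q → ℕ}

theorem mem_cur {σ : (Key R n N Q → Fin H → ℕ) × Fin (2 ^ G)} {f : Fin n → ℕ}
    {c : Finset (TCmd R n N Q G)} {a : TAtom R n N Q H G} :
    a ∈ (trackScheme R N Q H G k i₀ w hA hC).cur σ f c ↔ Announced i₀ σ.1 σ.2.1 f c a := by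
  simp [trackScheme]

theorem mem_due {K : Fin k → Finset (TAtom R n N Q H G)}
    {c : Finset (TCmd R n N Q G)} {a : TCmd R n N Q G} :
    a ∈ (trackScheme R N Q H G k i₀ w hA hC).due τ K c ↔ Due τ K c a := by
  simp [trackScheme]

theorem mem_fresh {c : TState R n N Q H G k} {a : TCmd R n N Q G} :
    a ∈ (trackScheme R N Q H G k i₀ w hA hC).fresh τ c ↔ Due τ c.K c.cmds a ∧ a ∉ c.cmds := by
  simp only [Scheme.fresh, Finset.mem_sdiff]
  exact and_congr_left' mem_due

theorem mem_exchange_cmds {c : TState R n N Q H G k}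
    {si : Fin k → (Key R n N Q → Fin H → ℕ) × Fin (2 ^ G)} {a : TCmd R n N Q G} :
    a ∈ ((trackScheme R N Q H G k i₀ w hA hC).exchange si τ c).cmds ↔
      a ∈ c.cmds ∨ Due τ c.K c.cmds a := by
  simp only [Scheme.exchange, Finset.mem_union]
  constructor
  · rintro (h | h)
    · exact Or.inl h
    · exact Or.inr (mem_fresh.1 h).1
  · intro h
    by_cases hc : a ∈ c.cmds
    · exact Or.inl hc
    · exact Or.inr (mem_fresh.2 ⟨h.resolve_left hc, hc⟩)

theorem quiet_track (hH : 1 ≤ H) : (trackScheme R N Q H G k i₀ w hA hC).Quiet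
    (fun j => (θ j, U j)) τ where
  cur_zero j := by
    ext a
    rw [mem_cur]
    rcases a with ⟨κ, h⟩ | ⟨κ, g, v⟩ | ⟨i, ν⟩
    · simp [Announced]
    · simp [Announced]
    · simp [Announced, roundExp]; rintro h1 rfl; simp at h1
  due_empty := by
    ext a
    rw [mem_due]
    refine iff_of_false ?_ (Finset.notMem_empty _)
    rintro (⟨_, h⟩ | ⟨g, _, h, _⟩)
    · obtain ⟨j, hj⟩ := h ⟨0, hH⟩
      exact absurd hj (Finset.notMem_empty _)
    · exact absurd h (Finset.notMem_empty _)

/-- What an announced fact says about the frequencies at present. -/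
def Truth (θ : Key R n N Q → Fin H → ℕ) (U : ℕ) (f : Fin n → ℕ) : TAtom R n N Q H G → Prop
  | Sum.inl (κ, h) => 1 ≤ f κ.item ∧ θ κ h ≤ f κ.item
  | Sum.inr (Sum.inl (κ, g, v)) => v.1 ≤ f κ.item / 2 ^ g.1
  | Sum.inr (Sum.inr (i, ν)) => ν.1 ≤ roundExp G U (f i)

theorem Truth.mono {θ : Key R n N Q → Fin H → ℕ} {U : ℕ} {f f' : Fin n → ℕ} (h : f ≤ f')
    {a : TAtom R n N Q H G} (ha : Truth θ U f a) : Truth θ U f' a := by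
  rcases a with ⟨κ, h'⟩ | ⟨κ, g, v⟩ | ⟨i, ν⟩
  · exact ⟨ha.1.trans (h _), ha.2.trans (h _)⟩
  · exact le_trans ha (Nat.div_le_div_right (h _))
  · exact le_trans ha (roundExp_mono _ _ (h _))

theorem Announced.truth {θ : Key R n N Q → Fin H → ℕ} {U : ℕ} {f : Fin n → ℕ}
    {c : Finset (TCmd R n N Q G)} {a : TAtom R n N Q H G} (ha : Announced i₀ θ U f c a) :
    Truth θ U f a := by
  rcases a with ⟨κ, h'⟩ | ⟨κ, g, v⟩ | ⟨i, ν⟩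
  · exact ⟨ha.1, ha.2.1⟩
  · exact ha.2.1.le
  · exact ha.2.1.le

/-- All announced facts are true. -/
def Truthful (θ : Fin k → Key R n N Q → Fin H → ℕ) (U : Fin k → Fin (2 ^ G))
    (c : TState R n N Q H G k) : Prop :=
  ∀ j, ∀ a ∈ c.K j, Truth (θ j) (U j).1 (c.F j) a

theorem Truthful.report {c : TState R n N Q H G k} (h : Truthful θ U c)
    (u : Fin n × Fin k) : Truthful θ U
      ((trackScheme R N Q H G k i₀ w hA hC).report (fun j => (θ j, U j)) c u) := by
  intro j a ha
  rcases Scheme.mem_report_K.1 ha with ha | ⟨rfl, ha⟩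
  · exact (h j a ha).mono (Scheme.le_bump c.F u j)
  · exact (mem_cur.1 ha).truth

theorem Truthful.exchange {c : TState R n N Q H G k} (h : Truthful θ U c) :
    Truthful θ U ((trackScheme R N Q H G k i₀ w hA hC).exchange (fun j => (θ j, U j)) τ c) := by
  intro j a ha
  rcases Scheme.mem_exchange_K.1 ha with ha | ha
  · exact h j a ha
  · exact (mem_cur.1 ha).truth

theorem truthful_start : Truthful θ U (Scheme.start : TState R n N Q H G k) := by
  intro j a ha
  exact absurd ha (Finset.notMem_empty a)

theorem topCount_le {c : TState R n N Q H G k} (h : Truthful θ U c)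
    (j : Fin k) (κ : Key R n N Q) (g : Fin (G + 1)) :
    topCount (c.K j) κ g ≤ c.F j κ.item / 2 ^ g.1 := by
  refine Finset.sup_le fun v hv => ?_
  exact h j _ (Finset.mem_filter.1 hv).2

theorem topCount_eq {c : TState R n N Q H G k} (h : Truthful θ U c)
    (hcur : ∀ j, (trackScheme R N Q H G k i₀ w hA hC).cur (θ j, U j) (c.F j) c.cmds ⊆ c.K j)
    (j : Fin k) (κ : Key R n N Q) (g : Fin (G + 1)) (hF : c.F j κ.item < 2 ^ G)
    (h1 : (κ, g.succ) ∈ c.cmds) (h2 : (κ, g.castSucc) ∉ c.cmds) :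
    topCount (c.K j) κ g = c.F j κ.item / 2 ^ g.1 := by
  refine le_antisymm (topCount_le h j κ g) ?_
  rcases Nat.eq_zero_or_pos (c.F j κ.item / 2 ^ g.1) with h0 | h0
  · omega
  have hlt : c.F j κ.item / 2 ^ g.1 < 2 ^ G := lt_of_le_of_lt (Nat.div_le_self _ _) hF
  have hmem : (Sum.inr (Sum.inl (κ, g, ⟨_, hlt⟩)) : TAtom R n N Q H G) ∈ c.K j :=
    hcur j (mem_cur.2 ⟨h0, rfl, h1, h2⟩)
  exact Finset.le_sup (f := fun v : Fin (2 ^ G) => v.1)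
    (Finset.mem_filter.2 ⟨Finset.mem_univ (⟨_, hlt⟩ : Fin (2 ^ G)), hmem⟩)

/-- The frequency of an item in a state. -/
def stateFreq (c : TState R n N Q H G k) (i : Fin n) : ℕ := ∑ j, c.F j i

theorem sum_topCount_le {c : TState R n N Q H G k} (h : Truthful θ U c)
    (κ : Key R n N Q) (g : Fin (G + 1)) :
    2 ^ g.1 * ∑ j, topCount (c.K j) κ g ≤ stateFreq c κ.item := by
  rw [Finset.mul_sum]
  refine Finset.sum_le_sum fun j _ => ?_
  calc 2 ^ g.1 * topCount (c.K j) κ g ≤ 2 ^ g.1 * (c.F j κ.item / 2 ^ g.1) :=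
        Nat.mul_le_mul_left _ (topCount_le h j κ g)
    _ ≤ _ := Nat.mul_div_le _ _

theorem stateFreq_report_le {c : TState R n N Q H G k}
    {si : Fin k → (Key R n N Q → Fin H → ℕ) × Fin (2 ^ G)}
    (u : Fin n × Fin k) (i : Fin n) : stateFreq c i
      ≤ stateFreq ((trackScheme R N Q H G k i₀ w hA hC).report si c u) i :=
  Finset.sum_le_sum fun j _ => Scheme.le_bump c.F u j i

/-- The commands issued are justified by the facts announced. -/
structure Justified (τ : Key R n N Q → ℕ)
    (c : TState R n N Q H G k) : Prop where
  found : ∀ κ, (κ, 0) ∈ c.cmds → τ κ ≤ stateFreq c κ.item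
  near : ∀ κ (γ : Fin (G + 2)), (κ, γ) ∈ c.cmds → τ κ ≤ stateFreq c κ.item + 2 ^ γ.1 * k
  succ_mem : ∀ κ (g : Fin (G + 1)), (κ, g.castSucc) ∈ c.cmds → (κ, g.succ) ∈ c.cmds
  hit : ∀ κ, (κ, Fin.last (G + 1)) ∈ c.cmds → ∀ h, ∃ j, Sum.inl (κ, h) ∈ c.K j

theorem justified_start : Justified τ (Scheme.start : TState R n N Q H G k) := by
  constructor <;> intro _ <;> simp [Scheme.start]

theorem Justified.report {c : TState R n N Q H G k} (hj : Justified τ c) (u : Fin n × Fin k)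
    {si : Fin k → (Key R n N Q → Fin H → ℕ) × Fin (2 ^ G)} :
    Justified τ ((trackScheme R N Q H G k i₀ w hA hC).report si c u) := by
  refine ⟨?_, ?_, hj.succ_mem, ?_⟩
  · exact fun κ h => (hj.found κ h).trans (stateFreq_report_le u _)
  · exact fun κ γ h => (hj.near κ γ h).trans (Nat.add_le_add_right (stateFreq_report_le u _) _)
  · intro κ h h'
    obtain ⟨j, hj⟩ := hj.hit κ h h'
    exact ⟨j, Scheme.mem_report_K.2 (Or.inl hj)⟩

theorem Justified.exchange {c : TState R n N Q H G k} (hk : 1 ≤ k) (hτ : ∀ κ, τ κ ≤ 2 ^ G)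
    (ht : Truthful θ U c) (hj : Justified τ c) :
    Justified τ ((trackScheme R N Q H G k i₀ w hA hC).exchange (fun j => (θ j, U j)) τ c) := by
  refine ⟨?_, ?_, ?_, ?_⟩
  · intro κ h
    rcases mem_exchange_cmds.1 h with h | h
    · exact hj.found κ h
    · rcases h with ⟨h, _⟩ | ⟨g, h, _, h2⟩
      · simp [Fin.ext_iff] at h
      · have hg : g.1 = 0 := (congrArg Fin.val h).symm
        have := sum_topCount_le ht κ g
        simp only [hg, if_true, add_zero] at h2 this
        exact h2.trans this
  · intro κ γ h
    rcases mem_exchange_cmds.1 h with h | h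
    · exact hj.near κ γ h
    · rcases h with ⟨h, _⟩ | ⟨g, h, _, h2⟩
      · have h : γ = Fin.last (G + 1) := h
        subst h
        refine (hτ κ).trans (le_trans ?_ (Nat.le_add_left _ _))
        calc 2 ^ G ≤ 2 ^ (G + 1) := Nat.pow_le_pow_right (by norm_num) (by omega)
          _ ≤ _ := Nat.le_mul_of_pos_right _ hk
      · have h : γ = g.castSucc := h
        subst h
        have := sum_topCount_le ht κ g
        refine h2.trans ?_
        rw [mul_add]
        refine Nat.add_le_add this (Nat.mul_le_mul_left _ ?_)
        split_ifs <;> omega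
  · intro κ g h
    rcases mem_exchange_cmds.1 h with h | h
    · exact mem_exchange_cmds.2 (Or.inl (hj.succ_mem κ g h))
    · rcases h with ⟨h, _⟩ | ⟨g', h, h1, _⟩
      · have h : g.castSucc = Fin.last (G + 1) := h
        exact absurd h (Fin.castSucc_lt_last g).ne
      · have h : g = g' := Fin.castSucc_injective _ h
        subst h
        exact mem_exchange_cmds.2 (Or.inl h1)
  · intro κ h h'
    have : ∃ j, Sum.inl (κ, h') ∈ c.K j := by
      rcases mem_exchange_cmds.1 h with h | h
      · exact hj.hit κ h h'
      · rcases h with ⟨_, h⟩ | ⟨g', h, _, _⟩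
        · exact h h'
        · exact absurd h (Fin.castSucc_lt_last g').ne'
    obtain ⟨j, hj⟩ := this
    exact ⟨j, Scheme.mem_exchange_K.2 (Or.inl hj)⟩

theorem justified_run (hH : 1 ≤ H) (hk : 1 ≤ k) (hτ : ∀ κ, τ κ ≤ 2 ^ G)
    (s : DStream n k) :
    Truthful θ U ((trackScheme R N Q H G k i₀ w hA hC).run (fun j => (θ j, U j)) τ s) ∧
    Justified τ ((trackScheme R N Q H G k i₀ w hA hC).run (fun j => (θ j, U j)) τ s) :=
  Scheme.run_induction (b := s.length + 1) (quiet_track hH)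
    (fun c => Truthful θ U c ∧ Justified τ c) ⟨truthful_start, justified_start⟩
    (fun _ u _ _ h => ⟨h.1.report u, h.2.report u⟩)
    (fun _ _ _ _ h => ⟨h.1.exchange, h.2.exchange hk hτ h.1⟩) s (by simp)

theorem stateFreq_run (s : DStream n k) (i : Fin n)
    {si : Fin k → (Key R n N Q → Fin H → ℕ) × Fin (2 ^ G)} :
    stateFreq ((trackScheme R N Q H G k i₀ w hA hC).run si τ s) i = freq s i := by
  simp only [stateFreq, freq]
  rw [Scheme.run_F]

theorem localFreq_le_length (s : DStream n k) (j : Fin k) (i : Fin n) :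
    localFreq s j i ≤ s.length := List.count_le_length

/-- A key that is found has reached its threshold. -/
theorem threshold_le_of_found (hH : 1 ≤ H) (hk : 1 ≤ k) (hτ : ∀ κ, τ κ ≤ 2 ^ G)
    {s : DStream n k} {κ : Key R n N Q}
    (h : (κ, 0) ∈ ((trackScheme R N Q H G k i₀ w hA hC).run (fun j => (θ j, U j)) τ s).cmds) :
    τ κ ≤ freq s κ.item := by
  have := (justified_run (θ := θ) (U := U) hH hk hτ s).2.found κ h
  rwa [stateFreq_run] at this

/-- A key that has reached its threshold and is hit in all groups is found, unless a higher level of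
its instance is. -/
theorem found_or_dead (hH : 1 ≤ H) (hk : 1 ≤ k) (hτ : ∀ κ, τ κ ≤ 2 ^ G)
    {s : DStream n k} (hs : s.length < 2 ^ G) {κ : Key R n N Q} (hf : τ κ ≤ freq s κ.item)
    (hhit : ∀ h, ∃ j, 1 ≤ localFreq s j κ.item ∧ θ j κ h ≤ localFreq s j κ.item) :
    (κ, 0) ∈ ((trackScheme R N Q H G k i₀ w hA hC).run (fun j => (θ j, U j)) τ s).cmds ∨
    DeadKey ((trackScheme R N Q H G k i₀ w hA hC).run (fun j => (θ j, U j)) τ s).cmds κ := by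
  rw [or_iff_not_imp_right]
  intro hd
  obtain ⟨ht, hj⟩ := justified_run (i₀ := i₀) (w := w) (hA := hA) (hC := hC)
    (θ := θ) (U := U) hH hk hτ s
  have hr := Scheme.run_rest (quiet_track (i₀ := i₀) (w := w) (hA := hA) (hC := hC)
    (θ := θ) (U := U) (τ := τ) hH) s
  have hF := Scheme.run_F (S := trackScheme R N Q H G k i₀ w hA hC)
    (si := fun j => (θ j, U j)) (ci := τ) s
  have hfr := stateFreq_run (R := R) (N := N) (H := H) (i₀ := i₀) (w := w) (hA := hA) (hC := hC)
    (si := fun j => (θ j, U j)) (τ := τ) s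
  generalize (trackScheme R N Q H G k i₀ w hA hC).run (fun j => (θ j, U j)) τ s = c at *
  have hlast : (κ, Fin.last (G + 1)) ∈ c.cmds := by
    by_contra hl
    refine hl (hr.due_subset (mem_due.2 (Or.inl ⟨rfl, fun h => ?_⟩)))
    obtain ⟨j, h1, h2⟩ := hhit h
    refine ⟨j, hr.cur_subset j (mem_cur.2 ?_)⟩
    rw [← hF] at h1 h2
    exact ⟨h1, h2, hl, hd⟩
  have key : ∀ γ : Fin (G + 2), (κ, γ) ∈ c.cmds := by
    intro γ
    induction γ using Fin.reverseInduction with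
    | last => exact hlast
    | cast g ih =>
      by_contra hg
      refine hg (hr.due_subset (mem_due.2 (Or.inr ⟨g, rfl, ih, ?_⟩)))
      have hlt : ∀ j, c.F j κ.item < 2 ^ G := fun j => by
        rw [hF]; exact (localFreq_le_length s j _).trans_lt hs
      have htop : ∀ j, topCount (c.K j) κ g = c.F j κ.item / 2 ^ g.1 := fun j =>
        topCount_eq ht hr.cur_subset j κ g (hlt j) ih hg
      simp only [htop]
      refine hf.trans ?_
      rw [← hfr, stateFreq]
      by_cases hg0 : g.1 = 0
      · simp [hg0]
      · simp only [hg0, if_false]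
        calc ∑ j, c.F j κ.item ≤ ∑ j : Fin k, 2 ^ g.1 * (c.F j κ.item / 2 ^ g.1 + 1) :=
              Finset.sum_le_sum fun j _ => (Nat.lt_mul_div_succ _ (by positivity)).le
          _ = _ := by rw [← Finset.mul_sum, Finset.sum_add_distrib]; simp
  exact key 0
end Track

section Track

variable {R n N Q H G k : ℕ} {i₀ : Fin n} {w : ℕ}
  {hA : Fintype.card (TAtom R n N Q H G) ≤ 2 ^ w}
  {hC : Fintype.card (TCmd R n N Q G) ≤ 2 ^ w}
  {θ : Fin k → Key R n N Q → Fin H → ℕ} {U : Fin k → Fin (2 ^ G)} {τ : Key R n N Q → ℕ}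

theorem Justified.last_mem {c : TState R n N Q H G k} (h : Justified τ c) {κ : Key R n N Q}
    (γ : Fin (G + 2)) : (κ, γ) ∈ c.cmds → (κ, Fin.last (G + 1)) ∈ c.cmds := by
  induction γ using Fin.reverseInduction with
  | last => exact id
  | cast g ih => exact fun hg => ih (h.succ_mem κ g hg)

/-- The counts announced for a key at one granularity lie in short intervals. -/
structure Confined (τ : Key R n N Q → ℕ) (κ : Key R n N Q) (g : Fin (G + 1))
    (c : TState R n N Q H G k) : Prop where
  idle : (κ, g.succ) ∉ c.cmds → ∀ j v, Sum.inr (Sum.inl (κ, g, v)) ∉ c.K j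
  confined : (κ, g.succ) ∈ c.cmds → ∃ b t : Fin k → ℕ,
    (∀ j v, Sum.inr (Sum.inl (κ, g, v)) ∈ c.K j → b j ≤ v.1 ∧ v.1 ≤ t j) ∧
    (∀ j, b j ≤ t j) ∧ (∀ j, t j ≤ c.F j κ.item / 2 ^ g.1) ∧
    τ κ ≤ 2 ^ g.1 * ((∑ j, b j) + 3 * k) ∧ (2 ^ g.1 * (∑ j, t j) ≤ τ κ ∨ t = b)

theorem sum_bump_div_le (F : Fin k → Fin n → ℕ) (u : Fin n × Fin k) (i : Fin n) (d : ℕ) :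
    ∑ j, Scheme.bump F u j i / 2 ^ d ≤ (∑ j, F j i / 2 ^ d) + 1 := by
  rw [← Finset.add_sum_erase _ _ (Finset.mem_univ u.2),
    ← Finset.add_sum_erase Finset.univ (fun j => F j i / 2 ^ d) (Finset.mem_univ u.2)]
  have h1 : ∀ j ∈ Finset.univ.erase u.2, Scheme.bump F u j i / 2 ^ d = F j i / 2 ^ d := by
    intro j hj
    simp [Scheme.bump, Function.update_of_ne (Finset.ne_of_mem_erase hj)]
  rw [Finset.sum_congr rfl h1]
  have h2 : Scheme.bump F u u.2 i ≤ F u.2 i + 1 := by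
    by_cases hi : i = u.1
    · subst hi; simp [Scheme.bump]
    · simp [Scheme.bump, hi]
  have h3 : Scheme.bump F u u.2 i / 2 ^ d ≤ F u.2 i / 2 ^ d + 1 := by
    calc Scheme.bump F u u.2 i / 2 ^ d ≤ (F u.2 i + 2 ^ d) / 2 ^ d :=
          Nat.div_le_div_right (h2.trans (Nat.add_le_add_left Nat.one_le_two_pow _))
      _ = _ := Nat.add_div_right _ (by positivity)
  omega

theorem Confined.report (hk : 1 ≤ k) {κ : Key R n N Q} {g : Fin (G + 1)}
    {c : TState R n N Q H G k} (u : Fin n × Fin k)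
    (hr : (trackScheme R N Q H G k i₀ w hA hC).Rest (fun j => (θ j, U j)) τ c)
    (hF : ∀ j i, Scheme.bump c.F u j i < 2 ^ G) (ht : Truthful θ U c) (h : Confined τ κ g c) :
    Confined τ κ g ((trackScheme R N Q H G k i₀ w hA hC).report (fun j => (θ j, U j)) c u) := by
  refine ⟨fun hc j v hv => ?_, fun hc => ?_⟩
  · rcases Scheme.mem_report_K.1 hv with hv | ⟨_, hv⟩
    · exact h.idle hc j v hv
    · exact hc (mem_cur.1 hv).2.2.1
  have hc' : (κ, g.succ) ∈ c.cmds := hc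
  obtain ⟨b, t, h1, h2, h3, h4, h5⟩ := h.confined hc'
  have hle : ∀ j, c.F j κ.item / 2 ^ g.1 ≤ Scheme.bump c.F u j κ.item / 2 ^ g.1 := fun j =>
    Nat.div_le_div_right (Scheme.le_bump c.F u j _)
  by_cases hg : (κ, g.castSucc) ∈ c.cmds
  · refine ⟨b, t, fun j v hv => ?_, h2, fun j => (h3 j).trans (hle j), h4, h5⟩
    rcases Scheme.mem_report_K.1 hv with hv | ⟨_, hv⟩
    · exact h1 j v hv
    · exact absurd hg (mem_cur.1 hv).2.2.2
  refine ⟨b, fun j => Scheme.bump c.F u j κ.item / 2 ^ g.1, fun j v hv => ?_,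
    fun j => (h2 j).trans ((h3 j).trans (hle j)), fun j => le_rfl, h4, Or.inl ?_⟩
  · rcases Scheme.mem_report_K.1 hv with hv | ⟨_, hv⟩
    · exact ⟨(h1 j v hv).1, (h1 j v hv).2.trans ((h3 j).trans (hle j))⟩
    · rw [(mem_cur.1 hv).2.1]
      exact ⟨(h2 j).trans ((h3 j).trans (hle j)), le_rfl⟩
  · have hnd : ¬ τ κ ≤ 2 ^ g.1 * ((∑ j, topCount (c.K j) κ g) + if g.1 = 0 then 0 else k) :=
      fun hd => hg (hr.due_subset (mem_due.2 (Or.inr ⟨g, rfl, hc', hd⟩)))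
    have htop : ∀ j, topCount (c.K j) κ g = c.F j κ.item / 2 ^ g.1 := fun j =>
      topCount_eq ht hr.cur_subset j κ g
        ((Scheme.le_bump c.F u j κ.item).trans_lt (hF j κ.item)) hc' hg
    simp only [htop] at hnd
    have hsum := sum_bump_div_le c.F u κ.item g.1
    by_cases hg0 : g.1 = 0
    · simp only [hg0, pow_zero, one_mul, if_true, add_zero] at hnd hsum ⊢
      omega
    · simp only [hg0, if_false] at hnd
      refine le_trans (Nat.mul_le_mul_left _ (hsum.trans ?_)) (not_le.1 hnd).le
      omega

theorem Confined.exchange {κ : Key R n N Q} {g : Fin (G + 1)}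
    {c : TState R n N Q H G k}
    (hcur : ∀ j, (trackScheme R N Q H G k i₀ w hA hC).cur (θ j, U j) (c.F j) c.cmds ⊆ c.K j)
    (hj : Justified τ ((trackScheme R N Q H G k i₀ w hA hC).exchange (fun j => (θ j, U j)) τ c))
    (h : Confined τ κ g c) : Confined τ κ g
      ((trackScheme R N Q H G k i₀ w hA hC).exchange (fun j => (θ j, U j)) τ c) := by
  have hmono : ∀ a, a ∈ c.cmds →
      a ∈ ((trackScheme R N Q H G k i₀ w hA hC).exchange (fun j => (θ j, U j)) τ c).cmds :=
    fun a ha => mem_exchange_cmds.2 (Or.inl ha)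
  refine ⟨fun hc j v hv => ?_, fun hc => ?_⟩
  · rcases Scheme.mem_exchange_K.1 hv with hv | hv
    · exact h.idle (fun h => hc (hmono _ h)) j v hv
    · exact hc (mem_cur.1 hv).2.2.1
  by_cases hc' : (κ, g.succ) ∈ c.cmds
  · obtain ⟨b, t, h1, h2, h3, h4, h5⟩ := h.confined hc'
    refine ⟨b, t, fun j v hv => ?_, h2, h3, h4, h5⟩
    rcases Scheme.mem_exchange_K.1 hv with hv | hv
    · exact h1 j v hv
    · obtain ⟨e1, e2, _, e4⟩ := mem_cur.1 hv
      exact h1 j v (hcur j (mem_cur.2 ⟨e1, e2, hc', fun h => e4 (hmono _ h)⟩))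
  · refine ⟨fun j => c.F j κ.item / 2 ^ g.1, fun j => c.F j κ.item / 2 ^ g.1, fun j v hv => ?_,
      fun _ => le_rfl, fun _ => le_rfl, ?_, Or.inr rfl⟩
    · rcases Scheme.mem_exchange_K.1 hv with hv | hv
      · exact absurd hv (h.idle hc' j v)
      · have := (mem_cur.1 hv).2.1
        exact ⟨this.ge, this.le⟩
    · refine (hj.near κ g.succ hc).trans ?_
      have hle : stateFreq c κ.item ≤ 2 ^ g.1 * ((∑ j, c.F j κ.item / 2 ^ g.1) + k) := by
        calc stateFreq c κ.item ≤ ∑ j : Fin k, 2 ^ g.1 * (c.F j κ.item / 2 ^ g.1 + 1) :=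
              Finset.sum_le_sum fun j _ => (Nat.lt_mul_div_succ _ (by positivity)).le
          _ = _ := by rw [← Finset.mul_sum, Finset.sum_add_distrib]; simp
      have hs : stateFreq ((trackScheme R N Q H G k i₀ w hA hC).exchange
        (fun j => (θ j, U j)) τ c) κ.item = stateFreq c κ.item := rfl
      rw [hs, Fin.val_succ, pow_succ]
      nlinarith

theorem confined_run (hH : 1 ≤ H) (hk : 1 ≤ k) (hτ : ∀ κ, τ κ ≤ 2 ^ G)
    {s : DStream n k} (hs : s.length < 2 ^ G) (κ : Key R n N Q) (g : Fin (G + 1)) :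
    Confined τ κ g ((trackScheme R N Q H G k i₀ w hA hC).run (fun j => (θ j, U j)) τ s) :=
  (Scheme.run_induction (b := 2 ^ G) (quiet_track hH)
    (fun c => Truthful θ U c ∧ Justified τ c ∧ Confined τ κ g c)
    ⟨truthful_start, justified_start,
      ⟨fun _ _ _ h => absurd h (Finset.notMem_empty _),
        fun h => absurd h (Finset.notMem_empty _)⟩⟩
    (fun _ u hr hF h => ⟨h.1.report u, h.2.1.report u, h.2.2.report hk u hr hF h.1⟩)
    (fun _ hcur _ _ h => ⟨h.1.exchange, h.2.1.exchange hk hτ h.1,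
      h.2.2.exchange hcur (h.2.1.exchange hk hτ h.1)⟩) s hs).2.2

theorem Confined.sum_card_le {κ : Key R n N Q} {g : Fin (G + 1)} {c : TState R n N Q H G k}
    (h : Confined τ κ g c) :
    ∑ j, (Finset.univ.filter fun v => Sum.inr (Sum.inl (κ, g, v)) ∈ c.K j).card
      ≤ if (κ, g.succ) ∈ c.cmds then 4 * k else 0 := by
  split_ifs with hc
  · obtain ⟨b, t, h1, h2, -, h4, h5⟩ := h.confined hc
    have hcard : ∀ j, (Finset.univ.filter fun v => Sum.inr (Sum.inl (κ, g, v)) ∈ c.K j).card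
        + b j ≤ t j + 1 := by
      intro j
      have : (Finset.univ.filter fun v => Sum.inr (Sum.inl (κ, g, v)) ∈ c.K j).card
          ≤ (Finset.Icc (b j) (t j)).card := by
        refine Finset.card_le_card_of_injOn (fun v => v.1) (fun v hv => ?_)
          (Fin.val_injective.injOn)
        exact Finset.mem_coe.2 (Finset.mem_Icc.2 (h1 j v (Finset.mem_filter.1 hv).2))
      rw [Nat.card_Icc] at this
      have := h2 j
      omega
    have hsum := Finset.sum_le_sum fun j (_ : j ∈ Finset.univ) => hcard j
    rw [Finset.sum_add_distrib, Finset.sum_add_distrib] at hsum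
    simp only [Finset.sum_const, Finset.card_univ, Fintype.card_fin, smul_eq_mul, mul_one] at hsum
    rcases h5 with h5 | rfl
    · have : ∑ j, t j ≤ (∑ j, b j) + 3 * k :=
        Nat.le_of_mul_le_mul_left (h5.trans h4) (by positivity)
      omega
    · omega
  · rw [Nat.le_zero, Finset.sum_eq_zero_iff]
    intro j _
    rw [Finset.card_eq_zero, Finset.filter_eq_empty_iff]
    exact fun v _ => h.idle hc j v

/-- The item is watched: its rounded counts are announced. -/
def Watched (i₀ : Fin n) (c : Finset (TCmd R n N Q G)) (i : Fin n) : Prop :=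
  i = i₀ ∨ ∃ κ γ, (κ, γ) ∈ c ∧ κ.item = i

theorem watched_of_mem_run (hH : 1 ≤ H) {s : DStream n k} {j : Fin k} {i : Fin n}
    {ν : Fin (G + 2)} (h : (Sum.inr (Sum.inr (i, ν)) : TAtom R n N Q H G) ∈
      ((trackScheme R N Q H G k i₀ w hA hC).run (fun j => (θ j, U j)) τ s).K j) :
    Watched i₀ ((trackScheme R N Q H G k i₀ w hA hC).run (fun j => (θ j, U j)) τ s).cmds i := by
  revert j
  refine Scheme.run_induction (b := s.length + 1) (quiet_track hH)
    (fun c => ∀ {j : Fin k}, (Sum.inr (Sum.inr (i, ν)) : TAtom R n N Q H G) ∈ c.K j →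
      Watched i₀ c.cmds i)
    (fun h => absurd h (Finset.notMem_empty _)) ?_ ?_ s (by simp)
  · intro c u _ _ ih j hj
    rcases Scheme.mem_report_K.1 hj with hj | ⟨_, hj⟩
    · exact ih hj
    · exact (mem_cur.1 hj).2.2
  · intro c _ _ _ ih j hj
    rcases Scheme.mem_exchange_K.1 hj with hj | hj
    · rcases ih hj with h | ⟨κ, γ, h, h'⟩
      · exact Or.inl h
      · exact Or.inr ⟨κ, γ, mem_exchange_cmds.2 (Or.inl h), h'⟩
    · exact (mem_cur.1 hj).2.2

/-- Once a key is dead, no hits of it are announced any more. -/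
theorem hit_frozen (hH : 1 ≤ H) {s₁ s₂ : DStream n k} {κ : Key R n N Q}
    (hd : DeadKey ((trackScheme R N Q H G k i₀ w hA hC).run (fun j => (θ j, U j)) τ s₁).cmds κ)
    {j : Fin k} {h : Fin H} (hm : Sum.inl (κ, h) ∈
      ((trackScheme R N Q H G k i₀ w hA hC).run (fun j => (θ j, U j)) τ (s₁ ++ s₂)).K j) :
    Sum.inl (κ, h) ∈
      ((trackScheme R N Q H G k i₀ w hA hC).run (fun j => (θ j, U j)) τ s₁).K j := by
  rw [Scheme.run_append] at hm
  have hr := Scheme.run_rest (quiet_track (i₀ := i₀) (w := w) (hA := hA) (hC := hC)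
    (θ := θ) (U := U) (τ := τ) hH) s₁
  have hF := Scheme.run_F (S := trackScheme R N Q H G k i₀ w hA hC)
    (si := fun j => (θ j, U j)) (ci := τ) s₁
  generalize (trackScheme R N Q H G k i₀ w hA hC).run (fun j => (θ j, U j)) τ s₁ = c₁ at *
  refine ((Scheme.foldl_induction (b := s₁.length + s₂.length + 1)
    (fun c => DeadKey c.cmds κ ∧ (Sum.inl (κ, h) ∈ c.K j → Sum.inl (κ, h) ∈ c₁.K j))
    c₁ hr ⟨hd, id⟩ ?_ ?_ s₂ ?_).1).2 hm
  · rintro c u _ _ ⟨ih1, ih2⟩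
    refine ⟨ih1, fun hm => ?_⟩
    rcases Scheme.mem_report_K.1 hm with hm | ⟨_, hm⟩
    · exact ih2 hm
    · exact absurd ih1 (mem_cur.1 hm).2.2.2
  · rintro c _ _ _ ⟨ih1, ih2⟩
    have hd' : DeadKey ((trackScheme R N Q H G k i₀ w hA hC).exchange
        (fun j => (θ j, U j)) τ c).cmds κ := by
      obtain ⟨κ', h1, h2⟩ := ih1
      exact ⟨κ', mem_exchange_cmds.2 (Or.inl h1), h2⟩
    refine ⟨hd', fun hm => ?_⟩
    rcases Scheme.mem_exchange_K.1 hm with hm | hm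
    · exact ih2 hm
    · exact absurd hd' (mem_cur.1 hm).2.2.2
  · intro j i
    rw [hF]
    have := localFreq_le_length s₁ j i
    omega

/-- The size of the communication in terms of hits and tracked keys. -/
theorem card_run_le (hH : 1 ≤ H) (hk : 1 ≤ k) (hτ : ∀ κ, τ κ ≤ 2 ^ G)
    {s : DStream n k} (hs : s.length < 2 ^ G) {c : TState R n N Q H G k}
    (hc : c = (trackScheme R N Q H G k i₀ w hA hC).run (fun j => (θ j, U j)) τ s) :
    (∑ j, (c.K j).card) + k * c.cmds.card ≤
      (∑ κ : Key R n N Q, ∑ h : Fin H, ∑ j, if Sum.inl (κ, h) ∈ c.K j then 1 else 0)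
      + (∑ κ : Key R n N Q, if (κ, Fin.last (G + 1)) ∈ c.cmds then 1 else 0)
        * (6 * k * (G + 2)) + k * (G + 2) := by
  classical
  have hj : Justified τ c := hc ▸ (justified_run hH hk hτ s).2
  have hconf : ∀ κ g, Confined τ κ g c := fun κ g => hc ▸ confined_run hH hk hτ hs κ g
  have hw : ∀ j i (ν : Fin (G + 2)), (Sum.inr (Sum.inr (i, ν)) : TAtom R n N Q H G) ∈ c.K j →
      Watched i₀ c.cmds i := by
    subst hc
    exact fun j i ν h => watched_of_mem_run hH h
  set act : ℕ := ∑ κ : Key R n N Q, if (κ, Fin.last (G + 1)) ∈ c.cmds then 1 else 0 with hact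
  have hact' : act = (Finset.univ.filter fun κ : Key R n N Q =>
      (κ, Fin.last (G + 1)) ∈ c.cmds).card := by
    rw [hact, Finset.card_filter]
  have hcard : ∀ j, (c.K j).card =
      (∑ κ : Key R n N Q, ∑ h : Fin H, if Sum.inl (κ, h) ∈ c.K j then 1 else 0)
      + (∑ κ : Key R n N Q, ∑ g : Fin (G + 1),
          (Finset.univ.filter fun v => Sum.inr (Sum.inl (κ, g, v)) ∈ c.K j).card)
      + (Finset.univ.filter fun x => Sum.inr (Sum.inr x) ∈ c.K j).card := by
    intro j
    have h1 : (c.K j).card = ∑ a : TAtom R n N Q H G, if a ∈ c.K j then 1 else 0 := by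
      rw [← Finset.card_filter]; congr 1; ext; simp
    rw [h1, Fintype.sum_sum_type, Fintype.sum_sum_type, Fintype.sum_prod_type,
      Fintype.sum_prod_type, Finset.card_filter, ← add_assoc]
    refine congrArg₂ (· + ·) (congrArg₂ (· + ·) rfl ?_) rfl
    rw [Fintype.sum_prod_type]
    refine Finset.sum_congr rfl fun κ _ => ?_
    rw [Fintype.sum_prod_type]
    refine Finset.sum_congr rfl fun g _ => ?_
    rw [Finset.card_filter]
  have hrnd : ∀ j, (Finset.univ.filter fun x : Fin n × Fin (G + 2) =>
      Sum.inr (Sum.inr x) ∈ c.K j).card ≤ (act + 1) * (G + 2) := by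
    intro j
    let W : Finset (Fin n) := insert i₀ ((Finset.univ.filter fun κ : Key R n N Q =>
      (κ, Fin.last (G + 1)) ∈ c.cmds).image Key.item)
    have hW : W.card ≤ act + 1 := by
      refine (Finset.card_insert_le _ _).trans ?_
      rw [hact']
      exact Nat.add_le_add_right Finset.card_image_le 1
    calc (Finset.univ.filter fun x : Fin n × Fin (G + 2) =>
          Sum.inr (Sum.inr x) ∈ c.K j).card ≤ (W ×ˢ (Finset.univ : Finset (Fin (G + 2)))).card := by
          refine Finset.card_le_card fun x hx => ?_
          rw [Finset.mem_product]
          refine ⟨?_, Finset.mem_univ _⟩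
          rcases hw j x.1 x.2 (Finset.mem_filter.1 hx).2 with h | ⟨κ, γ, h1, h2⟩
          · rw [h]; exact Finset.mem_insert_self _ _
          · exact Finset.mem_insert_of_mem (Finset.mem_image.2
              ⟨κ, Finset.mem_filter.2 ⟨Finset.mem_univ _, hj.last_mem γ h1⟩, h2⟩)
      _ = W.card * (G + 2) := by simp
      _ ≤ _ := Nat.mul_le_mul_right _ hW
  have hcnt : ∑ j, ∑ κ : Key R n N Q, ∑ g : Fin (G + 1),
      (Finset.univ.filter fun v => Sum.inr (Sum.inl (κ, g, v)) ∈ c.K j).card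
      ≤ act * (4 * k * (G + 1)) := by
    rw [Finset.sum_comm, hact, Finset.sum_mul]
    refine Finset.sum_le_sum fun κ _ => ?_
    rw [Finset.sum_comm]
    calc _ ≤ ∑ _g : Fin (G + 1),
            (if (κ, Fin.last (G + 1)) ∈ c.cmds then 1 else 0) * (4 * k) := by
          refine Finset.sum_le_sum fun g _ => (hconf κ g).sum_card_le.trans ?_
          split_ifs with h1 h2
          · simp
          · exact absurd (hj.last_mem _ h1) h2
          · simp
          · simp
      _ = _ := by
          rw [Finset.sum_const, Finset.card_univ, Fintype.card_fin, smul_eq_mul]; ring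
  have hcmds : c.cmds.card ≤ act * (G + 2) := by
    calc c.cmds.card ≤ ((Finset.univ.filter fun κ : Key R n N Q =>
          (κ, Fin.last (G + 1)) ∈ c.cmds) ×ˢ (Finset.univ : Finset (Fin (G + 2)))).card := by
          refine Finset.card_le_card fun x hx => ?_
          rw [Finset.mem_product, Finset.mem_filter]
          exact ⟨⟨Finset.mem_univ _, hj.last_mem x.2 hx⟩, Finset.mem_univ _⟩
      _ = _ := by rw [Finset.card_product, hact']; simp
  have hhit : ∑ j, ∑ κ : Key R n N Q, ∑ h : Fin H,
      (if Sum.inl (κ, h) ∈ c.K j then (1 : ℕ) else 0)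
      = ∑ κ : Key R n N Q, ∑ h : Fin H, ∑ j, if Sum.inl (κ, h) ∈ c.K j then 1 else 0 := by
    rw [Finset.sum_comm]
    exact Finset.sum_congr rfl fun κ _ => Finset.sum_comm
  rw [Finset.sum_congr rfl fun j _ => hcard j, Finset.sum_add_distrib, Finset.sum_add_distrib,
    hhit]
  have hrnd' := Finset.sum_le_sum fun j (_ : j ∈ Finset.univ) => hrnd j
  simp only [Finset.sum_const, Finset.card_univ, Fintype.card_fin, smul_eq_mul] at hrnd'
  have h3 : k * c.cmds.card ≤ k * (act * (G + 2)) := Nat.mul_le_mul_left _ hcmds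
  nlinarith

/-! ### The estimate -/

/-- The largest rounded count of an item that has been announced. -/
def topRound (A : Finset (TAtom R n N Q H G)) (i : Fin n) : ℕ :=
  (Finset.univ.filter fun ν => (Sum.inr (Sum.inr (i, ν)) : TAtom R n N Q H G) ∈ A).sup
    fun ν : Fin (G + 2) => ν.1

/-- The value with a given rounded exponent. -/
def roundVal : ℕ → ℕ
  | 0 => 0
  | z + 1 => 2 ^ z

/-- The estimate of the frequency of an item. -/
def estimate (K : Fin k → Finset (TAtom R n N Q H G)) (i : Fin n) : ℕ :=
  ∑ j, roundVal (topRound (K j) i)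

theorem estimate_run (hH : 1 ≤ H) (hk : 1 ≤ k) (hτ : ∀ κ, τ κ ≤ 2 ^ G)
    {s : DStream n k} (hs : s.length < 2 ^ G) {i : Fin n}
    (hw : Watched i₀
      ((trackScheme R N Q H G k i₀ w hA hC).run (fun j => (θ j, U j)) τ s).cmds i) :
    estimate ((trackScheme R N Q H G k i₀ w hA hC).run (fun j => (θ j, U j)) τ s).K i
      = ∑ j, roundVal (roundExp G (U j).1 (localFreq s j i)) := by
  refine Finset.sum_congr rfl fun j _ => congrArg roundVal ?_
  have ht := (justified_run (i₀ := i₀) (w := w) (hA := hA) (hC := hC)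
    (θ := θ) (U := U) hH hk hτ s).1
  have hr := Scheme.run_rest (quiet_track (i₀ := i₀) (w := w) (hA := hA) (hC := hC)
    (θ := θ) (U := U) (τ := τ) hH) s
  rw [← Scheme.run_F (S := trackScheme R N Q H G k i₀ w hA hC)
    (si := fun j => (θ j, U j)) (ci := τ) s]
  have hlt : ∀ j i, ((trackScheme R N Q H G k i₀ w hA hC).run
      (fun j => (θ j, U j)) τ s).F j i < 2 ^ G := fun j i => by
    rw [Scheme.run_F]; exact (localFreq_le_length s j _).trans_lt hs
  generalize (trackScheme R N Q H G k i₀ w hA hC).run (fun j => (θ j, U j)) τ s = c at *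
  refine le_antisymm (Finset.sup_le fun ν hν => ht j _ (Finset.mem_filter.1 hν).2) ?_
  rcases Nat.eq_zero_or_pos (roundExp G (U j).1 (c.F j i)) with h0 | h0
  · omega
  have hmem : (Sum.inr (Sum.inr (i, ⟨_, roundExp_lt (hlt j i)⟩)) : TAtom R n N Q H G) ∈ c.K j :=
    hr.cur_subset j (mem_cur.2 ⟨h0, rfl, hw⟩)
  exact Finset.le_sup (f := fun ν : Fin (G + 2) => ν.1)
    (Finset.mem_filter.2 ⟨Finset.mem_univ (⟨_, roundExp_lt (hlt j i)⟩ : Fin (G + 2)), hmem⟩)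

/-! ### The sample -/

/-- The coordinate is the only one of its instance at the highest level. -/
def Wins (Φ : Set (Key R n N Q)) (x : Coord R n N) : Prop :=
  ∃ q, (x, q) ∈ Φ ∧ (∀ κ ∈ Φ, κ.1.1 = x.1 → κ.2 ≤ q) ∧
    ∀ y : Coord R n N, (y, q) ∈ Φ → y.1 = x.1 → y = x

theorem Wins.unique {Φ : Set (Key R n N Q)} {x y : Coord R n N} (hx : Wins Φ x) (hy : Wins Φ y)
    (h : x.1 = y.1) : x = y := by
  obtain ⟨q, h1, h2, h3⟩ := hx
  obtain ⟨q', h1', h2', h3'⟩ := hy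
  have : q = q' := le_antisymm (h2' _ h1 h) (h2 _ h1' h.symm)
  subst this
  exact (h3 _ h1' h.symm).symm

open Classical in
/-- The winner of the first instance that has one. -/
noncomputable def pick (x₀ : Coord R n N) (Φ : Set (Key R n N Q)) : Coord R n N :=
  if h : ∃ x, Wins Φ x ∧ ∀ y, Wins Φ y → x.1 ≤ y.1 then h.choose else x₀

theorem pick_eq {x₀ x : Coord R n N} {Φ : Set (Key R n N Q)} (hx : Wins Φ x)
    (hmin : ∀ y, Wins Φ y → x.1 ≤ y.1) : pick x₀ Φ = x := by
  have h : ∃ x, Wins Φ x ∧ ∀ y, Wins Φ y → x.1 ≤ y.1 := ⟨x, hx, hmin⟩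
  rw [pick, dif_pos h]
  exact h.choose_spec.1.unique hx (le_antisymm (h.choose_spec.2 _ hx) (hmin _ h.choose_spec.1))

theorem wins_pick {x₀ : Coord R n N} {Φ : Set (Key R n N Q)} (h : ∃ x, Wins Φ x) :
    Wins Φ (pick x₀ Φ) ∧ ∀ y, Wins Φ y → (pick x₀ Φ).1 ≤ y.1 := by
  obtain ⟨x, hx, hmin⟩ := Set.exists_min_image {x | Wins Φ x} (fun x => x.1) (Set.toFinite _) h
  have h' : ∃ x, Wins Φ x ∧ ∀ y, Wins Φ y → x.1 ≤ y.1 := ⟨x, hx, hmin⟩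
  rw [pick, dif_pos h']
  exact h'.choose_spec

theorem pick_of_not_exists {x₀ : Coord R n N} {Φ : Set (Key R n N Q)} (h : ¬ ∃ x, Wins Φ x) :
    pick x₀ Φ = x₀ := by
  rw [pick, dif_neg]
  rintro ⟨x, hx, _⟩
  exact h ⟨x, hx⟩

theorem wins_congr {Φ Ψ : Set (Key R n N Q)} (hsub : Φ ⊆ Ψ)
    (hdead : ∀ κ ∈ Ψ, κ ∈ Φ ∨ ∃ κ' ∈ Φ, κ'.1.1 = κ.1.1 ∧ κ.2 < κ'.2) (x : Coord R n N) :
    Wins Φ x ↔ Wins Ψ x := by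
  constructor
  · rintro ⟨q, h1, h2, h3⟩
    refine ⟨q, hsub h1, fun κ hκ hr => ?_, fun y hy hr => ?_⟩
    · rcases hdead κ hκ with h | ⟨κ', h, hr', hlt⟩
      · exact h2 κ h hr
      · exact hlt.le.trans (h2 κ' h (hr'.trans hr))
    · rcases hdead _ hy with h | ⟨κ', h, hr', hlt⟩
      · exact h3 y h hr
      · exact absurd (h2 κ' h (hr'.trans hr)) (not_le.2 hlt)
  · rintro ⟨q, h1, h2, h3⟩
    refine ⟨q, ?_, fun κ hκ hr => h2 κ (hsub hκ) hr, fun y hy hr => h3 y (hsub hy) hr⟩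
    rcases hdead _ h1 with h | ⟨κ', h, hr', hlt⟩
    · exact h
    · exact absurd (h2 κ' (hsub h) hr') (not_le.2 hlt)

theorem pick_congr {x₀ : Coord R n N} {Φ Ψ : Set (Key R n N Q)}
    (h : ∀ x, Wins Φ x ↔ Wins Ψ x) : pick x₀ Φ = pick x₀ Ψ := by
  by_cases he : ∃ x, Wins Ψ x
  · obtain ⟨h1, h2⟩ := wins_pick (x₀ := x₀) he
    exact pick_eq ((h _).2 h1) fun y hy => h2 y ((h y).1 hy)
  · rw [pick_of_not_exists he, pick_of_not_exists]
    simpa only [h] using he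

end Track

/-! ### The exponential distribution -/

instance isProbabilityMeasure_expMeasure_one : IsProbabilityMeasure (expMeasure 1) :=
  isProbabilityMeasure_expMeasure one_pos

theorem expMeasure_real_Iic {t : ℝ} (ht : 0 ≤ t) :
    (expMeasure 1).real (Set.Iic t) = 1 - Real.exp (-t) := by
  rw [← cdf_eq_real, cdf_expMeasure_eq one_pos, if_pos ht, one_mul]

theorem expMeasure_real_Ioi {t : ℝ} (ht : 0 ≤ t) :
    (expMeasure 1).real (Set.Ioi t) = Real.exp (-t) := by
  rw [← Set.compl_Iic, probReal_compl_eq_one_sub measurableSet_Iic, expMeasure_real_Iic ht]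
  ring

theorem expMeasure_real_Ioc {a b : ℝ} (ha : 0 ≤ a) (hab : a ≤ b) :
    (expMeasure 1).real (Set.Ioc a b) = Real.exp (-a) - Real.exp (-b) := by
  have h : Set.Ioc a b = Set.Iic b \ Set.Iic a := by ext; simp [and_comm]
  rw [h, measureReal_sdiff (Set.Iic_subset_Iic.2 hab) measurableSet_Iic,
    expMeasure_real_Iic ha, expMeasure_real_Iic (ha.trans hab)]
  ring

theorem expMeasure_Iic_le (t : ℝ) : expMeasure 1 (Set.Iic t) ≤ ENNReal.ofReal t := by
  rw [← ofReal_measureReal]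
  rcases le_or_gt 0 t with ht | ht
  · rw [expMeasure_real_Iic ht]
    exact ENNReal.ofReal_le_ofReal (by linarith [Real.add_one_le_exp (-t)])
  · rw [← cdf_eq_real, cdf_expMeasure_eq one_pos, if_neg ht.not_ge]
    simp

theorem expMeasure_Ioi_le (t : ℝ) :
    expMeasure 1 (Set.Ioi t) ≤ ENNReal.ofReal (Real.exp (-t)) := by
  rw [← ofReal_measureReal]
  rcases le_or_gt 0 t with ht | ht
  · rw [expMeasure_real_Ioi ht]
  · refine ENNReal.ofReal_le_ofReal (measureReal_le_one.trans ?_)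
    rw [Real.one_le_exp_iff]
    linarith

theorem expMeasure_ae_pos : ∀ᵐ x ∂expMeasure 1, 0 < x := by
  rw [ae_iff]
  simpa [Set.Iic] using expMeasure_Iic_le 0

/-- The law of a finite family of independent exponential variables. -/
noncomputable abbrev expPi (ι : Type) [Fintype ι] : Measure (ι → ℝ) :=
  Measure.pi fun _ => expMeasure 1

theorem measureReal_pi_pi {ι : Type} [Fintype ι] {α : ι → Type} [∀ i, MeasurableSpace (α i)]
    (μ : ∀ i, Measure (α i)) [∀ i, IsProbabilityMeasure (μ i)] (s : ∀ i, Set (α i)) :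
    (Measure.pi μ).real (Set.pi Set.univ s) = ∏ i, (μ i).real (s i) := by
  simp only [Measure.real, Measure.pi_pi, ENNReal.toReal_prod]

/-! ### The ideal sample -/

section Ideal

variable {R n N Q : ℕ} (lam : Fin n → ℝ)

/-- The largest value of the exponential variable of a copy of item `i` for level `q`. -/
noncomputable def upper (N : ℕ) (q : Fin (Q + 1)) (i : Fin n) : ℝ := lam i / (N * 2 ^ q.1)

/-- The width of the interval for level `q`, as a multiple of `lam i / N`. -/
noncomputable def levelWeight (q : Fin (Q + 1)) : ℝ :=
  if q.1 = Q then (2 ^ q.1)⁻¹ else (2 ^ (q.1 + 1))⁻¹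

theorem levelWeight_le_one (q : Fin (Q + 1)) : levelWeight q ≤ 1 := by
  unfold levelWeight
  split_ifs <;> exact inv_le_one_of_one_le₀ (one_le_pow₀ (by norm_num))

theorem le_levelWeight (q : Fin (Q + 1)) : ((2 : ℝ) ^ (q.1 + 1))⁻¹ ≤ levelWeight q := by
  unfold levelWeight
  split_ifs
  · gcongr <;> norm_num
  · rfl

/-- The largest value of the exponential variable for level `q + 1`. -/
noncomputable def lower (N : ℕ) (q : Fin (Q + 1)) (i : Fin n) : ℝ :=
  upper lam N q i - lam i * levelWeight q / N

theorem lower_eq (q : Fin (Q + 1)) (i : Fin n) :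
    lower lam N q i = if q.1 = Q then 0 else lam i / (N * 2 ^ (q.1 + 1)) := by
  unfold lower upper levelWeight
  split_ifs
  · rw [div_eq_mul_inv, mul_inv]; ring
  · rw [div_eq_mul_inv, div_eq_mul_inv, div_eq_mul_inv, mul_inv, mul_inv, pow_succ, mul_inv]; ring

/-- Outcomes of an instance in which the copy `y` is the only one at the highest level `q`. -/
def winBox (q : Fin (Q + 1)) (y : Fin n × Fin N) : Set (Fin n × Fin N → ℝ) :=
  Set.pi Set.univ fun z =>
    if z = y then Set.Ioc (lower lam N q y.1) (upper lam N q y.1) else Set.Ioi (upper lam N q z.1)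

theorem mem_winBox {q : Fin (Q + 1)} {y : Fin n × Fin N} {v : Fin n × Fin N → ℝ} :
    v ∈ winBox lam q y ↔ (lower lam N q y.1 < v y ∧ v y ≤ upper lam N q y.1) ∧
      ∀ z, z ≠ y → upper lam N q z.1 < v z := by
  simp only [winBox, Set.mem_pi, Set.mem_univ, true_imp_iff]
  constructor
  · refine fun h => ⟨by simpa using h y, fun z hz => by simpa [hz] using h z⟩
  · rintro ⟨h1, h2⟩ z
    split_ifs with hz
    · exact hz ▸ h1
    · exact h2 z hz

theorem measurableSet_winBox (q : Fin (Q + 1)) (y : Fin n × Fin N) :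
    MeasurableSet (winBox lam q y) := by
  refine MeasurableSet.univ_pi fun z => ?_
  split_ifs
  exacts [measurableSet_Ioc, measurableSet_Ioi]

variable {lam}

theorem upper_nonneg (h : ∀ i, 0 ≤ lam i) (q : Fin (Q + 1)) (i : Fin n) :
    0 ≤ upper lam N q i := div_nonneg (h i) (by positivity)

theorem lower_nonneg (h : ∀ i, 0 ≤ lam i) (q : Fin (Q + 1)) (i : Fin n) :
    0 ≤ lower lam N q i := by
  rw [lower_eq]
  split_ifs
  · rfl
  · exact div_nonneg (h i) (by positivity)

theorem lower_le_upper (h : ∀ i, 0 ≤ lam i) (q : Fin (Q + 1)) (i : Fin n) :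
    lower lam N q i ≤ upper lam N q i := by
  have h1 : 0 ≤ lam i * levelWeight q / N := by
    have : 0 ≤ levelWeight q := by unfold levelWeight; positivity
    have := h i
    positivity
  unfold lower
  linarith

theorem winBox_disjoint (h : ∀ i, 0 ≤ lam i) (hN : 1 ≤ N) {q q' : Fin (Q + 1)}
    {y y' : Fin n × Fin N}
    {v : Fin n × Fin N → ℝ} (hv : v ∈ winBox lam q y) (hv' : v ∈ winBox lam q' y') :
    q = q' ∧ y = y' := by
  wlog hq : q ≤ q' generalizing q q' y y'
  · have := this hv' hv (le_of_not_ge hq)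
    exact ⟨this.1.symm, this.2.symm⟩
  rw [mem_winBox] at hv hv'
  have hy' := hv'.1
  have hNpos : (0 : ℝ) < N := by exact_mod_cast hN
  have hy : y = y' := by
    by_contra hne
    have h1 := hv.2 y' (Ne.symm hne)
    have h2 : upper lam N q' y'.1 ≤ upper lam N q y'.1 := by
      refine div_le_div_of_nonneg_left (h _) (by positivity) ?_
      gcongr
      · norm_num
      · exact hq
    exact absurd (h1.trans_le (hy'.2.trans h2)) (lt_irrefl _)
  subst hy
  refine ⟨?_, rfl⟩
  by_contra hne
  have hlt : q < q' := lt_of_le_of_ne hq hne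
  have h1 := hv.1
  have hqQ : q.1 ≠ Q := by have := q'.2; have : q.1 < q'.1 := hlt; omega
  have h2 := h1.1
  rw [lower_eq, if_neg hqQ] at h2
  have h3 : upper lam N q' y.1 ≤ lam y.1 / (N * 2 ^ (q.1 + 1)) := by
    refine div_le_div_of_nonneg_left (h _) (by positivity) ?_
    gcongr
    · norm_num
    · exact hlt
  exact absurd (h2.trans_le (hy'.2.trans h3)) (lt_irrefl _)

theorem sum_upper (hN : 1 ≤ N) (q : Fin (Q + 1)) :
    ∑ z : Fin n × Fin N, upper lam N q z.1 = (∑ i, lam i) / 2 ^ q.1 := by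
  have hNpos : (0 : ℝ) < N := by exact_mod_cast hN
  rw [Fintype.sum_prod_type, Finset.sum_div]
  refine Finset.sum_congr rfl fun i _ => ?_
  simp only [upper, Finset.sum_const, Finset.card_univ, Fintype.card_fin, nsmul_eq_mul]
  field_simp

theorem measureReal_winBox (h : ∀ i, 0 ≤ lam i) (hN : 1 ≤ N) (q : Fin (Q + 1))
    (y : Fin n × Fin N) :
    (expPi (Fin n × Fin N)).real (winBox lam q y)
      = Real.exp (-((∑ i, lam i) / 2 ^ q.1))
        * (Real.exp (lam y.1 * levelWeight q / N) - 1) := by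
  rw [winBox, measureReal_pi_pi, ← Finset.mul_prod_erase _ _ (Finset.mem_univ y)]
  simp only [if_true]
  rw [expMeasure_real_Ioc (lower_nonneg h q y.1) (lower_le_upper h q y.1)]
  have h1 : ∀ z ∈ Finset.univ.erase y, (expMeasure 1).real
      (if z = y then Set.Ioc (lower lam N q y.1) (upper lam N q y.1)
        else Set.Ioi (upper lam N q z.1)) = Real.exp (-upper lam N q z.1) := by
    intro z hz
    rw [if_neg (Finset.ne_of_mem_erase hz), expMeasure_real_Ioi (upper_nonneg h q _)]
  rw [Finset.prod_congr rfl h1, ← Real.exp_sum]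
  have h2 : ∑ z ∈ Finset.univ.erase y, -upper lam N q z.1
      = upper lam N q y.1 - (∑ i, lam i) / 2 ^ q.1 := by
    rw [← sum_upper hN, ← Finset.add_sum_erase _ _ (Finset.mem_univ y), Finset.sum_neg_distrib]
    ring
  rw [h2, sub_mul, ← Real.exp_add, ← Real.exp_add, mul_sub, ← Real.exp_add, mul_one]
  congr 2
  · unfold lower; ring
  · ring

/-- Outcomes of an instance that item `i` wins. -/
def winSet (Q N : ℕ) (lam : Fin n → ℝ) (i : Fin n) : Set (Fin n × Fin N → ℝ) :=
  ⋃ a : Fin (Q + 1) × Fin N, winBox lam a.1 (i, a.2)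

theorem measurableSet_winSet (i : Fin n) : MeasurableSet (winSet Q N lam i) :=
  MeasurableSet.iUnion fun a => measurableSet_winBox lam a.1 _

theorem winSet_disjoint (h : ∀ i, 0 ≤ lam i) (hN : 1 ≤ N) {i i' : Fin n}
    {v : Fin n × Fin N → ℝ} (hv : v ∈ winSet Q N lam i) (hv' : v ∈ winSet Q N lam i') :
    i = i' := by
  obtain ⟨a, ha⟩ := Set.mem_iUnion.1 hv
  obtain ⟨a', ha'⟩ := Set.mem_iUnion.1 hv'
  exact congrArg Prod.fst (winBox_disjoint h hN ha ha').2

theorem measureReal_winSet (h : ∀ i, 0 ≤ lam i) (hN : 1 ≤ N) (i : Fin n) :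
    (expPi (Fin n × Fin N)).real (winSet Q N lam i)
      = ∑ q : Fin (Q + 1), N * (Real.exp (-((∑ i, lam i) / 2 ^ q.1))
        * (Real.exp (lam i * levelWeight q / N) - 1)) := by
  rw [winSet, measureReal_iUnion_fintype]
  · rw [Fintype.sum_prod_type]
    refine Finset.sum_congr rfl fun q _ => ?_
    simp only [measureReal_winBox h hN, Finset.sum_const, Finset.card_univ, Fintype.card_fin,
      nsmul_eq_mul]
  · intro a b hab
    refine Set.disjoint_left.2 fun v hv hv' => hab ?_
    obtain ⟨h1, h2⟩ := winBox_disjoint h hN hv hv'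
    exact Prod.ext h1 (Prod.ext_iff.1 h2).2
  · exact fun a => measurableSet_winBox lam a.1 _

/-- The common factor of the winning probabilities. -/
noncomputable def winWeight (Q : ℕ) (L : ℝ) : ℝ :=
  ∑ q : Fin (Q + 1), levelWeight q * Real.exp (-(L / 2 ^ q.1))

theorem le_measureReal_winSet (h : ∀ i, 0 ≤ lam i) (hN : 1 ≤ N) (i : Fin n) :
    lam i * winWeight Q (∑ i, lam i) ≤ (expPi (Fin n × Fin N)).real (winSet Q N lam i) := by
  have hNpos : (0 : ℝ) < N := by exact_mod_cast hN
  rw [measureReal_winSet h hN, winWeight, Finset.mul_sum]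
  refine Finset.sum_le_sum fun q _ => ?_
  have h1 := Real.add_one_le_exp (lam i * levelWeight q / N)
  calc lam i * (levelWeight q * Real.exp (-((∑ i, lam i) / 2 ^ q.1)))
      = N * (Real.exp (-((∑ i, lam i) / 2 ^ q.1)) * (lam i * levelWeight q / N)) := by
        field_simp
    _ ≤ _ := by gcongr; linarith

theorem measureReal_winSet_le (h : ∀ i, 0 ≤ lam i) (hN : 1 ≤ N) {ε : ℝ} (hε : ε ≤ 1)
    (hlam : (∑ i, lam i) / N ≤ ε) (i : Fin n) :
    (expPi (Fin n × Fin N)).real (winSet Q N lam i)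
      ≤ (1 + ε) * (lam i * winWeight Q (∑ i, lam i)) := by
  have hNpos : (0 : ℝ) < N := by exact_mod_cast hN
  rw [measureReal_winSet h hN, winWeight, Finset.mul_sum, Finset.mul_sum]
  refine Finset.sum_le_sum fun q _ => ?_
  have hw0 : 0 ≤ levelWeight q := by unfold levelWeight; positivity
  have hx0 : 0 ≤ lam i * levelWeight q / N :=
    div_nonneg (mul_nonneg (h i) hw0) hNpos.le
  have hxε : lam i * levelWeight q / N ≤ ε := by
    refine le_trans ?_ hlam
    gcongr
    calc lam i * levelWeight q ≤ lam i * 1 := by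
          gcongr
          · exact h i
          · exact levelWeight_le_one q
      _ ≤ _ := by rw [mul_one]; exact Finset.single_le_sum (fun i _ => h i) (Finset.mem_univ i)
  have h1 := Real.abs_exp_sub_one_sub_id_le (x := lam i * levelWeight q / N)
    (by rw [abs_of_nonneg hx0]; linarith)
  have h2 : Real.exp (lam i * levelWeight q / N) - 1 ≤ (1 + ε) * (lam i * levelWeight q / N) := by
    have := (abs_le.1 h1).2
    nlinarith
  calc N * (Real.exp (-((∑ i, lam i) / 2 ^ q.1)) * (Real.exp (lam i * levelWeight q / N) - 1))
      ≤ N * (Real.exp (-((∑ i, lam i) / 2 ^ q.1)) * ((1 + ε) * (lam i * levelWeight q / N))) := by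
        gcongr
    _ = _ := by field_simp

theorem winWeight_ge {L : ℝ} (h1 : 1 ≤ L) (h2 : L ≤ 2 ^ Q) : 1 / 16 ≤ L * winWeight Q L := by
  obtain ⟨q, hq1, hq2⟩ := exists_nat_pow_near h1 (by norm_num : (1 : ℝ) < 2)
  have hqQ : q ≤ Q := by
    have := hq1.trans h2
    exact (pow_le_pow_iff_right₀ (by norm_num : (1 : ℝ) < 2)).1 this
  have hle : levelWeight (⟨q, by omega⟩ : Fin (Q + 1)) * Real.exp (-(L / 2 ^ q)) ≤ winWeight Q L :=
    Finset.single_le_sum (f := fun q : Fin (Q + 1) => levelWeight q * Real.exp (-(L / 2 ^ q.1)))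
      (fun q _ => mul_nonneg (by unfold levelWeight; positivity) (Real.exp_pos _).le)
      (Finset.mem_univ _)
  have hw := le_levelWeight (⟨q, by omega⟩ : Fin (Q + 1))
  have hexp : 1 / 8 ≤ Real.exp (-(L / 2 ^ q)) := by
    have h3 : L / 2 ^ q ≤ 2 := by
      rw [div_le_iff₀ (by positivity)]
      rw [pow_succ] at hq2; linarith
    have h4 : Real.exp (-2) ≤ Real.exp (-(L / 2 ^ q)) := Real.exp_le_exp.2 (by linarith)
    refine le_trans ?_ h4
    rw [Real.exp_neg, one_div]
    have h5 : Real.exp 2 ≤ 8 := by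
      have := Real.exp_one_lt_d9
      have h6 : Real.exp 2 = Real.exp 1 * Real.exp 1 := by rw [← Real.exp_add]; norm_num
      rw [h6]
      nlinarith [Real.exp_pos 1]
    exact inv_anti₀ (Real.exp_pos _) h5
  have hL : 1 / 2 ≤ L * levelWeight (⟨q, by omega⟩ : Fin (Q + 1)) := by
    calc (1 : ℝ) / 2 = 2 ^ q * (2 ^ (q + 1))⁻¹ := by rw [pow_succ]; field_simp
      _ ≤ L * levelWeight (⟨q, by omega⟩ : Fin (Q + 1)) := by gcongr
  calc (1 : ℝ) / 16 = 1 / 2 * (1 / 8) := by norm_num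
    _ ≤ (L * levelWeight (⟨q, by omega⟩ : Fin (Q + 1))) * Real.exp (-(L / 2 ^ q)) := by gcongr
    _ = L * (levelWeight (⟨q, by omega⟩ : Fin (Q + 1)) * Real.exp (-(L / 2 ^ q))) := by ring
    _ ≤ _ := by gcongr

/-- Outcomes in which instance `r` is the first that some item wins, and item `i` wins it. -/
def firstWin (Q : ℕ) (lam : Fin n → ℝ) (r : Fin R) (i : Fin n) :
    Set (Fin R → Fin n × Fin N → ℝ) :=
  Set.pi Set.univ fun r' => if r' < r then (⋃ i, winSet Q N lam i)ᶜ
    else if r' = r then winSet Q N lam i else Set.univ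

/-- Outcomes in which item `i` wins the first instance that some item wins. -/
def sampleSet (R N Q : ℕ) (lam : Fin n → ℝ) (i : Fin n) : Set (Fin R → Fin n × Fin N → ℝ) :=
  ⋃ r, firstWin Q lam r i

theorem mem_firstWin {r : Fin R} {i : Fin n} {v : Fin R → Fin n × Fin N → ℝ} :
    v ∈ firstWin Q lam r i ↔ v r ∈ winSet Q N lam i ∧
      ∀ r' < r, ∀ i', v r' ∉ winSet Q N lam i' := by
  simp only [firstWin, Set.mem_pi, Set.mem_univ, true_imp_iff]
  constructor
  · intro h
    refine ⟨by simpa using h r, fun r' hr i' hi => ?_⟩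
    have := h r'
    simp only [hr, if_true] at this
    exact this (Set.mem_iUnion.2 ⟨i', hi⟩)
  · rintro ⟨h1, h2⟩ r'
    split_ifs with h3 h4
    · simpa using h2 r' h3
    · exact h4 ▸ h1
    · trivial

theorem measurableSet_sampleSet (i : Fin n) : MeasurableSet (sampleSet R N Q lam i) := by
  refine MeasurableSet.iUnion fun r => MeasurableSet.univ_pi fun r' => ?_
  split_ifs
  · exact (MeasurableSet.iUnion fun i => measurableSet_winSet i).compl
  · exact measurableSet_winSet i
  · exact MeasurableSet.univ

theorem firstWin_disjoint (h : ∀ i, 0 ≤ lam i) (hN : 1 ≤ N) {r r' : Fin R} {i i' : Fin n}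
    {v : Fin R → Fin n × Fin N → ℝ} (hv : v ∈ firstWin Q lam r i)
    (hv' : v ∈ firstWin Q lam r' i') : r = r' ∧ i = i' := by
  rw [mem_firstWin] at hv hv'
  have hr : r = r' := by
    rcases lt_trichotomy r r' with hlt | heq | hlt
    · exact absurd hv.1 (hv'.2 r hlt i)
    · exact heq
    · exact absurd hv'.1 (hv.2 r' hlt i')
  subst hr
  exact ⟨rfl, winSet_disjoint h hN hv.1 hv'.1⟩

theorem sampleSet_disjoint (h : ∀ i, 0 ≤ lam i) (hN : 1 ≤ N) {i i' : Fin n}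
    {v : Fin R → Fin n × Fin N → ℝ} (hv : v ∈ sampleSet R N Q lam i)
    (hv' : v ∈ sampleSet R N Q lam i') : i = i' := by
  obtain ⟨r, hr⟩ := Set.mem_iUnion.1 hv
  obtain ⟨r₁, hr₁⟩ := Set.mem_iUnion.1 hv'
  exact (firstWin_disjoint h hN hr hr₁).2

/-- The law of the exponential variables of all instances. -/
noncomputable abbrev expLaw (R n N : ℕ) : Measure (Fin R → Fin n × Fin N → ℝ) :=
  Measure.pi fun _ => expPi (Fin n × Fin N)

theorem measureReal_sampleSet (h : ∀ i, 0 ≤ lam i) (hN : 1 ≤ N) (i : Fin n) :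
    (expLaw R n N).real (sampleSet R N Q lam i) = ∑ r : Fin R,
      (1 - ∑ i, (expPi (Fin n × Fin N)).real (winSet Q N lam i)) ^ r.1
        * (expPi (Fin n × Fin N)).real (winSet Q N lam i) := by
  rw [sampleSet, measureReal_iUnion_fintype]
  · refine Finset.sum_congr rfl fun r _ => ?_
    rw [firstWin, measureReal_pi_pi]
    have hc : (expPi (Fin n × Fin N)).real (⋃ i, winSet Q N lam i)ᶜ
        = 1 - ∑ i, (expPi (Fin n × Fin N)).real (winSet Q N lam i) := by
      rw [probReal_compl_eq_one_sub (MeasurableSet.iUnion fun i => measurableSet_winSet i),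
        measureReal_iUnion_fintype]
      · intro a b hab
        exact Set.disjoint_left.2 fun v hv hv' => hab (winSet_disjoint h hN hv hv')
      · exact fun i => measurableSet_winSet i
    have hf : ∀ r' : Fin R, (expPi (Fin n × Fin N)).real
        (if r' < r then (⋃ i, winSet Q N lam i)ᶜ
          else if r' = r then winSet Q N lam i else Set.univ)
        = (if r' < r then 1 - ∑ i, (expPi (Fin n × Fin N)).real (winSet Q N lam i) else 1)
          * (if r' = r then (expPi (Fin n × Fin N)).real (winSet Q N lam i) else 1) := by
      intro r'
      by_cases h1 : r' < r
      · rw [if_pos h1, if_pos h1, if_neg h1.ne, hc, mul_one]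
      · by_cases h2 : r' = r
        · simp [h2]
        · simp [h1, h2]
    rw [Finset.prod_congr rfl fun r' _ => hf r', Finset.prod_mul_distrib,
      Finset.prod_ite_eq' Finset.univ r, if_pos (Finset.mem_univ r), Finset.prod_ite,
      Finset.prod_const_one, mul_one, Finset.prod_const]
    rw [show (Finset.univ.filter fun r' : Fin R => r' < r) = Finset.Iio r by ext; simp,
      Fin.card_Iio]
  · intro a b hab
    exact Set.disjoint_left.2 fun v hv hv' => hab (firstWin_disjoint h hN hv hv').1
  · intro r
    refine MeasurableSet.univ_pi fun r' => ?_
    split_ifs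
    · exact (MeasurableSet.iUnion fun i => measurableSet_winSet i).compl
    · exact measurableSet_winSet i
    · exact MeasurableSet.univ

/-- The ideal sample has nearly the distribution proportional to `lam`. -/
theorem sampleSet_bounds (h : ∀ i, 0 ≤ lam i) (hN : 1 ≤ N) (h1 : 1 ≤ ∑ i, lam i)
    (h2 : ∑ i, lam i ≤ 2 ^ Q) {ε : ℝ} (hε : ε ≤ 1) (hlam : (∑ i, lam i) / N ≤ ε) :
    (∀ i, |(expLaw R n N).real (sampleSet R N Q lam i) - lam i / ∑ i, lam i|
      ≤ ε + (15 / 16) ^ R) ∧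
    1 - (15 / 16) ^ R ≤ ∑ i, (expLaw R n N).real (sampleSet R N Q lam i) := by
  set L := ∑ i, lam i with hL
  have hNpos : (0 : ℝ) < N := by exact_mod_cast hN
  have hε0 : 0 ≤ ε := le_trans (by positivity) hlam
  set σ : Fin n → ℝ := fun i => (expPi (Fin n × Fin N)).real (winSet Q N lam i) with hσ
  set W := winWeight Q L
  have hlo : ∀ i, lam i * W ≤ σ i := fun i => le_measureReal_winSet h hN i
  have hhi : ∀ i, σ i ≤ (1 + ε) * (lam i * W) := fun i => measureReal_winSet_le h hN hε hlam i
  have hLW : 1 / 16 ≤ L * W := winWeight_ge h1 h2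
  set S := ∑ i, σ i with hS
  have hSlo : L * W ≤ S := by
    rw [hL, Finset.sum_mul]; exact Finset.sum_le_sum fun i _ => hlo i
  have hShi : S ≤ (1 + ε) * (L * W) := by
    rw [hL, Finset.sum_mul, Finset.mul_sum]; exact Finset.sum_le_sum fun i _ => hhi i
  have hS1 : S ≤ 1 := by
    have : S = (expPi (Fin n × Fin N)).real (⋃ i, winSet Q N lam i) := by
      rw [measureReal_iUnion_fintype]
      · intro a b hab
        exact Set.disjoint_left.2 fun v hv hv' => hab (winSet_disjoint h hN hv hv')
      · exact fun i => measurableSet_winSet i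
    rw [this]
    exact measureReal_le_one
  have hSpos : 0 < S := by linarith
  have hLpos : 0 < L := by linarith
  have hWpos : 0 < W := by
    by_contra hW
    have : L * W ≤ 0 := mul_nonpos_of_nonneg_of_nonpos hLpos.le (not_lt.1 hW)
    linarith
  set δ := (1 - S) ^ R with hδ
  have hδ0 : 0 ≤ δ := pow_nonneg (by linarith) _
  have hδ1 : δ ≤ (15 / 16) ^ R := pow_le_pow_left₀ (by linarith) (by linarith) _
  have hδ2 : δ ≤ 1 := pow_le_one₀ (by linarith) (by linarith)
  have hval : ∀ i, (expLaw R n N).real (sampleSet R N Q lam i) = σ i / S * (1 - δ) := by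
    intro i
    rw [measureReal_sampleSet h hN, ← Finset.sum_mul,
      Fin.sum_univ_eq_sum_range (fun r => (1 - S) ^ r) R, geom_sum_eq (by linarith)]
    rw [hδ]
    have : 1 - S - 1 = -S := by ring
    rw [this]
    field_simp
    ring
  constructor
  · intro i
    rw [hval]
    have ha : σ i / S ≤ lam i / L + ε := by
      have hi1 : lam i / L ≤ 1 := by
        rw [div_le_one hLpos]
        exact Finset.single_le_sum (fun i _ => h i) (Finset.mem_univ i)
      calc σ i / S ≤ ((1 + ε) * (lam i * W)) / (L * W) := by
            gcongr
            · have := h i; positivity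
            · exact hhi i
        _ = lam i / L + ε * (lam i / L) := by field_simp
        _ ≤ lam i / L + ε * 1 := by gcongr
        _ = _ := by ring
    have hb : lam i / L - ε ≤ σ i / S := by
      have hi1 : lam i / L ≤ 1 := by
        rw [div_le_one hLpos]
        exact Finset.single_le_sum (fun i _ => h i) (Finset.mem_univ i)
      have hi0 : 0 ≤ lam i / L := div_nonneg (h i) hLpos.le
      calc lam i / L - ε ≤ lam i / L / (1 + ε) := by
            rw [le_div_iff₀ (by linarith)]
            nlinarith
        _ = (lam i * W) / ((1 + ε) * (L * W)) := by field_simp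
        _ ≤ σ i / S := by
            have h0 : 0 ≤ lam i * W := mul_nonneg (h i) hWpos.le
            exact div_le_div₀ (h0.trans (hlo i)) (hlo i) hSpos hShi
    have hc0 : 0 ≤ σ i / S := div_nonneg measureReal_nonneg hSpos.le
    have hc1 : σ i / S ≤ 1 := by
      rw [div_le_one hSpos]
      exact Finset.single_le_sum (f := σ) (fun i _ => measureReal_nonneg) (Finset.mem_univ i)
    rw [abs_le]
    constructor <;> nlinarith
  · rw [Finset.sum_congr rfl fun i _ => hval i, ← Finset.sum_mul, ← Finset.sum_div,
      div_self hSpos.ne', one_mul]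
    linarith

/-- The keys whose scaled value has reached their level. -/
def reachedKeys (lam : Fin n → ℝ) (v : Fin R → Fin n × Fin N → ℝ) : Set (Key R n N Q) :=
  {κ | N * 2 ^ κ.2.1 * v κ.1.1 κ.1.2 ≤ lam κ.item}

theorem wins_iff {v : Fin R → Fin n × Fin N → ℝ} (hv : ∀ r y, 0 < v r y) (hN : 1 ≤ N)
    (x : Coord R n N) :
    Wins (reachedKeys (Q := Q) lam v) x ↔ ∃ q : Fin (Q + 1), v x.1 ∈ winBox lam q x.2 := by
  have hNpos : (0 : ℝ) < N := by exact_mod_cast hN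
  have hup : ∀ (r : Fin R) (y : Fin n × Fin N) (q : Fin (Q + 1)),
      (((r, y), q) : Key R n N Q) ∈ reachedKeys lam v ↔ v r y ≤ upper lam N q y.1 := by
    intro r y q
    rw [upper, le_div_iff₀ (by positivity), mul_comm]
    rfl
  have hmono : ∀ (r : Fin R) (y : Fin n × Fin N) (q q' : Fin (Q + 1)), q ≤ q' →
      (((r, y), q') : Key R n N Q) ∈ reachedKeys lam v →
      (((r, y), q) : Key R n N Q) ∈ reachedKeys lam v := by
    intro r y q q' hq h
    refine le_trans (b := (N : ℝ) * 2 ^ q'.1 * v r y) ?_ h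
    change (N : ℝ) * 2 ^ q.1 * v r y ≤ _
    have := hv r y
    have h2 : (2 : ℝ) ^ q.1 ≤ 2 ^ q'.1 := pow_le_pow_right₀ (by norm_num) hq
    gcongr
  constructor
  · rintro ⟨q, h1, h2, h3⟩
    refine ⟨q, (mem_winBox lam).2 ⟨⟨?_, (hup x.1 x.2 q).1 h1⟩, fun z hz => ?_⟩⟩
    · rw [lower_eq]
      split_ifs with hq
      · exact hv _ _
      · by_contra hlt
        have hqlt : q.1 + 1 < Q + 1 := by have := q.2; omega
        have : ((x, ⟨q.1 + 1, hqlt⟩) : Key R n N Q) ∈ reachedKeys lam v :=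
          (hup x.1 x.2 ⟨q.1 + 1, hqlt⟩).2 (not_lt.1 hlt)
        have h4 := h2 _ this rfl
        rw [Fin.le_def] at h4
        simp at h4
    · by_contra hlt
      have := h3 (x.1, z) ((hup x.1 z q).2 (not_lt.1 hlt)) rfl
      exact hz (congrArg Prod.snd this)
  · rintro ⟨q, h⟩
    rw [mem_winBox] at h
    have hx := h.1
    have hz : ∀ z, z ≠ x.2 → (((x.1, z), q) : Key R n N Q) ∉ reachedKeys lam v := by
      intro z hz hmem
      have h1 := h.2 z hz
      exact absurd ((hup x.1 z q).1 hmem) (not_le.2 h1)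
    refine ⟨q, (hup x.1 x.2 q).2 hx.2, ?_, ?_⟩
    · rintro ⟨⟨r, z⟩, q'⟩ hκ hr
      have hr : r = x.1 := hr
      subst hr
      by_contra hle
      have hlt : q < q' := not_le.1 hle
      by_cases hzx : z = x.2
      · subst hzx
        have hqQ : q.1 ≠ Q := by have := q'.2; have : q.1 < q'.1 := hlt; omega
        have h1 := hx.1
        rw [lower_eq, if_neg hqQ] at h1
        have hqlt : q.1 + 1 < Q + 1 := by have := q.2; omega
        have h2 := (hup x.1 x.2 ⟨q.1 + 1, hqlt⟩).1
          (hmono x.1 x.2 ⟨q.1 + 1, hqlt⟩ q' hlt hκ)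
        exact absurd h2 (not_le.2 h1)
      · exact hz z hzx (hmono _ _ _ _ hlt.le hκ)
    · rintro ⟨r, z⟩ hy hr
      have hr : r = x.1 := hr
      subst hr
      by_contra hne
      refine hz z (fun h => hne ?_) hy
      rw [h]

theorem exists_wins_of_mem_sampleSet {v : Fin R → Fin n × Fin N → ℝ} (hv : ∀ r y, 0 < v r y)
    (hN : 1 ≤ N) {i : Fin n} (h : v ∈ sampleSet R N Q lam i) :
    ∃ x : Coord R n N, x.2.1 = i ∧ Wins (reachedKeys (Q := Q) lam v) x ∧
      ∀ y, Wins (reachedKeys (Q := Q) lam v) y → x.1 ≤ y.1 := by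
  obtain ⟨r, hr⟩ := Set.mem_iUnion.1 h
  rw [mem_firstWin] at hr
  obtain ⟨⟨q, l⟩, hq⟩ := Set.mem_iUnion.1 hr.1
  refine ⟨(r, i, l), rfl, (wins_iff hv hN _).2 ⟨q, hq⟩, fun y hy => ?_⟩
  obtain ⟨q', hq'⟩ := (wins_iff hv hN _).1 hy
  by_contra hlt
  exact hr.2 y.1 (not_le.1 hlt) y.2.1 (Set.mem_iUnion.2 ⟨(q', y.2.2), hq'⟩)

end Ideal

/-! ### Random thresholds -/

/-- The real frequency at which a key with exponential variable `x` reaches level `q`. -/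
noncomputable def reach (p : ℝ) (N q : ℕ) (x : ℝ) : ℝ := (N * 2 ^ q * x) ^ (1 / p)

/-- The local count at which a server announces a hit, for a threshold `t` and the random
number `y`. -/
noncomputable def hitThreshold (ρ : ℝ) (k : ℕ) (t y : ℝ) : ℕ := ⌈t / (4 * k) + t * y / ρ⌉₊

theorem measurable_reach (p : ℝ) (N q : ℕ) : Measurable (reach p N q) := by
  unfold reach; fun_prop

theorem reach_pos {p : ℝ} {N q : ℕ} {x : ℝ} (hN : 1 ≤ N) (hx : 0 < x) : 0 < reach p N q x := by
  have hNpos : (0 : ℝ) < N := by exact_mod_cast hN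
  unfold reach; positivity

theorem reach_rpow {p : ℝ} {N q : ℕ} {x : ℝ} (hp : 1 ≤ p) (hx : 0 ≤ x) :
    reach p N q x ^ p = N * 2 ^ q * x := by
  unfold reach
  rw [← Real.rpow_mul (by positivity), one_div, inv_mul_cancel₀ (by linarith), Real.rpow_one]

theorem reach_le_iff {p : ℝ} {N q : ℕ} {x y : ℝ} (hp : 1 ≤ p) (hx : 0 ≤ x) (hy : 0 ≤ y) :
    reach p N q x ≤ y ↔ N * 2 ^ q * x ≤ y ^ p := by
  rw [← reach_rpow hp hx]
  exact (Real.rpow_le_rpow_iff (by unfold reach; positivity) hy (by linarith)).symm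

theorem hitThreshold_le_iff {ρ : ℝ} (hρ : 0 < ρ) {k : ℕ} {t : ℝ} (ht : 0 < t) {y : ℝ}
    {f : ℕ} :
    hitThreshold ρ k t y ≤ f ↔ y ≤ ρ * (f / t - 1 / (4 * k)) := by
  rw [hitThreshold, Nat.ceil_le]
  have h1 : t / (4 * k) + t * y / ρ ≤ f ↔ t * y / ρ ≤ t * (f / t - 1 / (4 * k)) := by
    have : t * (f / t - 1 / (4 * k)) = f - t / (4 * k) := by field_simp
    rw [this]
    constructor <;> intro h <;> linarith
  rw [h1, mul_div_assoc, mul_le_mul_iff_right₀ ht, div_le_iff₀ hρ, mul_comm ρ]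

theorem expMeasure_hit_le {ρ : ℝ} (hρ : 0 < ρ) {k : ℕ} {t : ℝ} (ht : 0 < t) (f : ℕ) :
    expMeasure 1 {y | 1 ≤ f ∧ hitThreshold ρ k t y ≤ f}
      ≤ ENNReal.ofReal (ρ * (f / t - 1 / (4 * k))) := by
  refine (measure_mono ?_).trans (expMeasure_Iic_le _)
  exact fun y hy => (hitThreshold_le_iff hρ ht).1 hy.2

theorem expMeasure_hit_le_rpow {p : ℝ} (hp : 1 ≤ p) {ρ : ℝ} (hρ : 0 < ρ) {k : ℕ} (hk : 1 ≤ k)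
    {t : ℝ} (ht : 0 < t) (f : ℕ) :
    expMeasure 1 {y | 1 ≤ f ∧ hitThreshold ρ k t y ≤ f}
      ≤ ENNReal.ofReal (ρ * (4 * k) ^ (p - 1) * f ^ p / t ^ p) := by
  refine (expMeasure_hit_le hρ ht f).trans (ENNReal.ofReal_le_ofReal ?_)
  have hkpos : (0 : ℝ) < k := by exact_mod_cast hk
  rcases le_or_gt ((f : ℝ) / t) (1 / (4 * k)) with h | h
  · calc ρ * (f / t - 1 / (4 * k)) ≤ 0 :=
          mul_nonpos_of_nonneg_of_nonpos hρ.le (by linarith)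
      _ ≤ _ := by positivity
  · have hy : (0 : ℝ) < f / t := lt_trans (by positivity) h
    have h1 : (f / t : ℝ) ≤ (4 * k) ^ (p - 1) * (f / t) ^ p := by
      have h2 : 1 ≤ (4 * k * (f / t)) ^ (p - 1) := by
        refine Real.one_le_rpow ?_ (by linarith)
        rw [div_lt_iff₀ (by positivity)] at h
        linarith
      rw [Real.mul_rpow (by positivity) hy.le] at h2
      calc (f / t : ℝ) = 1 * (f / t) := by ring
        _ ≤ ((4 * k) ^ (p - 1) * (f / t) ^ (p - 1)) * (f / t) := by gcongr
        _ = (4 * k) ^ (p - 1) * ((f / t) ^ (p - 1) * (f / t) ^ (1 : ℝ)) := by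
            rw [Real.rpow_one]; ring
        _ = _ := by rw [← Real.rpow_add hy]; ring_nf
    rw [Real.div_rpow (by positivity) ht.le] at h1
    calc ρ * (f / t - 1 / (4 * k)) ≤ ρ * (f / t) := by
          gcongr
          have : (0 : ℝ) ≤ 1 / (4 * k) := by positivity
          linarith
      _ ≤ ρ * ((4 * k) ^ (p - 1) * (f ^ p / t ^ p)) := by gcongr
      _ = _ := by ring

/-- The law of the random numbers that decide about hits. -/
noncomputable abbrev hitLaw (H k : ℕ) : Measure (Fin H → Fin k → ℝ) :=
  Measure.pi fun _ => expPi (Fin k)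

/-- An item that has reached its threshold is hit in all groups, except with small probability. -/
theorem hitLaw_miss_le {H k : ℕ} (hk : 1 ≤ k) {ρ : ℝ} (hρ : 0 < ρ) {t : ℝ} (ht : 0 < t)
    (f : Fin k → ℕ) (hf : t ≤ ∑ j, (f j : ℝ)) :
    hitLaw H k {E | ¬ ∀ h, ∃ j, 1 ≤ f j ∧ hitThreshold ρ k t (E h j) ≤ f j}
      ≤ ENNReal.ofReal (H * Real.exp (-(3 / 4 * ρ))) := by
  have hkpos : (0 : ℝ) < k := by exact_mod_cast hk
  have hsub : {E : Fin H → Fin k → ℝ |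
      ¬ ∀ h, ∃ j, 1 ≤ f j ∧ hitThreshold ρ k t (E h j) ≤ f j}
      ⊆ ⋃ h, Function.eval h ⁻¹' (Set.pi Set.univ fun j : Fin k =>
        {y : ℝ | ¬ (1 ≤ f j ∧ hitThreshold ρ k t y ≤ f j)}) := by
    intro E hE
    simp only [Set.mem_ofPred_eq, not_forall, not_exists] at hE
    obtain ⟨h, hh⟩ := hE
    exact Set.mem_iUnion.2 ⟨h, fun j _ => hh j⟩
  have hone : ∀ j, expMeasure 1 {y : ℝ | ¬ (1 ≤ f j ∧ hitThreshold ρ k t y ≤ f j)}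
      ≤ ENNReal.ofReal (Real.exp (-(ρ * (f j / t - 1 / (4 * k))))) := by
    intro j
    by_cases h0 : 1 ≤ f j
    · refine (measure_mono ?_).trans (expMeasure_Ioi_le _)
      intro y hy
      simp only [h0, true_and, Set.mem_ofPred_eq] at hy
      rw [hitThreshold_le_iff hρ ht] at hy
      exact not_le.1 hy
    · have hz : f j = 0 := by omega
      refine prob_le_one.trans ?_
      rw [← ENNReal.ofReal_one]
      refine ENNReal.ofReal_le_ofReal (Real.one_le_exp ?_)
      rw [hz]
      have : 0 ≤ ρ * (1 / (4 * k)) := by positivity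
      simp only [Nat.cast_zero, zero_div, zero_sub]
      linarith
  have hgroup : ∀ h : Fin H, hitLaw H k (Function.eval h ⁻¹' (Set.pi Set.univ fun j : Fin k =>
        {y : ℝ | ¬ (1 ≤ f j ∧ hitThreshold ρ k t y ≤ f j)}))
      ≤ ENNReal.ofReal (Real.exp (-(3 / 4 * ρ))) := by
    intro h
    have hle : (hitLaw H k).map (Function.eval h) = expPi (Fin k) :=
      (measurePreserving_eval (fun _ : Fin H => expPi (Fin k)) h).map_eq
    refine (Measure.le_map_apply (measurable_pi_apply h).aemeasurable _).trans ?_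
    rw [hle, Measure.pi_pi]
    refine (Finset.prod_le_prod' fun j _ => hone j).trans ?_
    rw [← ENNReal.ofReal_prod_of_nonneg fun j _ => (Real.exp_pos _).le, ← Real.exp_sum]
    refine ENNReal.ofReal_le_ofReal (Real.exp_le_exp.2 ?_)
    rw [Finset.sum_neg_distrib, ← Finset.mul_sum, Finset.sum_sub_distrib, ← Finset.sum_div]
    simp only [Finset.sum_const, Finset.card_univ, Fintype.card_fin, nsmul_eq_mul]
    have h1 : 1 ≤ (∑ j, (f j : ℝ)) / t := by rwa [one_le_div ht]
    have h2 : (k : ℝ) * (1 / (4 * k)) = 1 / 4 := by field_simp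
    rw [h2]
    nlinarith
  calc _ ≤ _ := measure_mono hsub
    _ ≤ ∑ h : Fin H, _ := measure_iUnion_fintype_le _ _
    _ ≤ ∑ _h : Fin H, ENNReal.ofReal (Real.exp (-(3 / 4 * ρ))) :=
        Finset.sum_le_sum fun h _ => hgroup h
    _ = _ := by
        rw [Finset.sum_const, Finset.card_univ, Fintype.card_fin, nsmul_eq_mul,
          ENNReal.ofReal_mul (by positivity), ENNReal.ofReal_natCast]

/-- An item far below its threshold is unlikely to be hit in all groups. -/
theorem hitLaw_all_le {H k : ℕ} {ρ : ℝ} (hρ : 0 < ρ) {t : ℝ} (ht : 0 < t)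
    (f : Fin k → ℕ) (hf : 8 * ρ * (∑ j, (f j : ℝ)) ≤ t) :
    hitLaw H k {E | ∀ h, ∃ j, 1 ≤ f j ∧ hitThreshold ρ k t (E h j) ≤ f j}
      ≤ ENNReal.ofReal ((1 / 8) ^ H) := by
  have heq : {E : Fin H → Fin k → ℝ | ∀ h, ∃ j, 1 ≤ f j ∧ hitThreshold ρ k t (E h j) ≤ f j}
      = Set.pi Set.univ fun _ : Fin H => ⋃ j : Fin k, Function.eval j ⁻¹'
        {y : ℝ | 1 ≤ f j ∧ hitThreshold ρ k t y ≤ f j} := by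
    ext E
    simp [Set.mem_pi]
  have hone : expPi (Fin k) (⋃ j : Fin k, Function.eval j ⁻¹'
        {y : ℝ | 1 ≤ f j ∧ hitThreshold ρ k t y ≤ f j}) ≤ ENNReal.ofReal (1 / 8) := by
    refine (measure_iUnion_fintype_le _ _).trans ?_
    have hj : ∀ j : Fin k, expPi (Fin k) (Function.eval j ⁻¹'
        {y : ℝ | 1 ≤ f j ∧ hitThreshold ρ k t y ≤ f j}) ≤ ENNReal.ofReal (ρ * (f j / t)) := by
      intro j
      have hle : (expPi (Fin k)).map (Function.eval j) = expMeasure 1 :=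
        (measurePreserving_eval (fun _ : Fin k => expMeasure 1) j).map_eq
      refine (Measure.le_map_apply (measurable_pi_apply j).aemeasurable _).trans ?_
      rw [hle]
      refine (expMeasure_hit_le hρ ht _).trans (ENNReal.ofReal_le_ofReal ?_)
      gcongr
      have : (0 : ℝ) ≤ 1 / (4 * k) := by positivity
      linarith
    refine (Finset.sum_le_sum fun j _ => hj j).trans ?_
    rw [← ENNReal.ofReal_sum_of_nonneg fun j _ => by positivity]
    refine ENNReal.ofReal_le_ofReal ?_
    rw [← Finset.mul_sum, ← Finset.sum_div, ← mul_div_assoc, div_le_iff₀ ht]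
    linarith
  rw [heq, Measure.pi_pi]
  refine (Finset.prod_le_prod' fun _ _ => hone).trans ?_
  rw [Finset.prod_const, Finset.card_univ, Fintype.card_fin, ← ENNReal.ofReal_pow (by norm_num)]

theorem min_one_le_sum_dyadic {r : ℝ} (Z : ℕ) :
    min 1 r ≤ (∑ b ∈ Finset.range (Z + 1), if (1 / 2 : ℝ) ^ (b + 1) ≤ r then (1 / 2) ^ b else 0)
      + (1 / 2) ^ Z := by
  induction Z with
  | zero => simp; split_ifs <;> norm_num
  | succ Z ih =>
    rw [Finset.sum_range_succ]
    have hnn : 0 ≤ ∑ b ∈ Finset.range (Z + 1),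
        if (1 / 2 : ℝ) ^ (b + 1) ≤ r then (1 / 2 : ℝ) ^ b else 0 :=
      Finset.sum_nonneg fun b _ => by split_ifs <;> positivity
    split_ifs with h
    · by_cases h' : (1 / 2 : ℝ) ^ (Z + 1) ≤ r
      · have hpos : (0 : ℝ) < (1 / 2) ^ Z := by positivity
        rw [pow_succ] at *
        linarith
      · have := min_le_right 1 r
        have hpos : (0 : ℝ) < (1 / 2) ^ (Z + 1) := by positivity
        linarith [not_le.1 h']
    · have := min_le_right 1 r
      rw [pow_succ (1 / 2 : ℝ) (Z + 1)] at h
      have hpos : (0 : ℝ) < (1 / 2) ^ (Z + 1) := by positivity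
      linarith [not_le.1 h]

theorem lintegral_min_le {A : ℝ} (hA : 0 ≤ A) (Z : ℕ) :
    ∫⁻ x, min 1 (ENNReal.ofReal (A / x)) ∂expMeasure 1
      ≤ ENNReal.ofReal (2 * (Z + 1) * A + (1 / 2) ^ Z) := by
  have hpt : ∀ᵐ x ∂expMeasure 1, min 1 (ENNReal.ofReal (A / x))
      ≤ (∑ b ∈ Finset.range (Z + 1), (Set.Iic (2 ^ (b + 1) * A)).indicator
          (fun _ => ENNReal.ofReal ((1 / 2) ^ b)) x) + ENNReal.ofReal ((1 / 2) ^ Z) := by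
    filter_upwards [expMeasure_ae_pos] with x hx
    have h1 : min 1 (ENNReal.ofReal (A / x)) = ENNReal.ofReal (min 1 (A / x)) := by
      rw [ENNReal.ofReal_min, ENNReal.ofReal_one]
    rw [h1]
    refine (ENNReal.ofReal_le_ofReal (min_one_le_sum_dyadic Z)).trans ?_
    rw [ENNReal.ofReal_add (Finset.sum_nonneg fun b _ => by split_ifs <;> positivity)
      (by positivity),
      ENNReal.ofReal_sum_of_nonneg fun b _ => by split_ifs <;> positivity]
    gcongr with b _
    split_ifs with h
    · rw [Set.indicator_of_mem]
      rw [le_div_iff₀ hx] at h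
      rw [Set.mem_Iic]
      calc x = 2 ^ (b + 1) * ((1 / 2) ^ (b + 1) * x) := by
            rw [← mul_assoc, ← mul_pow]; norm_num
        _ ≤ 2 ^ (b + 1) * A := by gcongr
    · simp
  refine (lintegral_mono_ae hpt).trans ?_
  rw [lintegral_add_right _ measurable_const,
    lintegral_finsetSum _ fun b _ => measurable_const.indicator measurableSet_Iic]
  simp only [lintegral_indicator_const measurableSet_Iic, lintegral_const, measure_univ, mul_one]
  have hb : ∀ b ∈ Finset.range (Z + 1), ENNReal.ofReal ((1 / 2) ^ b)
      * expMeasure 1 (Set.Iic (2 ^ (b + 1) * A)) ≤ ENNReal.ofReal (2 * A) := by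
    intro b _
    refine (mul_le_mul_right (expMeasure_Iic_le _) _).trans ?_
    rw [← ENNReal.ofReal_mul (by positivity)]
    refine ENNReal.ofReal_le_ofReal (le_of_eq ?_)
    rw [pow_succ, ← mul_assoc, ← mul_assoc, ← mul_pow]
    norm_num
  refine (add_le_add_left (Finset.sum_le_sum hb) _).trans ?_
  rw [Finset.sum_const, Finset.card_range, nsmul_eq_mul, ENNReal.ofReal_add (by positivity)
    (by positivity)]
  gcongr
  rw [← ENNReal.ofReal_natCast, ← ENNReal.ofReal_mul (by positivity)]
  refine ENNReal.ofReal_le_ofReal (le_of_eq ?_)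
  push_cast
  ring

/-! ### The public randomness -/

section Public

variable {R n N Q H G k : ℕ}

/-- The public randomness: the exponential variables and the random numbers for hits. -/
abbrev PubSpace (R n N H k : ℕ) : Type :=
  (Fin R → Fin n × Fin N → ℝ) × (Fin H → Fin k → ℝ)

/-- The law of the public randomness. -/
noncomputable abbrev pubMeasure (R n N H k : ℕ) : Measure (PubSpace R n N H k) :=
  (expLaw R n N).prod (hitLaw H k)

theorem measurePreserving_coord (x : Coord R n N) :
    MeasurePreserving (fun v : Fin R → Fin n × Fin N → ℝ => v x.1 x.2) (expLaw R n N)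
      (expMeasure 1) :=
  (measurePreserving_eval (fun _ : Fin n × Fin N => expMeasure 1) x.2).comp
    (measurePreserving_eval (fun _ : Fin R => expPi (Fin n × Fin N)) x.1)

theorem expLaw_ae_pos : ∀ᵐ v ∂expLaw R n N, ∀ r y, 0 < v r y := by
  rw [ae_all_iff]
  intro r
  rw [ae_all_iff]
  intro y
  exact (measurePreserving_coord (r, y)).quasiMeasurePreserving.ae expMeasure_ae_pos

theorem pubMeasure_ae_pos : ∀ᵐ ω ∂pubMeasure R n N H k, ∀ r y, 0 < ω.1 r y :=
  Measure.quasiMeasurePreserving_fst.ae expLaw_ae_pos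

/-- The probability of an event that depends on one exponential variable and the random numbers for
hits. -/
theorem pubMeasure_coord (x : Coord R n N) {B : Set (ℝ × (Fin H → Fin k → ℝ))}
    (hB : MeasurableSet B) :
    pubMeasure R n N H k {ω | (ω.1 x.1 x.2, ω.2) ∈ B}
      = ∫⁻ y, hitLaw H k {E | (y, E) ∈ B} ∂expMeasure 1 := by
  have h := (measurePreserving_coord x).prod (MeasurePreserving.id (hitLaw H k))
  have h2 := h.measure_preimage hB.nullMeasurableSet
  rw [Measure.prod_apply hB] at h2
  exact h2

/-- All groups hit the key, at the local counts `f` of its item. -/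
def AllHit (p ρ : ℝ) (κ : Key R n N Q) (f : Fin k → ℕ) (ω : PubSpace R n N H k) : Prop :=
  ∀ h, ∃ j, 1 ≤ f j ∧
    hitThreshold ρ k (reach p N κ.2.1 (ω.1 κ.1.1 κ.1.2)) (ω.2 h j) ≤ f j

theorem measurable_hitThreshold (p ρ : ℝ) (q : ℕ) (h : Fin H) (j : Fin k) :
    Measurable fun z : ℝ × (Fin H → Fin k → ℝ) =>
      hitThreshold ρ k (reach p N q z.1) (z.2 h j) := by
  unfold hitThreshold
  refine Nat.measurable_ceil.comp ?_
  have h1 : Measurable fun z : ℝ × (Fin H → Fin k → ℝ) => reach p N q z.1 :=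
    (measurable_reach p N q).comp measurable_fst
  have h2 : Measurable fun z : ℝ × (Fin H → Fin k → ℝ) => z.2 h j := by fun_prop
  fun_prop

theorem measurableSet_allHit (p ρ : ℝ) (q : ℕ) (f : Fin k → ℕ) :
    MeasurableSet {z : ℝ × (Fin H → Fin k → ℝ) |
      ∀ h, ∃ j, 1 ≤ f j ∧ hitThreshold ρ k (reach p N q z.1) (z.2 h j) ≤ f j} := by
  simp only [Set.ofPred_forall, Set.ofPred_exists, Set.ofPred_and]
  refine MeasurableSet.iInter fun h => MeasurableSet.iUnion fun j => ?_
  exact (MeasurableSet.const _).inter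
    (measurableSet_le (measurable_hitThreshold p ρ q h j) measurable_const)

theorem pubMeasure_miss_le {p ρ : ℝ} (hp : 1 ≤ p) (hρ : 0 < ρ) (hN : 1 ≤ N) (hk : 1 ≤ k)
    (κ : Key R n N Q) (f : Fin k → ℕ) :
    pubMeasure R n N H k {ω | N * 2 ^ κ.2.1 * ω.1 κ.1.1 κ.1.2 ≤ (∑ j, (f j : ℝ)) ^ p ∧
      ¬ AllHit p ρ κ f ω} ≤ ENNReal.ofReal (H * Real.exp (-(3 / 4 * ρ))) := by
  have hB : MeasurableSet {z : ℝ × (Fin H → Fin k → ℝ) |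
      N * 2 ^ κ.2.1 * z.1 ≤ (∑ j, (f j : ℝ)) ^ p ∧
      ¬ ∀ h, ∃ j, 1 ≤ f j ∧ hitThreshold ρ k (reach p N κ.2.1 z.1) (z.2 h j) ≤ f j} := by
    have h1 : MeasurableSet {z : ℝ × (Fin H → Fin k → ℝ) |
        N * 2 ^ κ.2.1 * z.1 ≤ (∑ j, (f j : ℝ)) ^ p} :=
      measurableSet_le (by fun_prop) measurable_const
    exact h1.inter (measurableSet_allHit (N := N) (H := H) p ρ κ.2.1 f).compl
  refine (pubMeasure_coord κ.1 hB).le.trans ?_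
  calc _ ≤ ∫⁻ _, ENNReal.ofReal (H * Real.exp (-(3 / 4 * ρ))) ∂expMeasure 1 := by
        refine lintegral_mono_ae ?_
        filter_upwards [expMeasure_ae_pos] with x hx
        by_cases hle : N * 2 ^ κ.2.1 * x ≤ (∑ j, (f j : ℝ)) ^ p
        · refine (measure_mono fun E hE => hE.2).trans
            (hitLaw_miss_le hk hρ (reach_pos hN hx) f ?_)
          exact (reach_le_iff hp hx.le (by positivity)).2 hle
        · refine (measure_mono (t := ∅) fun E hE => hle hE.1).trans ?_
          simp
    _ = _ := by simp

theorem pubMeasure_hit_le {p ρ : ℝ} (hp : 1 ≤ p) (hρ : 0 < ρ) (hN : 1 ≤ N) (hk : 1 ≤ k)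
    (κ : Key R n N Q) (h : Fin H) (j : Fin k) (f Z : ℕ) :
    pubMeasure R n N H k {ω | 1 ≤ f ∧
      hitThreshold ρ k (reach p N κ.2.1 (ω.1 κ.1.1 κ.1.2)) (ω.2 h j) ≤ f}
    ≤ ENNReal.ofReal (2 * (Z + 1) * (ρ * (4 * k) ^ (p - 1) * f ^ p / (N * 2 ^ κ.2.1))
      + (1 / 2) ^ Z) := by
  have hNpos : (0 : ℝ) < N := by exact_mod_cast hN
  have hB : MeasurableSet {z : ℝ × (Fin H → Fin k → ℝ) | 1 ≤ f ∧
      hitThreshold ρ k (reach p N κ.2.1 z.1) (z.2 h j) ≤ f} :=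
    (MeasurableSet.const _).inter
      (measurableSet_le (measurable_hitThreshold p ρ _ h j) measurable_const)
  refine (pubMeasure_coord κ.1 hB).le.trans ?_
  refine le_trans ?_ (lintegral_min_le (by positivity) Z)
  refine lintegral_mono_ae ?_
  filter_upwards [expMeasure_ae_pos] with x hx
  refine le_min prob_le_one ?_
  have hmap : (hitLaw H k).map (fun E => E h j) = expMeasure 1 :=
    ((measurePreserving_eval (fun _ : Fin k => expMeasure 1) j).comp
      (measurePreserving_eval (fun _ : Fin H => expPi (Fin k)) h)).map_eq
  have hm : Measurable fun E : Fin H → Fin k → ℝ => E h j := by fun_prop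
  refine (Measure.le_map_apply (f := fun E : Fin H → Fin k → ℝ => E h j) hm.aemeasurable
    {y | 1 ≤ f ∧ hitThreshold ρ k (reach p N κ.2.1 x) y ≤ f}).trans ?_
  rw [hmap]
  refine (expMeasure_hit_le_rpow hp hρ hk (reach_pos hN hx) f).trans ?_
  rw [reach_rpow hp hx.le, div_div]

theorem pubMeasure_allHit_le {p ρ : ℝ} (hp : 1 ≤ p) (hρ : 0 < ρ) (hN : 1 ≤ N)
    (κ : Key R n N Q) (f : Fin k → ℕ) :
    pubMeasure R n N H k {ω | AllHit p ρ κ f ω}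
      ≤ ENNReal.ofReal ((8 * ρ) ^ p * (∑ j, (f j : ℝ)) ^ p / (N * 2 ^ κ.2.1)
        + (1 / 8) ^ H) := by
  have hNpos : (0 : ℝ) < N := by exact_mod_cast hN
  refine (pubMeasure_coord κ.1 (measurableSet_allHit p ρ κ.2.1 f)).le.trans ?_
  set a : ℝ := (8 * ρ) ^ p * (∑ j, (f j : ℝ)) ^ p / (N * 2 ^ κ.2.1) with ha
  calc _ ≤ ∫⁻ x, ((Set.Iic a).indicator (fun _ => 1) x + ENNReal.ofReal ((1 / 8) ^ H))
          ∂expMeasure 1 := by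
        refine lintegral_mono_ae ?_
        filter_upwards [expMeasure_ae_pos] with x hx
        by_cases hxa : x ≤ a
        · rw [Set.indicator_of_mem (Set.mem_Iic.2 hxa)]
          exact prob_le_one.trans le_self_add
        · refine le_add_left (hitLaw_all_le hρ (reach_pos hN hx) f ?_)
          by_contra hlt
          have h1 := (reach_le_iff (N := N) (q := κ.2.1) hp hx.le (by positivity)).1
            (not_le.1 hlt).le
          rw [Real.mul_rpow (by positivity) (by positivity)] at h1
          refine hxa ?_
          rw [ha, le_div_iff₀ (by positivity)]
          linarith
    _ ≤ _ := by
        rw [lintegral_add_right _ measurable_const, lintegral_indicator_const measurableSet_Iic,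
          one_mul, lintegral_const, measure_univ, mul_one,
          ENNReal.ofReal_add (by positivity) (by positivity)]
        gcongr
        exact expMeasure_Iic_le a

/-- The probability that an instance has no key at some level. -/
theorem expLaw_no_reached_le {lam : Fin n → ℝ} (hN : 1 ≤ N) (r : Fin R)
    (q : Fin (Q + 1)) :
    expLaw R n N {v | ∀ y : Fin n × Fin N, (((r, y), q) : Key R n N Q) ∉ reachedKeys lam v}
      ≤ ENNReal.ofReal (Real.exp (-((∑ i, lam i) / 2 ^ q.1))) := by
  have hNpos : (0 : ℝ) < N := by exact_mod_cast hN
  have hsub : {v : Fin R → Fin n × Fin N → ℝ |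
      ∀ y : Fin n × Fin N, (((r, y), q) : Key R n N Q) ∉ reachedKeys lam v}
      ⊆ Function.eval r ⁻¹' (Set.pi Set.univ fun y => Set.Ioi (upper lam N q y.1)) := by
    intro v hv y _
    rw [Set.mem_Ioi, upper, div_lt_iff₀ (by positivity), mul_comm]
    exact not_le.1 (hv y)
  refine (measure_mono hsub).trans ?_
  have hle : (expLaw R n N).map (Function.eval r) = expPi (Fin n × Fin N) :=
    (measurePreserving_eval (fun _ : Fin R => expPi (Fin n × Fin N)) r).map_eq
  refine (Measure.le_map_apply (measurable_pi_apply r).aemeasurable _).trans ?_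
  rw [hle, Measure.pi_pi]
  refine (Finset.prod_le_prod' fun y _ => expMeasure_Ioi_le _).trans ?_
  rw [← ENNReal.ofReal_prod_of_nonneg fun j _ => (Real.exp_pos _).le, ← Real.exp_sum,
    Finset.sum_neg_distrib, sum_upper hN]

end Public

/-! ### Unbiased rounding -/

theorem roundVal_roundExp_le (G U f : ℕ) : roundVal (roundExp G U f) ≤ 2 * f := by
  unfold roundExp
  by_cases hf : f = 0
  · simp [hf, roundVal]
  have h1 := Nat.pow_log_le_self 2 hf
  simp only [hf, if_false]
  split_ifs
  · simp only [roundVal, pow_succ]; omega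
  · simp only [roundVal]; omega

/-- The uniform distribution of the random number for rounding. -/
noncomputable abbrev roundLaw (G : ℕ) : Measure (Fin (2 ^ G)) :=
  (PMF.uniformOfFintype (Fin (2 ^ G))).toMeasure

theorem sum_roundVal {G f : ℕ} (hf : f < 2 ^ G) :
    ∑ U : Fin (2 ^ G), roundVal (roundExp G U.1 f) = 2 ^ G * f := by
  by_cases h0 : f = 0
  · simp [h0, roundExp, roundVal]
  set z := Nat.log 2 f with hz
  have hzG : z < G := Nat.log_lt_of_lt_pow h0 hf
  have hz1 : 2 ^ z ≤ f := Nat.pow_log_le_self 2 h0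
  have hz2 : f < 2 ^ (z + 1) := Nat.lt_pow_succ_log_self (by norm_num) f
  have hG : 2 ^ G = 2 ^ (G - z) * 2 ^ z := by rw [← pow_add]; congr 1; omega
  set c := (f - 2 ^ z) * 2 ^ (G - z) with hc
  have hcG : c ≤ 2 ^ G := by
    rw [hG, mul_comm (2 ^ (G - z)), hc]
    refine Nat.mul_le_mul_right _ ?_
    rw [pow_succ] at hz2; omega
  have hval : ∀ U : Fin (2 ^ G), roundVal (roundExp G U.1 f)
      = 2 ^ z + if U.1 < c then 2 ^ z else 0 := by
    intro U
    have hiff : U.1 * 2 ^ z < (f - 2 ^ z) * 2 ^ G ↔ U.1 < c := by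
      rw [show (f - 2 ^ z) * 2 ^ G = c * 2 ^ z by rw [hc, mul_assoc, ← hG]]
      exact Nat.mul_lt_mul_right (by positivity)
    unfold roundExp
    simp only [h0, if_false, ← hz, hiff]
    split_ifs
    · simp only [roundVal, pow_succ]; ring
    · simp [roundVal]
  have hcount : ∑ U : Fin (2 ^ G), (if U.1 < c then 2 ^ z else 0) = c * 2 ^ z := by
    rw [Fin.sum_univ_eq_sum_range (fun U => if U < c then 2 ^ z else 0), ← Finset.sum_filter,
      Finset.sum_const, smul_eq_mul]
    congr 1
    rw [show (Finset.range (2 ^ G)).filter (· < c) = Finset.range c by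
      ext; simp; omega, Finset.card_range]
  rw [Finset.sum_congr rfl fun U _ => hval U, Finset.sum_add_distrib, hcount]
  simp only [Finset.sum_const, Finset.card_univ, Fintype.card_fin, smul_eq_mul]
  rw [hc, mul_assoc, ← hG, mul_comm (f - 2 ^ z), ← mul_add]
  congr 1
  omega

theorem integral_roundVal {G f : ℕ} (hf : f < 2 ^ G) :
    ∫ U, (roundVal (roundExp G U.1 f) : ℝ) ∂roundLaw G = f := by
  rw [PMF.integral_eq_sum]
  simp only [PMF.uniformOfFintype_apply, Fintype.card_fin, smul_eq_mul]
  rw [← Finset.mul_sum]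
  have := sum_roundVal hf
  have h2 : ∑ U : Fin (2 ^ G), (roundVal (roundExp G U.1 f) : ℝ) = 2 ^ G * f := by
    exact_mod_cast this
  rw [h2]
  simp

/-- The law of the private randomness. -/
noncomputable abbrev privMeasure (G k : ℕ) : Measure (Unit × (Fin k → Fin (2 ^ G))) :=
  (Measure.dirac ()).prod (Measure.pi fun _ => roundLaw G)

/-- The estimate of a frequency from its randomly rounded parts. -/
def roundedSum {G k : ℕ} (f : Fin k → ℕ) (U : Fin k → Fin (2 ^ G)) : ℕ :=
  ∑ j, roundVal (roundExp G (U j).1 (f j))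

theorem roundedSum_le {G k : ℕ} (f : Fin k → ℕ) (U : Fin k → Fin (2 ^ G)) :
    roundedSum f U ≤ 2 * ∑ j, f j := by
  rw [Finset.mul_sum]
  exact Finset.sum_le_sum fun j _ => roundVal_roundExp_le G _ _

theorem memLp_roundedSum {G k : ℕ} (f : Fin k → ℕ) :
    MemLp (fun ω : Unit × (Fin k → Fin (2 ^ G)) => (roundedSum f ω.2 : ℝ)) 2
      (privMeasure G k) := by
  refine MemLp.of_bound (Measurable.of_discrete.aestronglyMeasurable) (2 * ∑ j, f j : ℕ) ?_
  refine Filter.Eventually.of_forall fun ω => ?_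
  rw [Real.norm_of_nonneg (by positivity)]
  exact_mod_cast roundedSum_le f ω.2

theorem integral_roundedSum {G k : ℕ} (f : Fin k → ℕ) (hf : ∀ j, f j < 2 ^ G) :
    ∫ ω, (roundedSum f ω.2 : ℝ) ∂privMeasure G k = ∑ j, f j := by
  have h1 : ∀ j : Fin k, MeasurePreserving
      (fun ω : Unit × (Fin k → Fin (2 ^ G)) => ω.2 j) (privMeasure G k) (roundLaw G) := fun j =>
    (measurePreserving_eval (fun _ : Fin k => roundLaw G) j).comp measurePreserving_snd
  simp only [roundedSum, Nat.cast_sum]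
  rw [integral_finsetSum]
  · refine Finset.sum_congr rfl fun j _ => ?_
    rw [← integral_roundVal (hf j), ← (h1 j).map_eq,
      integral_map (h1 j).measurable.aemeasurable
        (Measurable.of_discrete.aestronglyMeasurable)]
  · intro j _
    refine Integrable.of_bound (Measurable.of_discrete.aestronglyMeasurable)
      (2 * f j : ℕ) (Filter.Eventually.of_forall fun ω => ?_)
    rw [Real.norm_of_nonneg (by positivity)]
    exact_mod_cast roundVal_roundExp_le G _ _

/-! ### The sampler -/

/-- The parameters of the sampler. -/
structure SamplerParams (n k : ℕ) where
  p : ℝ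
  ρ : ℝ
  R : ℕ
  N : ℕ
  Q : ℕ
  H : ℕ
  G : ℕ
  w : ℕ
  one_le_p : 1 ≤ p
  ρ_pos : 0 < ρ
  one_le_n : 1 ≤ n
  one_le_k : 1 ≤ k
  one_le_R : 1 ≤ R
  one_le_N : 1 ≤ N
  one_le_H : 1 ≤ H
  card_atom_le : Fintype.card (TAtom R n N Q H G) ≤ 2 ^ w
  card_cmd_le : Fintype.card (TCmd R n N Q G) ≤ 2 ^ w

namespace SamplerParams

variable {n k : ℕ} (D : SamplerParams n k)

/-- The public randomness. -/
abbrev PubΩ : Type := PubSpace D.R n D.N D.H k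

/-- The law of the public randomness. -/
noncomputable abbrev pubM : Measure D.PubΩ := pubMeasure D.R n D.N D.H k

/-- The coordinate that is sampled if no instance is won. -/
def dflt : Coord D.R n D.N := (⟨0, D.one_le_R⟩, ⟨0, D.one_le_n⟩, ⟨0, D.one_le_N⟩)

/-- The tracking scheme of the sampler. -/
noncomputable abbrev scheme : Scheme n k (TAtom D.R n D.N D.Q D.H D.G) (TCmd D.R n D.N D.Q D.G)
    ((Key D.R n D.N D.Q → Fin D.H → ℕ) × Fin (2 ^ D.G)) (Key D.R n D.N D.Q → ℕ) :=
  trackScheme D.R D.N D.Q D.H D.G k D.dflt.2.1 D.w D.card_atom_le D.card_cmd_le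

/-- The threshold of a key. -/
noncomputable def tau (ω : D.PubΩ) (κ : Key D.R n D.N D.Q) : ℕ :=
  min ⌈reach D.p D.N κ.2.1 (ω.1 κ.1.1 κ.1.2)⌉₊ (2 ^ D.G)

/-- The local counts at which servers announce hits. -/
noncomputable def theta (ω : D.PubΩ) (j : Fin k) (κ : Key D.R n D.N D.Q) (h : Fin D.H) : ℕ :=
  hitThreshold D.ρ k (reach D.p D.N κ.2.1 (ω.1 κ.1.1 κ.1.2)) (ω.2 h j)

/-- The state of the sampler after a stream. -/
noncomputable def state (s : DStream n k) (ω : D.PubΩ) (U : Fin k → Fin (2 ^ D.G)) :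
    TState D.R n D.N D.Q D.H D.G k :=
  D.scheme.run (fun j => (D.theta ω j, U j)) (D.tau ω) s

/-- The coordinate sampled when the commands `c` have been issued. -/
noncomputable def choice (c : Finset (TCmd D.R n D.N D.Q D.G)) : Coord D.R n D.N :=
  pick D.dflt {κ | (κ, 0) ∈ c}

/-- The sampler. -/
noncomputable def prot : Protocol n k (SampleOut D.R n D.N) :=
  D.scheme.protocol D.pubM (roundLaw D.G) (fun j ω U => (D.theta ω j, U)) D.tau
    fun ω K c => (D.choice c,
      (estimate K (D.choice c).2.1 : ℝ) / ω.1 (D.choice c).1 (D.choice c).2 ^ (1 / D.p))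

/-- The commands issued by the coordinator; they do not depend on the private randomness. -/
noncomputable def cmds (s : DStream n k) (ω : D.PubΩ) : Finset (TCmd D.R n D.N D.Q D.G) :=
  (D.state s ω fun _ => ⟨0, by positivity⟩).cmds

/-- The sampled coordinate. -/
noncomputable def smp (s : DStream n k) (ω : D.PubΩ) : Coord D.R n D.N := D.choice (D.cmds s ω)

theorem tau_le (ω : D.PubΩ) (κ : Key D.R n D.N D.Q) : D.tau ω κ ≤ 2 ^ D.G := min_le_right _ _

theorem state_cmds (s : DStream n k) (ω : D.PubΩ) (U : Fin k → Fin (2 ^ D.G)) :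
    (D.state s ω U).cmds = D.cmds s ω := by
  refine Scheme.run_congr_visible (fun a => ∀ x, a ≠ Sum.inr (Sum.inr x))
    (quiet_track D.one_le_H) (quiet_track D.one_le_H) ?_ ?_ s
  · intro j f c
    ext a
    simp only [Finset.mem_filter, mem_cur]
    refine and_congr_left fun hv => ?_
    rcases a with ⟨κ, h⟩ | ⟨κ, g, v⟩ | x
    · rfl
    · rfl
    · exact absurd rfl (hv x)
  · intro K K' c hK
    have hvis : ∀ j a, (∀ x, a ≠ Sum.inr (Sum.inr x)) → (a ∈ K j ↔ a ∈ K' j) := by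
      intro j a ha
      have := Finset.ext_iff.1 (hK j) a
      simpa only [Finset.mem_filter, ha, and_true, ne_eq, not_false_eq_true, implies_true]
        using this
    have htop : ∀ j κ g, topCount (K j) κ g = topCount (K' j) κ g := by
      intro j κ g
      unfold topCount
      congr 1
      ext v
      simp only [Finset.mem_filter, Finset.mem_univ, true_and]
      exact hvis j _ (by simp)
    ext a
    rw [mem_due, mem_due]
    unfold Due
    simp only [htop]
    have hhit : ∀ j h, (Sum.inl (a.1, h) ∈ K j ↔ Sum.inl (a.1, h) ∈ K' j) := fun j h =>
      hvis j _ (by simp)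
    simp only [hhit]

theorem watched_smp (s : DStream n k) (ω : D.PubΩ) :
    Watched D.dflt.2.1 (D.cmds s ω) (D.smp s ω).2.1 := by
  by_cases h : ∃ x, Wins {κ | (κ, 0) ∈ D.cmds s ω} x
  · obtain ⟨q, hq, _⟩ := (wins_pick (x₀ := D.dflt) h).1
    exact Or.inr ⟨_, 0, hq, rfl⟩
  · left
    rw [smp, choice, pick_of_not_exists h]

theorem prot_comm (s : DStream n k) (ω : D.PubΩ) (u : Unit) (U : Fin k → Fin (2 ^ D.G)) :
    D.prot.comm s (ω, u, U) = (D.state s ω U).bits :=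
  Scheme.protocol_comm D.one_le_k ω u U s

theorem prot_result {s : DStream n k} (hs : s.length < 2 ^ D.G) (ω : D.PubΩ) (u : Unit)
    (U : Fin k → Fin (2 ^ D.G)) :
    D.prot.result s (ω, u, U) = (D.smp s ω,
      (roundedSum (fun j => localFreq s j (D.smp s ω).2.1) U : ℝ)
      / ω.1 (D.smp s ω).1 (D.smp s ω).2 ^ (1 / D.p)) := by
  have h1 : D.prot.result s (ω, u, U) = (D.choice (D.state s ω U).cmds,
      (estimate (D.state s ω U).K (D.choice (D.state s ω U).cmds).2.1 : ℝ)
      / ω.1 (D.choice (D.state s ω U).cmds).1 (D.choice (D.state s ω U).cmds).2 ^ (1 / D.p)) :=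
    Scheme.protocol_result D.one_le_k ω u U s
  have h2 : estimate (D.state s ω U).K (D.smp s ω).2.1
      = roundedSum (fun j => localFreq s j (D.smp s ω).2.1) U := by
    refine estimate_run (θ := D.theta ω) (U := U) (τ := D.tau ω) D.one_le_H D.one_le_k
      (D.tau_le ω) hs ?_
    have := D.watched_smp s ω
    rw [← D.state_cmds s ω U] at this
    exact this
  rw [h1, state_cmds, ← smp, h2]

/-! ### Measurability -/

/-- The part of the randomness that determines the communication. -/
noncomputable def digest (ω : D.PubΩ) :
    (Key D.R n D.N D.Q → ℕ) × (Fin k → Key D.R n D.N D.Q → Fin D.H → ℕ) :=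
  (D.tau ω, D.theta ω)

theorem measurable_reach_coord (κ : Key D.R n D.N D.Q) :
    Measurable fun ω : D.PubΩ => reach D.p D.N κ.2.1 (ω.1 κ.1.1 κ.1.2) :=
  (measurable_reach _ _ _).comp (by fun_prop)

theorem measurable_digest : Measurable D.digest := by
  refine Measurable.prodMk (measurable_pi_lambda _ fun κ => ?_)
    (measurable_pi_lambda _ fun j => measurable_pi_lambda _ fun κ => measurable_pi_lambda _
      fun h => ?_)
  · exact (Nat.measurable_ceil.comp (D.measurable_reach_coord κ)).min measurable_const
  · refine Nat.measurable_ceil.comp ?_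
    have h1 := D.measurable_reach_coord κ
    have h2 : Measurable fun ω : D.PubΩ => ω.2 h j := by fun_prop
    fun_prop

theorem measurable_of_digest {β : Type} [MeasurableSpace β]
    (g : ((Key D.R n D.N D.Q → ℕ) × (Fin k → Key D.R n D.N D.Q → Fin D.H → ℕ)) →
      (Fin k → Fin (2 ^ D.G)) → β) :
    Measurable fun ω : D.PubΩ × (Unit × (Fin k → Fin (2 ^ D.G))) => g (D.digest ω.1) ω.2.2 := by
  have h1 : Measurable fun ω : D.PubΩ × (Unit × (Fin k → Fin (2 ^ D.G))) =>
      (D.digest ω.1, ω.2.2) :=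
    (D.measurable_digest.comp measurable_fst).prodMk (measurable_snd.comp measurable_snd)
  exact (Measurable.of_discrete (f := fun x : ((Key D.R n D.N D.Q → ℕ) ×
    (Fin k → Key D.R n D.N D.Q → Fin D.H → ℕ)) × (Fin k → Fin (2 ^ D.G)) => g x.1 x.2)).comp h1

theorem measurable_smp (s : DStream n k) : Measurable (D.smp s) := by
  let g : (Key D.R n D.N D.Q → ℕ) × (Fin k → Key D.R n D.N D.Q → Fin D.H → ℕ) →
      Coord D.R n D.N := fun d =>
    D.choice (D.scheme.run (fun j => (d.2 j, ⟨0, by positivity⟩)) d.1 s).cmds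
  have h : D.smp s = g ∘ D.digest := rfl
  have hg : Measurable g := Measurable.of_discrete
  rw [h]
  exact hg.comp D.measurable_digest

theorem measurable_comm (s : DStream n k) : Measurable (D.prot.comm s) := by
  let g : ((Key D.R n D.N D.Q → ℕ) × (Fin k → Key D.R n D.N D.Q → Fin D.H → ℕ)) →
      (Fin k → Fin (2 ^ D.G)) → ℕ := fun d U =>
    (D.scheme.run (fun j => (d.2 j, U j)) d.1 s).bits
  have h : D.prot.comm s = fun ω : D.PubΩ × (Unit × (Fin k → Fin (2 ^ D.G))) =>
      g (D.digest ω.1) ω.2.2 :=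
    funext fun ω => D.prot_comm s ω.1 ω.2.1 ω.2.2
  have hg := D.measurable_of_digest g
  rw [← h] at hg
  exact hg

theorem measurable_result {s : DStream n k} (hs : s.length < 2 ^ D.G) :
    Measurable (D.prot.result s) := by
  have hm : Measurable fun ω : D.PubΩ × (Unit × (Fin k → Fin (2 ^ D.G))) => D.smp s ω.1 :=
    (D.measurable_smp s).comp measurable_fst
  have h1 : Measurable fun z : Coord D.R n D.N × (D.PubΩ × (Unit × (Fin k → Fin (2 ^ D.G)))) =>
      (roundedSum (fun j => localFreq s j z.1.2.1) z.2.2.2 : ℝ)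
      / z.2.1.1 z.1.1 z.1.2 ^ (1 / D.p) := by
    refine measurable_from_prod_countable_right fun x => ?_
    have h2 : Measurable fun ω : D.PubΩ × (Unit × (Fin k → Fin (2 ^ D.G))) =>
        (roundedSum (fun j => localFreq s j x.2.1) ω.2.2 : ℝ) :=
      (Measurable.of_discrete (f := fun U : Fin k → Fin (2 ^ D.G) =>
        (roundedSum (fun j => localFreq s j x.2.1) U : ℝ))).comp
          (measurable_snd.comp measurable_snd)
    have h3 : Measurable fun ω : D.PubΩ × (Unit × (Fin k → Fin (2 ^ D.G))) =>
        ω.1.1 x.1 x.2 := by fun_prop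
    exact h2.div (h3.pow_const _)
  have h4 := hm.prodMk (h1.comp (hm.prodMk measurable_id))
  have h : D.prot.result s = fun ω : D.PubΩ × (Unit × (Fin k → Fin (2 ^ D.G))) =>
      (D.smp s ω.1, (roundedSum (fun j => localFreq s j (D.smp s ω.1).2.1) ω.2.2 : ℝ)
      / ω.1.1 (D.smp s ω.1).1 (D.smp s ω.1).2 ^ (1 / D.p)) :=
    funext fun ω => D.prot_result hs ω.1 ω.2.1 ω.2.2
  rw [h]
  exact h4

end SamplerParams

theorem measurePreserving_snd_cond {Ω Ω' : Type} [MeasurableSpace Ω] [MeasurableSpace Ω']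
    (μ : Measure Ω) [IsProbabilityMeasure μ] (ν : Measure Ω') [IsProbabilityMeasure ν] {T : Set Ω}
    (h0 : μ T ≠ 0) :
    MeasurePreserving Prod.snd ((μ.prod ν)[|T ×ˢ Set.univ]) ν := by
  refine ⟨measurable_snd, ?_⟩
  rw [ProbabilityTheory.cond, ← Measure.prod_restrict, Measure.restrict_univ, Measure.prod_prod, measure_univ,
    mul_one, Measure.map_smul, Measure.map_snd_prod, Measure.restrict_apply_univ, smul_smul,
    ENNReal.inv_mul_cancel h0 (measure_ne_top _ _), one_smul]

/-! ### The exponential variables -/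

theorem measurePreserving_uncurry_expLaw {R n N : ℕ} :
    MeasurePreserving (fun (v : Fin R → Fin n × Fin N → ℝ) (x : Coord R n N) => v x.1 x.2)
      (expLaw R n N) (expPi (Coord R n N)) := by
  have hm : Measurable fun (v : Fin R → Fin n × Fin N → ℝ) (x : Coord R n N) => v x.1 x.2 :=
    measurable_pi_lambda _ fun x => (measurePreserving_coord x).measurable
  refine ⟨hm, (Measure.pi_eq fun s hs => ?_).symm⟩
  rw [Measure.map_apply hm (MeasurableSet.univ_pi hs)]
  have : (fun (v : Fin R → Fin n × Fin N → ℝ) (x : Coord R n N) => v x.1 x.2) ⁻¹' Set.univ.pi s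
      = Set.univ.pi fun r => Set.univ.pi fun y => s (r, y) := by
    ext v
    simp [Set.mem_pi]
  rw [this, Measure.pi_pi]
  simp only [Measure.pi_pi]
  rw [Fintype.prod_prod_type]

namespace SamplerParams

variable {n k : ℕ} (D : SamplerParams n k)

/-- The scaling variables. -/
def scale (x : Coord D.R n D.N) (ω : D.PubΩ) : ℝ := ω.1 x.1 x.2

theorem measurable_scale (x : Coord D.R n D.N) : Measurable (D.scale x) := by
  unfold scale; fun_prop

theorem map_scale (x : Coord D.R n D.N) : D.pubM.map (D.scale x) = expMeasure 1 :=
  ((measurePreserving_coord x).comp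
    (measurePreserving_fst (μ := expLaw D.R n D.N) (ν := hitLaw D.H k))).map_eq

theorem iIndepFun_scale : iIndepFun D.scale D.pubM := by
  rw [iIndepFun_iff_map_fun_eq_pi_map (fun x => (D.measurable_scale x).aemeasurable)]
  simp only [D.map_scale]
  exact (measurePreserving_uncurry_expLaw.comp
    (measurePreserving_fst (μ := expLaw D.R n D.N) (ν := hitLaw D.H k))).map_eq

theorem stdExponentials : D.prot.StdExponentials D.scale :=
  ⟨D.measurable_scale, D.iIndepFun_scale, D.map_scale⟩

/-! ### The estimates -/

theorem prot_sample {s : DStream n k} (hs : s.length < 2 ^ D.G) (ω : D.prot.Rand) :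
    D.prot.sample s ω = D.smp s ω.1 :=
  congrArg Prod.fst (D.prot_result hs ω.1 ω.2.1 ω.2.2)

theorem prot_index {s : DStream n k} (hs : s.length < 2 ^ D.G) (ω : D.prot.Rand) :
    D.prot.index s ω = (D.smp s ω.1).2.1 :=
  congrArg (fun x => x.2.1) (D.prot_sample hs ω)

theorem prot_est {s : DStream n k} (hs : s.length < 2 ^ D.G) (ω : D.prot.Rand) :
    D.prot.est s ω = (roundedSum (fun j => localFreq s j (D.smp s ω.1).2.1) ω.2.2 : ℝ)
      / D.scale (D.smp s ω.1) ω.1 ^ (1 / D.p) :=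
  congrArg Prod.snd (D.prot_result hs ω.1 ω.2.1 ω.2.2)

theorem integral_rounded {s : DStream n k} (hs : s.length < 2 ^ D.G) (i : Fin n) :
    ∫ u, (roundedSum (fun j => localFreq s j i) u.2 : ℝ) ∂privMeasure D.G k = freq s i := by
  rw [integral_roundedSum _ fun j => (localFreq_le_length s j i).trans_lt hs]
  simp [freq]

theorem rounded_le (s : DStream n k) (i : Fin n) (U : Fin k → Fin (2 ^ D.G)) :
    (roundedSum (fun j => localFreq s j i) U : ℝ) ≤ 2 * freq s i := by
  exact_mod_cast roundedSum_le (fun j => localFreq s j i) U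

theorem estimatesScaledAt {s : DStream n k} (hs : s.length < 2 ^ D.G) :
    D.prot.EstimatesScaledAt D.p 4 D.scale s := by
  have key : ∀ᵐ ω ∂D.pubM, ∀ x, (privMeasure D.G k) {_u | D.smp s ω = x} ≠ 0 →
      MemLp (fun u : Unit × (Fin k → Fin (2 ^ D.G)) =>
        (roundedSum (fun j => localFreq s j (D.smp s ω).2.1) u.2 : ℝ)
          / D.scale (D.smp s ω) ω ^ (1 / D.p)) 2 (privMeasure D.G k)[|{_u | D.smp s ω = x}] ∧
      ∫ u, (roundedSum (fun j => localFreq s j (D.smp s ω).2.1) u.2 : ℝ)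
          / D.scale (D.smp s ω) ω ^ (1 / D.p) ∂(privMeasure D.G k)[|{_u | D.smp s ω = x}]
        = scaled D.p s (fun y => D.scale y ω) x ∧
      ∫ u, ((roundedSum (fun j => localFreq s j (D.smp s ω).2.1) u.2 : ℝ)
          / D.scale (D.smp s ω) ω ^ (1 / D.p)) ^ 2 ∂(privMeasure D.G k)[|{_u | D.smp s ω = x}]
        ≤ 4 * scaled D.p s (fun y => D.scale y ω) x ^ 2 := by
    filter_upwards [pubMeasure_ae_pos] with ω hω x hx
    have hx' : D.smp s ω = x := by
      by_contra h
      simp [h] at hx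
    subst hx'
    simp only [Set.ofPred_true, cond_univ]
    have hpos : 0 < D.scale (D.smp s ω) ω ^ (1 / D.p) := Real.rpow_pos_of_pos (hω _ _) _
    set i := (D.smp s ω).2.1 with hi
    set z := D.scale (D.smp s ω) ω ^ (1 / D.p) with hz
    refine ⟨?_, ?_, ?_⟩
    · simp only [div_eq_mul_inv]
      exact (memLp_roundedSum _).mul_const _
    · rw [integral_div, D.integral_rounded hs, scaled]
    · refine (integral_mono_of_nonneg (Filter.Eventually.of_forall fun u => sq_nonneg _)
        (integrable_const (4 * scaled D.p s (fun y => D.scale y ω) (D.smp s ω) ^ 2))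
        (Filter.Eventually.of_forall fun u => ?_)).trans (by simp)
      have h1 := D.rounded_le s i u.2
      have h2 : (roundedSum (fun j => localFreq s j i) u.2 : ℝ) / z ≤ 2 * (freq s i / z) := by
        rw [← mul_div_assoc]; gcongr
      have h3 : 0 ≤ (roundedSum (fun j => localFreq s j i) u.2 : ℝ) / z := by positivity
      calc ((roundedSum (fun j => localFreq s j i) u.2 : ℝ) / z) ^ 2
          ≤ (2 * (freq s i / z)) ^ 2 := by gcongr
        _ = 4 * (freq s i / z) ^ 2 := by ring
  refine Filter.Eventually.mono (show ∀ᵐ ω ∂D.prot.pubLaw, _ from key) fun ω h x hx => ?_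
  simp only [D.prot_est hs, D.prot_sample hs] at hx ⊢
  exact h x hx

theorem estimatesFreqAt {s : DStream n k} (hs : s.length < 2 ^ D.G) :
    D.prot.EstimatesFreqAt D.p D.scale s := by
  have key : ∀ i, (D.pubM.prod (privMeasure D.G k)) {ω | (D.smp s ω.1).2.1 = i} ≠ 0 →
      ∀ g : D.PubΩ × (Unit × (Fin k → Fin (2 ^ D.G))) → ℝ,
      (∀ ω, g ω = (roundedSum (fun j => localFreq s j (D.smp s ω.1).2.1) ω.2.2 : ℝ)
        / D.scale (D.smp s ω.1) ω.1 ^ (1 / D.p) * D.scale (D.smp s ω.1) ω.1 ^ (1 / D.p)) →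
      MemLp g 2 (D.pubM.prod (privMeasure D.G k))[|{ω | (D.smp s ω.1).2.1 = i}] ∧
      ∫ ω, g ω ∂(D.pubM.prod (privMeasure D.G k))[|{ω | (D.smp s ω.1).2.1 = i}] = freq s i ∧
      ∫ ω, (g ω - freq s i) ^ 2
          ∂(D.pubM.prod (privMeasure D.G k))[|{ω | (D.smp s ω.1).2.1 = i}]
        ≤ (freq s i : ℝ) ^ 2 := by
    intro i h0 g hg
    set T : Set D.PubΩ := {ω | (D.smp s ω).2.1 = i} with hT
    have hTm : MeasurableSet T :=
      (D.measurable_smp s) (MeasurableSet.of_discrete (s := {x : Coord D.R n D.N | x.2.1 = i}))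
    have hset : {ω : D.PubΩ × (Unit × (Fin k → Fin (2 ^ D.G))) | (D.smp s ω.1).2.1 = i}
        = T ×ˢ Set.univ := by
      ext ω; simp [hT]
    rw [hset] at h0 ⊢
    rw [Measure.prod_prod, measure_univ, mul_one] at h0
    have hmp := measurePreserving_snd_cond D.pubM (privMeasure D.G k) h0
    set ν := (D.pubM.prod (privMeasure D.G k))[|T ×ˢ Set.univ] with hν
    have hν1 : IsProbabilityMeasure ν :=
      cond_isProbabilityMeasure (by rw [Measure.prod_prod, measure_univ, mul_one]; exact h0)
    have hae : g =ᵐ[ν] fun ω => (roundedSum (fun j => localFreq s j i) ω.2.2 : ℝ) := by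
      have h1 : ∀ᵐ ω ∂ν, ω ∈ T ×ˢ (Set.univ : Set (Unit × (Fin k → Fin (2 ^ D.G)))) :=
        ae_cond_mem (hTm.prod MeasurableSet.univ)
      have h2 : ∀ᵐ ω ∂ν, ∀ r y, 0 < ω.1.1 r y :=
        cond_absolutelyContinuous.ae_le
          (Measure.quasiMeasurePreserving_fst.ae pubMeasure_ae_pos)
      filter_upwards [h1, h2] with ω h1 h2
      have hi : (D.smp s ω.1).2.1 = i := h1.1
      have hpos : 0 < D.scale (D.smp s ω.1) ω.1 ^ (1 / D.p) := Real.rpow_pos_of_pos (h2 _ _) _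
      rw [hg, div_mul_cancel₀ _ hpos.ne', hi]
    refine ⟨?_, ?_, ?_⟩
    · exact (memLp_congr_ae hae).2 ((memLp_roundedSum _).comp_measurePreserving hmp)
    · rw [integral_congr_ae hae, ← D.integral_rounded hs i, ← hmp.map_eq,
        integral_map hmp.measurable.aemeasurable
          (Measurable.of_discrete.aestronglyMeasurable)]
    · refine (integral_mono_of_nonneg (Filter.Eventually.of_forall fun u => sq_nonneg _)
        (integrable_const ((freq s i : ℝ) ^ 2)) (hae.mono fun ω h => ?_)).trans (by simp)
      have h1 := D.rounded_le s i ω.2.2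
      have h3 : 0 ≤ (roundedSum (fun j => localFreq s j i) ω.2.2 : ℝ) := by positivity
      simp only [h]
      exact sq_le_sq' (by linarith) (by linarith)
  intro i hi
  simp only [D.prot_index hs] at hi ⊢
  exact key i hi _ fun ω => by
    refine Eq.trans ?_ (congrArg₂ (· * ·) (D.prot_est hs ω)
      (congrArg (fun x => D.scale x ω.1 ^ (1 / D.p)) (D.prot_sample hs ω)))
    rfl

end SamplerParams

theorem sum_localFreq_le_length {n k : ℕ} (s : DStream n k) :
    ∑ i, freq s i ≤ s.length := by
  unfold freq localFreq
  induction s with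
  | nil => simp
  | cons u s ih =>
    simp only [List.count_cons, Finset.sum_add_distrib, List.length_cons]
    refine Nat.add_le_add ih ?_
    rw [Finset.sum_eq_single u.1, Finset.sum_eq_single u.2] <;> aesop

theorem freq_le_length {n k : ℕ} (s : DStream n k) (i : Fin n) : freq s i ≤ s.length :=
  (Finset.single_le_sum (f := freq s) (fun _ _ => Nat.zero_le _) (Finset.mem_univ i)).trans
    (sum_localFreq_le_length s)

/-- A coordinate that wins is a largest one of its instance. -/
theorem scaled_le_of_wins {R n N Q k : ℕ} {p : ℝ} (hp : 1 ≤ p) (hN : 1 ≤ N) {s : DStream n k}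
    {v : Fin R → Fin n × Fin N → ℝ} (hv : ∀ r y, 0 < v r y) {x : Coord R n N}
    (hx : Wins (reachedKeys (Q := Q) (fun i => (freq s i : ℝ) ^ p) v) x) (y : Fin n × Fin N) :
    scaled p s (fun z : Coord R n N => v z.1 z.2) (x.1, y)
      ≤ scaled p s (fun z : Coord R n N => v z.1 z.2) x := by
  obtain ⟨q, h1, -, h3⟩ := hx
  by_cases hy : (x.1, y) = x
  · rw [hy]
  have h2 : ((((x.1, y) : Coord R n N), q) : Key R n N Q)
      ∉ reachedKeys (fun i => (freq s i : ℝ) ^ p) v := fun h => hy (h3 _ h rfl)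
  have hNpos : (0 : ℝ) < N := by exact_mod_cast hN
  have hiff : ∀ z : Coord R n N, ((z, q) : Key R n N Q)
      ∈ reachedKeys (fun i => (freq s i : ℝ) ^ p) v
      ↔ ((N : ℝ) * 2 ^ q.1) ^ (1 / p) ≤ scaled p s (fun z : Coord R n N => v z.1 z.2) z := by
    intro z
    have hz := hv z.1 z.2
    have h : ((z, q) : Key R n N Q) ∈ reachedKeys (fun i => (freq s i : ℝ) ^ p) v ↔
      reach p N q.1 (v z.1 z.2) ≤ freq s z.2.1 := (reach_le_iff hp hz.le (Nat.cast_nonneg _)).symm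
    rw [h, reach, Real.mul_rpow (by positivity) hz.le, scaled, le_div_iff₀]
    exact Real.rpow_pos_of_pos hz _
  rw [hiff] at h1 h2
  exact (not_le.1 h2).le.trans h1

namespace SamplerParams

variable {n k : ℕ} (D : SamplerParams n k)

/-- The weights of the items. -/
noncomputable def lam (s : DStream n k) (i : Fin n) : ℝ := (freq s i : ℝ) ^ D.p

theorem lam_nonneg (s : DStream n k) (i : Fin n) : 0 ≤ D.lam s i := by
  unfold lam; positivity

/-- Some key has reached its threshold without being hit in all groups. -/
def miss (s : DStream n k) : Set D.PubΩ :=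
  {ω | ∃ κ ∈ reachedKeys (Q := D.Q) (D.lam s) ω.1,
    ¬ AllHit D.p D.ρ κ (fun j => localFreq s j κ.item) ω}

/-- A bound for the probability of `miss`. -/
noncomputable def missBound : ℝ :=
  Fintype.card (Key D.R n D.N D.Q) * (D.H * Real.exp (-(3 / 4 * D.ρ)))

theorem missBound_nonneg : 0 ≤ D.missBound := by unfold missBound; positivity

theorem lam_eq_sum (s : DStream n k) (i : Fin n) :
    D.lam s i = (∑ j, (localFreq s j i : ℝ)) ^ D.p := by
  simp [lam, freq]

theorem measure_miss_le (s : DStream n k) : D.pubM (D.miss s) ≤ ENNReal.ofReal D.missBound := by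
  have h : D.miss s = ⋃ κ : Key D.R n D.N D.Q,
      {ω | D.N * 2 ^ κ.2.1 * ω.1 κ.1.1 κ.1.2 ≤ (∑ j, (localFreq s j κ.item : ℝ)) ^ D.p ∧
        ¬ AllHit D.p D.ρ κ (fun j => localFreq s j κ.item) ω} := by
    ext ω
    simp only [miss, reachedKeys, lam_eq_sum, Set.mem_iUnion]
    rfl
  rw [h]
  refine (measure_iUnion_fintype_le _ _).trans ((Finset.sum_le_sum fun κ _ =>
    pubMeasure_miss_le D.one_le_p D.ρ_pos D.one_le_N D.one_le_k κ _).trans ?_)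
  rw [Finset.sum_const, Finset.card_univ, missBound,
    ENNReal.ofReal_mul (p := (Fintype.card (Key D.R n D.N D.Q) : ℝ)) (by positivity),
    ENNReal.ofReal_natCast, nsmul_eq_mul]

theorem tau_le_freq_iff {s : DStream n k} (hs : s.length < 2 ^ D.G) {ω : D.PubΩ}
    (hω : ∀ r y, 0 < ω.1 r y) (κ : Key D.R n D.N D.Q) :
    D.tau ω κ ≤ freq s κ.item ↔ κ ∈ reachedKeys (D.lam s) ω.1 := by
  have h1 := (freq_le_length s κ.item).trans_lt hs
  rw [tau, min_le_iff, or_iff_left (not_le.2 h1), Nat.ceil_le,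
    reach_le_iff D.one_le_p (hω _ _).le (Nat.cast_nonneg _)]
  rfl

/-- Without a miss the winners are those of the ideal sample. -/
theorem wins_found_iff {s : DStream n k} (hs : s.length < 2 ^ D.G) {ω : D.PubΩ}
    (hω : ∀ r y, 0 < ω.1 r y) (hm : ω ∉ D.miss s) (x : Coord D.R n D.N) :
    Wins {κ | (κ, 0) ∈ D.cmds s ω} x ↔ Wins (reachedKeys (Q := D.Q) (D.lam s) ω.1) x := by
  refine wins_congr (fun κ hκ => ?_) (fun κ hκ => ?_) x
  · rw [← D.tau_le_freq_iff hs hω]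
    exact threshold_le_of_found D.one_le_H D.one_le_k (D.tau_le ω) hκ
  · have hhit : AllHit D.p D.ρ κ (fun j => localFreq s j κ.item) ω := by
      by_contra h
      exact hm ⟨κ, hκ, h⟩
    exact found_or_dead (θ := D.theta ω) D.one_le_H D.one_le_k (D.tau_le ω) hs
      ((D.tau_le_freq_iff hs hω κ).2 hκ) hhit

theorem smp_of_mem_sampleSet {s : DStream n k} (hs : s.length < 2 ^ D.G) {ω : D.PubΩ}
    (hω : ∀ r y, 0 < ω.1 r y) (hm : ω ∉ D.miss s) {i : Fin n}
    (h : ω.1 ∈ sampleSet D.R D.N D.Q (D.lam s) i) :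
    (D.smp s ω).2.1 = i ∧ Wins (reachedKeys (Q := D.Q) (D.lam s) ω.1) (D.smp s ω) := by
  obtain ⟨x, hx, hw, hmin⟩ := exists_wins_of_mem_sampleSet hω D.one_le_N h
  have : D.smp s ω = x := by
    rw [smp, choice, pick_congr (D.wins_found_iff hs hω hm)]
    exact pick_eq hw hmin
  rw [this]
  exact ⟨hx, hw⟩

theorem law_real_fst (T : Set D.PubΩ) : D.prot.law.real {ω | ω.1 ∈ T} = D.pubM.real T := by
  have h : (D.pubM.prod (privMeasure D.G k)) (T ×ˢ Set.univ) = D.pubM T := by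
    rw [Measure.prod_prod, measure_univ, mul_one]
  have h2 : D.prot.law {ω | ω.1 ∈ T} = D.pubM T := by
    rw [← h]
    refine congrArg (D.pubM.prod (privMeasure D.G k)) ?_
    exact Set.ext fun ω => ⟨fun h => ⟨h, trivial⟩, fun h => h.1⟩
  rw [Measure.real, h2, Measure.real]

theorem measureReal_fst (T : Set (Fin D.R → Fin n × Fin D.N → ℝ)) :
    D.pubM.real {ω | ω.1 ∈ T} = (expLaw D.R n D.N).real T := by
  have h : D.pubM (T ×ˢ Set.univ) = expLaw D.R n D.N T := by
    rw [Measure.prod_prod, measure_univ, mul_one]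
  have h2 : {ω : D.PubΩ | ω.1 ∈ T} = T ×ˢ Set.univ := by ext; simp
  rw [Measure.real, h2, h, Measure.real]

theorem measureReal_miss_le (s : DStream n k) : D.pubM.real (D.miss s) ≤ D.missBound := by
  rw [Measure.real]
  exact ENNReal.toReal_le_of_le_ofReal D.missBound_nonneg (D.measure_miss_le s)

theorem measureReal_mono_pos {A B : Set D.PubΩ}
    (h : ∀ ω : D.PubΩ, (∀ r y, 0 < ω.1 r y) → ω ∈ A → ω ∈ B) : D.pubM.real A ≤ D.pubM.real B := by
  rw [Measure.real, Measure.real]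
  refine ENNReal.toReal_mono (measure_ne_top _ _) (measure_mono_ae ?_)
  filter_upwards [pubMeasure_ae_pos] with ω hω
  exact h ω hω

theorem measureReal_iUnion_sampleSet (s : DStream n k) :
    (expLaw D.R n D.N).real (⋃ i, sampleSet D.R D.N D.Q (D.lam s) i)
      = ∑ i, (expLaw D.R n D.N).real (sampleSet D.R D.N D.Q (D.lam s) i) := by
  rw [measureReal_iUnion_fintype]
  · intro i i' hii
    refine Set.disjoint_left.2 fun v hv hv' => hii ?_
    exact sampleSet_disjoint (D.lam_nonneg s) D.one_le_N hv hv'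
  · exact fun i => measurableSet_sampleSet i

theorem perfectAt {s : DStream n k} (hs : s.length < 2 ^ D.G) (h1 : 1 ≤ ∑ i, D.lam s i)
    (h2 : ∑ i, D.lam s i ≤ 2 ^ D.Q) {ε : ℝ} (hε : ε ≤ 1) (hN : (∑ i, D.lam s i) / D.N ≤ ε) :
    D.prot.PerfectAt D.p (ε + 2 * (15 / 16) ^ D.R + D.missBound) s := by
  obtain ⟨hb, hsum⟩ := sampleSet_bounds (R := D.R) (D.lam_nonneg s) D.one_le_N h1 h2 hε hN
  intro i
  simp only [D.prot_index hs]
  rw [show lpProb D.p s i = D.lam s i / ∑ i, D.lam s i from rfl]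
  have e1 := D.law_real_fst {ω | (D.smp s ω).2.1 = i}
  have e2 : D.prot.law.real {ω | (D.smp s ω.1).2.1 = i}
      = D.pubM.real {ω | (D.smp s ω).2.1 = i} := e1
  rw [e2]
  have hlow : (expLaw D.R n D.N).real (sampleSet D.R D.N D.Q (D.lam s) i)
      ≤ D.pubM.real {ω | (D.smp s ω).2.1 = i} + D.missBound := by
    rw [← D.measureReal_fst]
    refine (D.measureReal_mono_pos (B := {ω | (D.smp s ω).2.1 = i} ∪ D.miss s)
      fun ω hω h => ?_).trans ((measureReal_union_le _ _).trans
        (add_le_add le_rfl (D.measureReal_miss_le s)))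
    by_cases hm : ω ∈ D.miss s
    · exact Or.inr hm
    · exact Or.inl (D.smp_of_mem_sampleSet hs hω hm h).1
  have hupp : D.pubM.real {ω | (D.smp s ω).2.1 = i}
      ≤ (expLaw D.R n D.N).real (sampleSet D.R D.N D.Q (D.lam s) i) + (15 / 16) ^ D.R
        + D.missBound := by
    have hc : (expLaw D.R n D.N).real (⋃ i, sampleSet D.R D.N D.Q (D.lam s) i)ᶜ
        ≤ (15 / 16) ^ D.R := by
      rw [probReal_compl_eq_one_sub (MeasurableSet.iUnion fun i => measurableSet_sampleSet i),
        D.measureReal_iUnion_sampleSet]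
      linarith
    refine (D.measureReal_mono_pos
      (B := ({ω | ω.1 ∈ sampleSet D.R D.N D.Q (D.lam s) i} ∪
        {ω | ω.1 ∈ (⋃ i, sampleSet D.R D.N D.Q (D.lam s) i)ᶜ}) ∪ D.miss s)
      fun ω hω h => ?_).trans ((measureReal_union_le _ _).trans
        (add_le_add ((measureReal_union_le _ _).trans ?_) (D.measureReal_miss_le s)))
    · by_cases hm : ω ∈ D.miss s
      · exact Or.inr hm
      · by_cases hU : ω.1 ∈ ⋃ i, sampleSet D.R D.N D.Q (D.lam s) i
        · obtain ⟨i', hi'⟩ := Set.mem_iUnion.1 hU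
          have h3 := (D.smp_of_mem_sampleSet hs hω hm hi').1
          have h4 : (D.smp s ω).2.1 = i := h
          rw [← h4, h3]
          exact Or.inl (Or.inl hi')
        · exact Or.inl (Or.inr hU)
    · rw [D.measureReal_fst, D.measureReal_fst]
      linarith
  have hbi := abs_le.1 (hb i)
  have h0 : (0 : ℝ) ≤ (15 / 16) ^ D.R := by positivity
  rw [abs_le]
  constructor <;> linarith [hbi.1, hbi.2]

theorem maximizesAt {s : DStream n k} (hs : s.length < 2 ^ D.G) (h1 : 1 ≤ ∑ i, D.lam s i)
    (h2 : ∑ i, D.lam s i ≤ 2 ^ D.Q) {ε : ℝ} (hε : ε ≤ 1) (hN : (∑ i, D.lam s i) / D.N ≤ ε) :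
    D.prot.MaximizesAt D.p ((15 / 16) ^ D.R + D.missBound) D.scale s := by
  obtain ⟨-, hsum⟩ := sampleSet_bounds (R := D.R) (D.lam_nonneg s) D.one_le_N h1 h2 hε hN
  unfold Protocol.MaximizesAt
  simp only [D.prot_sample hs]
  have e1 := D.law_real_fst {ω | ∀ i l, scaled D.p s (fun x => D.scale x ω) ((D.smp s ω).1, i, l)
    ≤ scaled D.p s (fun x => D.scale x ω) (D.smp s ω)}
  refine le_trans ?_ (le_of_eq e1.symm)
  rw [← D.measureReal_iUnion_sampleSet, ← D.measureReal_fst] at hsum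
  have h3 := (D.measureReal_mono_pos (A := {ω | ω.1 ∈ ⋃ i, sampleSet D.R D.N D.Q (D.lam s) i})
    (B := {ω | ∀ i l, scaled D.p s (fun x => D.scale x ω) ((D.smp s ω).1, i, l)
      ≤ scaled D.p s (fun x => D.scale x ω) (D.smp s ω)} ∪ D.miss s)
    fun ω hω h => ?_).trans (measureReal_union_le _ _)
  · linarith [D.measureReal_miss_le s]
  · by_cases hm : ω ∈ D.miss s
    · exact Or.inr hm
    · obtain ⟨i', hi'⟩ := Set.mem_iUnion.1 h
      exact Or.inl fun i l => scaled_le_of_wins D.one_le_p D.one_le_N hω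
        (D.smp_of_mem_sampleSet hs hω hm hi').2 (i, l)

end SamplerParams

theorem sum_rpow_le_rpow_sum {ι : Type} (t : Finset ι) (f : ι → ℕ) {p : ℝ} (hp : 1 ≤ p) :
    ∑ i ∈ t, (f i : ℝ) ^ p ≤ (∑ i ∈ t, (f i : ℝ)) ^ p := by
  classical
  have h : ∑ i ∈ t, (f i : NNReal) ^ p ≤ (∑ i ∈ t, (f i : NNReal)) ^ p := by
    induction t using Finset.induction_on with
    | empty => simp
    | insert a t ha ih =>
      rw [Finset.sum_insert ha, Finset.sum_insert ha]
      exact (add_le_add le_rfl ih).trans (NNReal.add_rpow_le_rpow_add _ _ hp)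
  have h' := NNReal.coe_le_coe.2 h
  push_cast at h'
  exact h'

theorem sum_key_le {R n N Q : ℕ} (hN : 1 ≤ N) {φ : Fin n → Fin (Q + 1) → ℝ} {c : ℝ}
    (h : ∀ q, ∑ i, φ i q ≤ c) :
    ∑ κ : Key R n N Q, φ κ.item κ.2 / N ≤ R * (Q + 1) * c := by
  have hNpos : (0 : ℝ) < N := by exact_mod_cast hN
  rw [Fintype.sum_prod_type_right]
  have h1 : ∀ q : Fin (Q + 1), ∑ x : Coord R n N, φ x.2.1 q / N = R * ∑ i, φ i q := by
    intro q
    rw [Fintype.sum_prod_type]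
    simp only [Fintype.sum_prod_type, Finset.sum_const, Finset.card_univ, Fintype.card_fin,
      nsmul_eq_mul, Finset.mul_sum]
    refine Finset.sum_congr rfl fun i _ => ?_
    field_simp
  calc ∑ q : Fin (Q + 1), ∑ x : Coord R n N, φ x.2.1 q / N
      = ∑ q : Fin (Q + 1), R * ∑ i, φ i q := Finset.sum_congr rfl fun q _ => h1 q
    _ ≤ ∑ _q : Fin (Q + 1), R * c := by gcongr with q; exact h q
    _ = _ := by simp; ring

theorem rpow_add_one_le {p : ℝ} (hp : 1 ≤ p) (f : ℕ) :
    ((f : ℝ) + 1) ^ p ≤ 2 ^ p * (f : ℝ) ^ p + 1 := by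
  rcases Nat.eq_zero_or_pos f with rfl | hf
  · have : (0 : ℝ) ^ p = 0 := Real.zero_rpow (by linarith)
    simp [this]
  · have h1 : (1 : ℝ) ≤ f := by exact_mod_cast hf
    rw [← Real.mul_rpow (by norm_num) (by positivity)]
    have : ((f : ℝ) + 1) ^ p ≤ (2 * f) ^ p :=
      Real.rpow_le_rpow (by positivity) (by linarith) (by linarith)
    linarith

theorem freq_append_singleton {n k : ℕ} (s : DStream n k) (u : Fin n × Fin k) (i : Fin n) :
    freq (s ++ [u]) i = freq s i + if i = u.1 then 1 else 0 := by
  unfold freq localFreq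
  simp only [List.count_append, Finset.sum_add_distrib, List.count_singleton]
  congr 1
  by_cases h : i = u.1
  · subst h
    rw [Finset.sum_eq_single u.2] <;> aesop
  · simp only [h, if_false]
    refine Finset.sum_eq_zero fun j _ => ?_
    aesop

namespace SamplerParams

variable {n k : ℕ} (D : SamplerParams n k)

theorem sum_lam_append_singleton (s : DStream n k) (u : Fin n × Fin k) :
    ∑ i, D.lam (s ++ [u]) i ≤ 2 ^ D.p * (∑ i, D.lam s i) + 1 := by
  have h : ∀ i, D.lam (s ++ [u]) i ≤ 2 ^ D.p * D.lam s i + if i = u.1 then 1 else 0 := by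
    intro i
    have h2 : (1 : ℝ) ≤ 2 ^ D.p := Real.one_le_rpow (by norm_num) (by linarith [D.one_le_p])
    unfold lam
    rw [freq_append_singleton]
    split_ifs
    · push_cast
      exact rpow_add_one_le D.one_le_p _
    · have : (0 : ℝ) ≤ (freq s i : ℝ) ^ D.p := by positivity
      push_cast
      rw [add_zero, add_zero]
      nlinarith
  refine (Finset.sum_le_sum fun i _ => h i).trans ?_
  rw [Finset.sum_add_distrib, ← Finset.mul_sum]
  simp

theorem sum_lam_le (s : DStream n k) : ∑ i, D.lam s i ≤ (s.length : ℝ) ^ D.p := by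
  refine (sum_rpow_le_rpow_sum _ _ D.one_le_p).trans ?_
  refine Real.rpow_le_rpow (by positivity) ?_ (by linarith [D.one_le_p])
  exact_mod_cast sum_localFreq_le_length s

/-- A stream can be cut such that the first part has weight about `W`, unless the whole stream has
less. -/
theorem exists_cut {W : ℝ} (hW : 1 ≤ W) (s : DStream n k) :
    ∃ s₁ s₂ : DStream n k, s = s₁ ++ s₂ ∧ ∑ i, D.lam s₁ i ≤ (2 ^ D.p + 1) * W ∧
      (s₂ = [] ∨ W < ∑ i, D.lam s₁ i) := by
  have h2 : (0 : ℝ) ≤ 2 ^ D.p := by positivity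
  induction s using List.reverseRecOn with
  | nil =>
    refine ⟨[], [], rfl, ?_, Or.inl rfl⟩
    refine (D.sum_lam_le []).trans ?_
    simp only [List.length_nil, Nat.cast_zero]
    rw [Real.zero_rpow (by linarith [D.one_le_p])]
    positivity
  | append_singleton s u ih =>
    rcases le_or_gt (∑ i, D.lam s i) W with hle | hlt
    · refine ⟨s ++ [u], [], by simp, ?_, Or.inl rfl⟩
      refine (D.sum_lam_append_singleton s u).trans ?_
      nlinarith
    · obtain ⟨s₁, s₂, h1, h3, h4⟩ := ih
      refine ⟨s₁, s₂ ++ [u], by rw [h1, List.append_assoc], h3, Or.inr ?_⟩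
      rcases h4 with rfl | h4
      · rw [List.append_nil] at h1
        rwa [← h1]
      · exact h4

/-- The hits of a key may still change after the first part of the stream. -/
def alive (s₁ s₂ : DStream n k) (κ : Key D.R n D.N D.Q) : Set D.PubΩ :=
  {ω | s₂ ≠ [] ∧ ¬ DeadKey (D.cmds s₁ ω) κ}

/-- A hit is true after the first part of the stream. -/
def hitSet (s₁ : DStream n k) (κ : Key D.R n D.N D.Q) (h : Fin D.H) (j : Fin k) : Set D.PubΩ :=
  {ω | 1 ≤ localFreq s₁ j κ.item ∧ D.theta ω j κ h ≤ localFreq s₁ j κ.item}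

/-- A key is hit in all groups after the first part of the stream. -/
def activeSet (s₁ : DStream n k) (κ : Key D.R n D.N D.Q) : Set D.PubΩ :=
  {ω | ∀ h, ∃ j, ω ∈ D.hitSet s₁ κ h j}

theorem measurableSet_of_digest
    (g : ((Key D.R n D.N D.Q → ℕ) × (Fin k → Key D.R n D.N D.Q → Fin D.H → ℕ)) → Prop) :
    MeasurableSet {ω | g (D.digest ω)} :=
  D.measurable_digest (MeasurableSet.of_discrete (s := {d | g d}))

theorem measurableSet_alive (s₁ s₂ : DStream n k) (κ : Key D.R n D.N D.Q) :
    MeasurableSet (D.alive s₁ s₂ κ) :=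
  D.measurableSet_of_digest fun d => s₂ ≠ [] ∧
    ¬ DeadKey (D.scheme.run (fun j => (d.2 j, ⟨0, by positivity⟩)) d.1 s₁).cmds κ

theorem measurableSet_hitSet (s₁ : DStream n k) (κ : Key D.R n D.N D.Q) (h : Fin D.H)
    (j : Fin k) : MeasurableSet (D.hitSet s₁ κ h j) :=
  D.measurableSet_of_digest fun d => 1 ≤ localFreq s₁ j κ.item ∧
    d.2 j κ h ≤ localFreq s₁ j κ.item

theorem measurableSet_activeSet (s₁ : DStream n k) (κ : Key D.R n D.N D.Q) :
    MeasurableSet (D.activeSet s₁ κ) :=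
  D.measurableSet_of_digest fun d => ∀ h, ∃ j, 1 ≤ localFreq s₁ j κ.item ∧
    d.2 j κ h ≤ localFreq s₁ j κ.item

theorem hit_run {s₁ s₂ : DStream n k} {ω : D.PubΩ} {U : Fin k → Fin (2 ^ D.G)}
    {κ : Key D.R n D.N D.Q} {h : Fin D.H} {j : Fin k}
    (hm : Sum.inl (κ, h) ∈ (D.state (s₁ ++ s₂) ω U).K j) :
    ω ∈ D.hitSet s₁ κ h j ∪ D.alive s₁ s₂ κ := by
  by_cases ha : ω ∈ D.alive s₁ s₂ κ
  · exact Or.inr ha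
  refine Or.inl ?_
  have h1 : Sum.inl (κ, h) ∈ (D.state s₁ ω U).K j := by
    by_cases h2 : s₂ = []
    · rwa [h2, List.append_nil] at hm
    · have hd : DeadKey (D.cmds s₁ ω) κ := by
        by_contra hd
        exact ha ⟨h2, hd⟩
      rw [← D.state_cmds s₁ ω U] at hd
      exact hit_frozen D.one_le_H hd hm
  have ht := (justified_run (i₀ := D.dflt.2.1) (w := D.w) (hA := D.card_atom_le)
    (hC := D.card_cmd_le) (θ := D.theta ω) (U := U) D.one_le_H D.one_le_k
    (D.tau_le ω) s₁).1 j _ h1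
  rw [Scheme.run_F] at ht
  exact ht

theorem active_run {s₁ s₂ : DStream n k} {ω : D.PubΩ} {U : Fin k → Fin (2 ^ D.G)}
    {κ : Key D.R n D.N D.Q} (hm : (κ, Fin.last (D.G + 1)) ∈ (D.state (s₁ ++ s₂) ω U).cmds) :
    ω ∈ D.activeSet s₁ κ ∪ D.alive s₁ s₂ κ := by
  by_cases ha : ω ∈ D.alive s₁ s₂ κ
  · exact Or.inr ha
  refine Or.inl fun h => ?_
  obtain ⟨j, hj⟩ := (justified_run (i₀ := D.dflt.2.1) (w := D.w) (hA := D.card_atom_le)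
    (hC := D.card_cmd_le) (θ := D.theta ω) (U := U) D.one_le_H D.one_le_k
    (D.tau_le ω) (s₁ ++ s₂)).2.hit κ hm h
  exact ⟨j, (D.hit_run hj).resolve_right ha⟩

theorem measure_alive_le {s₁ s₂ : DStream n k} (hs : s₁.length < 2 ^ D.G) {M : ℝ}
    (κ : Key D.R n D.N D.Q) (hcut : s₂ = [] ∨ M * 2 ^ κ.2.1 < ∑ i, D.lam s₁ i)
    (hM : 1 ≤ M) (hQ : ∑ i, D.lam s₁ i ≤ 2 ^ D.Q) :
    D.pubM (D.alive s₁ s₂ κ) ≤ ENNReal.ofReal (Real.exp (-(M / 2)) + D.missBound) := by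
  by_cases h2 : s₂ = []
  · simp [alive, h2]
  have hcut := hcut.resolve_left h2
  have hq : κ.2.1 + 1 < D.Q + 1 := by
    by_contra hq
    have : κ.2.1 = D.Q := by omega
    rw [this] at hcut
    have h3 : (0 : ℝ) < 2 ^ D.Q := by positivity
    nlinarith
  set q : Fin (D.Q + 1) := ⟨κ.2.1 + 1, hq⟩ with hqdef
  have hsub : ∀ᵐ ω ∂D.pubM, ω ∈ D.alive s₁ s₂ κ → ω ∈
      ({v | ∀ y, (((κ.1.1, y), q) : Key D.R n D.N D.Q) ∉ reachedKeys (D.lam s₁) v} ×ˢ Set.univ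
      ∪ D.miss s₁ : Set D.PubΩ) := by
    filter_upwards [pubMeasure_ae_pos] with ω hω ha
    by_contra hn
    rw [Set.mem_union, not_or] at hn
    obtain ⟨hn1, hn2⟩ := hn
    have hn1' : ¬ ∀ y, (((κ.1.1, y), q) : Key D.R n D.N D.Q) ∉ reachedKeys (D.lam s₁) ω.1 :=
      fun h => hn1 ⟨h, trivial⟩
    push Not at hn1'
    obtain ⟨y, hy⟩ := hn1'
    have hhit : AllHit D.p D.ρ (((κ.1.1, y), q) : Key D.R n D.N D.Q)
        (fun j => localFreq s₁ j y.1) ω := by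
      by_contra h
      exact hn2 ⟨_, hy, h⟩
    have hlt : κ.2 < q := by rw [Fin.lt_def, hqdef]; simp
    rcases found_or_dead (i₀ := D.dflt.2.1) (w := D.w) (hA := D.card_atom_le)
      (hC := D.card_cmd_le) (U := fun _ => ⟨0, by positivity⟩)
      (θ := D.theta ω) D.one_le_H D.one_le_k (D.tau_le ω) hs
      ((D.tau_le_freq_iff hs hω _).2 hy) hhit with hf | ⟨κ', hf, hr, hl⟩
    · exact ha.2 ⟨_, hf, rfl, hlt⟩
    · exact ha.2 ⟨κ', hf, hr, hlt.trans hl⟩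
  refine (measure_mono_ae hsub).trans ((measure_union_le _ _).trans ?_)
  rw [Measure.prod_prod, measure_univ, mul_one,
    ENNReal.ofReal_add (Real.exp_pos _).le D.missBound_nonneg]
  refine add_le_add ((expLaw_no_reached_le D.one_le_N _ _).trans
    (ENNReal.ofReal_le_ofReal ?_)) (D.measure_miss_le s₁)
  rw [Real.exp_le_exp, neg_le_neg_iff, div_le_div_iff₀ (by norm_num) (by positivity), hqdef,
    pow_succ]
  linarith

end SamplerParams

namespace SamplerParams

variable {n k : ℕ} (D : SamplerParams n k)

theorem bits_state_le {s : DStream n k} (hs : s.length < 2 ^ D.G)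
    {s₁ s₂ : Fin (D.Q + 1) → DStream n k} (hcut : ∀ q, s = s₁ q ++ s₂ q) (ω : D.PubΩ)
    (U : Fin k → Fin (2 ^ D.G)) :
    ((D.state s ω U).bits : ℝ≥0∞) ≤ (D.w + 3 : ℕ) *
      ((∑ κ : Key D.R n D.N D.Q, ∑ h : Fin D.H, ∑ j : Fin k,
          (D.hitSet (s₁ κ.2) κ h j ∪ D.alive (s₁ κ.2) (s₂ κ.2) κ).indicator 1 ω)
        + (∑ κ : Key D.R n D.N D.Q,
          (D.activeSet (s₁ κ.2) κ ∪ D.alive (s₁ κ.2) (s₂ κ.2) κ).indicator 1 ω)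
          * (6 * k * (D.G + 2) : ℕ) + (k * (D.G + 2) : ℕ)) := by
  have h1 := Scheme.bits_run_le (S := D.scheme) (si := fun j => (D.theta ω j, U j))
    (ci := D.tau ω) (quiet_track D.one_le_H) s
  have h2 := card_run_le (i₀ := D.dflt.2.1) (w := D.w) (hA := D.card_atom_le)
    (hC := D.card_cmd_le) (θ := D.theta ω) (U := U) (τ := D.tau ω) D.one_le_H D.one_le_k
    (D.tau_le ω) hs rfl
  have h3 := h1.trans (Nat.mul_le_mul_left _ h2)
  have h4 : ((D.state s ω U).bits : ℝ≥0∞) ≤ _ := Nat.cast_le.2 h3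
  refine h4.trans ?_
  rw [Nat.cast_mul]
  refine mul_le_mul_right ?_ _
  rw [Nat.cast_add, Nat.cast_add, Nat.cast_mul (∑ κ : Key D.R n D.N D.Q, _)]
  simp only [Nat.cast_sum]
  refine add_le_add (add_le_add ?_ (mul_le_mul_left ?_ _)) le_rfl
  · refine Finset.sum_le_sum fun κ _ => Finset.sum_le_sum fun h _ => Finset.sum_le_sum fun j _ => ?_
    split_ifs with hm
    · have hm' : Sum.inl (κ, h) ∈ (D.state s ω U).K j := hm
      rw [hcut κ.2] at hm'
      rw [Set.indicator_of_mem (D.hit_run hm')]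
      simp
    · simp
  · refine Finset.sum_le_sum fun κ _ => ?_
    split_ifs with hm
    · have hm' : (κ, Fin.last (D.G + 1)) ∈ (D.state s ω U).cmds := hm
      rw [hcut κ.2] at hm'
      rw [Set.indicator_of_mem (D.active_run hm')]
      simp
    · simp

/-- A bound for the expected number of hits. -/
noncomputable def hitCost (M : ℝ) (Z : ℕ) : ℝ :=
  D.H * (2 * (Z + 1) * (D.ρ * (4 * k) ^ (D.p - 1)) * (D.R * (D.Q + 1) * ((2 ^ D.p + 1) * M))
    + Fintype.card (Key D.R n D.N D.Q) * k
      * ((1 / 2) ^ Z + (Real.exp (-(M / 2)) + D.missBound)))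

/-- A bound for the expected number of active keys. -/
noncomputable def activeCost (M : ℝ) : ℝ :=
  (8 * D.ρ) ^ D.p * (D.R * (D.Q + 1) * ((2 ^ D.p + 1) * M))
    + Fintype.card (Key D.R n D.N D.Q)
      * ((1 / 8) ^ D.H + (Real.exp (-(M / 2)) + D.missBound))

theorem lintegral_comm_le {s : DStream n k} (hs : s.length < 2 ^ D.G)
    (hQ : (s.length : ℝ) ^ D.p ≤ 2 ^ D.Q) {M : ℝ} (hM : 1 ≤ M) (Z : ℕ) :
    ∫⁻ ω, (D.prot.comm s ω : ℝ≥0∞) ∂D.prot.law ≤ ENNReal.ofReal ((D.w + 3) *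
      (D.hitCost M Z + D.activeCost M * (6 * k * (D.G + 2)) + k * (D.G + 2))) := by
  have hNpos : (0 : ℝ) < D.N := by exact_mod_cast D.one_le_N
  have hρ := D.ρ_pos
  have hmb := D.missBound_nonneg
  have hc : ∀ q : Fin (D.Q + 1), ∃ s₁ s₂ : DStream n k, s = s₁ ++ s₂ ∧
      ∑ i, D.lam s₁ i ≤ (2 ^ D.p + 1) * (M * 2 ^ q.1) ∧
      (s₂ = [] ∨ M * 2 ^ q.1 < ∑ i, D.lam s₁ i) := fun q =>
    D.exists_cut (one_le_mul_of_one_le_of_one_le hM (one_le_pow₀ (by norm_num))) s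
  choose s₁ s₂ hcut hle hend using hc
  have hlen : ∀ q, (s₁ q).length ≤ s.length := fun q => by
    have := congrArg List.length (hcut q)
    rw [List.length_append] at this
    omega
  have halive : ∀ κ : Key D.R n D.N D.Q, D.pubM (D.alive (s₁ κ.2) (s₂ κ.2) κ)
      ≤ ENNReal.ofReal (Real.exp (-(M / 2)) + D.missBound) := fun κ => by
    refine D.measure_alive_le ((hlen κ.2).trans_lt hs) κ (hend κ.2) hM ?_
    refine (D.sum_lam_le _).trans (le_trans ?_ hQ)
    refine Real.rpow_le_rpow (by positivity) ?_ (by linarith [D.one_le_p])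
    exact_mod_cast hlen κ.2
  set β := Real.exp (-(M / 2)) + D.missBound with hβ
  have hβ0 : 0 ≤ β := by positivity
  have hhit : ∀ (κ : Key D.R n D.N D.Q) (h : Fin D.H) (j : Fin k),
      D.pubM (D.hitSet (s₁ κ.2) κ h j ∪ D.alive (s₁ κ.2) (s₂ κ.2) κ) ≤ ENNReal.ofReal
        (2 * (Z + 1) * (D.ρ * (4 * k) ^ (D.p - 1)) *
          ((localFreq (s₁ κ.2) j κ.item : ℝ) ^ D.p / 2 ^ κ.2.1 / D.N) + ((1 / 2) ^ Z + β)) := by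
    intro κ h j
    refine (measure_union_le _ _).trans ((add_le_add (pubMeasure_hit_le D.one_le_p hρ D.one_le_N
      D.one_le_k κ h j (localFreq (s₁ κ.2) j κ.item) Z) (halive κ)).trans ?_)
    rw [← ENNReal.ofReal_add (by positivity) hβ0]
    refine ENNReal.ofReal_le_ofReal (le_of_eq ?_)
    field_simp
    ring
  have hactive : ∀ κ : Key D.R n D.N D.Q,
      D.pubM (D.activeSet (s₁ κ.2) κ ∪ D.alive (s₁ κ.2) (s₂ κ.2) κ) ≤ ENNReal.ofReal
        ((8 * D.ρ) ^ D.p * (D.lam (s₁ κ.2) κ.item / 2 ^ κ.2.1 / D.N) + ((1 / 8) ^ D.H + β)) := by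
    intro κ
    refine (measure_union_le _ _).trans ((add_le_add (pubMeasure_allHit_le D.one_le_p hρ D.one_le_N
      κ (fun j => localFreq (s₁ κ.2) j κ.item)) (halive κ)).trans ?_)
    rw [← ENNReal.ofReal_add (by positivity) hβ0, lam_eq_sum]
    refine ENNReal.ofReal_le_ofReal (le_of_eq ?_)
    field_simp
    ring
  have hloc : ∀ (q : Fin (D.Q + 1)), ∑ i, ∑ j : Fin k, (localFreq (s₁ q) j i : ℝ) ^ D.p / 2 ^ q.1
      ≤ (2 ^ D.p + 1) * M := by
    intro q
    have h1 : ∑ i, ∑ j : Fin k, (localFreq (s₁ q) j i : ℝ) ^ D.p ≤ ∑ i, D.lam (s₁ q) i := by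
      refine Finset.sum_le_sum fun i _ => ?_
      rw [lam_eq_sum]
      exact sum_rpow_le_rpow_sum _ _ D.one_le_p
    simp only [← Finset.sum_div]
    rw [div_le_iff₀ (by positivity), mul_assoc]
    exact h1.trans (hle q)
  have hlam : ∀ (q : Fin (D.Q + 1)), ∑ i, D.lam (s₁ q) i / 2 ^ q.1 ≤ (2 ^ D.p + 1) * M := by
    intro q
    rw [← Finset.sum_div, div_le_iff₀ (by positivity), mul_assoc]
    exact hle q
  have hsumhit : ∑ κ : Key D.R n D.N D.Q, ∑ h : Fin D.H, ∑ j : Fin k,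
      D.pubM (D.hitSet (s₁ κ.2) κ h j ∪ D.alive (s₁ κ.2) (s₂ κ.2) κ)
      ≤ ENNReal.ofReal (D.hitCost M Z) := by
    refine (Finset.sum_le_sum fun κ _ => Finset.sum_le_sum fun h _ => Finset.sum_le_sum fun j _ =>
      hhit κ h j).trans ?_
    simp only [Finset.sum_const, Finset.card_univ, Fintype.card_fin]
    have hterm : ∀ κ : Key D.R n D.N D.Q, D.H • ∑ j : Fin k, ENNReal.ofReal
        (2 * (Z + 1) * (D.ρ * (4 * k) ^ (D.p - 1)) *
          ((localFreq (s₁ κ.2) j κ.item : ℝ) ^ D.p / 2 ^ κ.2.1 / D.N) + ((1 / 2) ^ Z + β))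
        = ENNReal.ofReal (D.H * (2 * (Z + 1) * (D.ρ * (4 * k) ^ (D.p - 1)) *
          ((∑ j, (localFreq (s₁ κ.2) j κ.item : ℝ) ^ D.p / 2 ^ κ.2.1) / D.N)
          + k * ((1 / 2) ^ Z + β))) := by
      intro κ
      rw [← ENNReal.ofReal_sum_of_nonneg (fun j _ => by positivity), nsmul_eq_mul,
        ENNReal.ofReal_mul (by positivity), ENNReal.ofReal_natCast, Finset.sum_add_distrib,
        ← Finset.mul_sum, Finset.sum_div]
      simp only [Finset.sum_const, Finset.card_univ, Fintype.card_fin, nsmul_eq_mul]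
    rw [Finset.sum_congr rfl fun κ _ => hterm κ,
      ← ENNReal.ofReal_sum_of_nonneg (fun κ _ => by positivity)]
    refine ENNReal.ofReal_le_ofReal ?_
    rw [← Finset.mul_sum, Finset.sum_add_distrib, ← Finset.mul_sum, hitCost]
    gcongr
    · exact sum_key_le (φ := fun i q => ∑ j, (localFreq (s₁ q) j i : ℝ) ^ D.p / 2 ^ q.1)
        D.one_le_N hloc
    · rw [Finset.sum_const, Finset.card_univ, nsmul_eq_mul, mul_assoc]
  have hsumactive : ∑ κ : Key D.R n D.N D.Q,
      D.pubM (D.activeSet (s₁ κ.2) κ ∪ D.alive (s₁ κ.2) (s₂ κ.2) κ)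
      ≤ ENNReal.ofReal (D.activeCost M) := by
    have hnn : ∀ κ : Key D.R n D.N D.Q, 0 ≤ D.lam (s₁ κ.2) κ.item := fun κ => D.lam_nonneg _ _
    refine (Finset.sum_le_sum fun κ _ => hactive κ).trans ?_
    rw [← ENNReal.ofReal_sum_of_nonneg (fun κ _ => by have := hnn κ; positivity)]
    refine ENNReal.ofReal_le_ofReal ?_
    rw [Finset.sum_add_distrib, ← Finset.mul_sum, activeCost]
    gcongr
    · exact sum_key_le (φ := fun i q => D.lam (s₁ q) i / 2 ^ q.1) D.one_le_N hlam
    · rw [Finset.sum_const, Finset.card_univ, nsmul_eq_mul]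
  have hhc : 0 ≤ D.hitCost M Z := by unfold hitCost; positivity
  have hac : 0 ≤ D.activeCost M := by unfold activeCost; positivity
  have hmA : ∀ κ h j, Measurable
      ((D.hitSet (s₁ κ.2) κ h j ∪ D.alive (s₁ κ.2) (s₂ κ.2) κ).indicator (1 : D.PubΩ → ℝ≥0∞)) :=
    fun κ h j => measurable_one.indicator
      ((D.measurableSet_hitSet _ _ _ _).union (D.measurableSet_alive _ _ _))
  have hmB : ∀ κ, Measurable
      ((D.activeSet (s₁ κ.2) κ ∪ D.alive (s₁ κ.2) (s₂ κ.2) κ).indicator (1 : D.PubΩ → ℝ≥0∞)) :=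
    fun κ => measurable_one.indicator
      ((D.measurableSet_activeSet _ _).union (D.measurableSet_alive _ _ _))
  set g : D.PubΩ → ℝ≥0∞ := fun ω => (D.w + 3 : ℕ) *
      ((∑ κ : Key D.R n D.N D.Q, ∑ h : Fin D.H, ∑ j : Fin k,
          (D.hitSet (s₁ κ.2) κ h j ∪ D.alive (s₁ κ.2) (s₂ κ.2) κ).indicator 1 ω)
        + (∑ κ : Key D.R n D.N D.Q,
          (D.activeSet (s₁ κ.2) κ ∪ D.alive (s₁ κ.2) (s₂ κ.2) κ).indicator 1 ω)
          * (6 * k * (D.G + 2) : ℕ) + (k * (D.G + 2) : ℕ)) with hg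
  have hm1 : Measurable fun ω => ∑ κ : Key D.R n D.N D.Q, ∑ h : Fin D.H, ∑ j : Fin k,
      (D.hitSet (s₁ κ.2) κ h j ∪ D.alive (s₁ κ.2) (s₂ κ.2) κ).indicator (1 : D.PubΩ → ℝ≥0∞) ω :=
    Finset.measurable_sum _ fun κ _ => Finset.measurable_sum _ fun h _ =>
      Finset.measurable_sum _ fun j _ => hmA κ h j
  have hm2 : Measurable fun ω => ∑ κ : Key D.R n D.N D.Q,
      (D.activeSet (s₁ κ.2) κ ∪ D.alive (s₁ κ.2) (s₂ κ.2) κ).indicator (1 : D.PubΩ → ℝ≥0∞) ω :=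
    Finset.measurable_sum _ fun κ _ => hmB κ
  have hmg : Measurable g := ((hm1.add (hm2.mul_const _)).add_const _).const_mul _
  have hpoint : ∫⁻ ω, (D.prot.comm s ω : ℝ≥0∞) ∂D.prot.law
      ≤ ∫⁻ ω, g ω.1 ∂(D.pubM.prod (privMeasure D.G k)) :=
    lintegral_mono fun ω : D.prot.Rand => by
      refine le_trans (le_of_eq ?_) (D.bits_state_le hs hcut ω.1 ω.2.2)
      exact congrArg Nat.cast (D.prot_comm s ω.1 ω.2.1 ω.2.2)
  refine hpoint.trans ?_
  rw [measurePreserving_fst.lintegral_comp hmg]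
  simp only [hg]
  rw [lintegral_const_mul' _ _ (ENNReal.natCast_ne_top _), lintegral_add_right _ measurable_const,
    lintegral_add_left hm1, lintegral_mul_const _ hm2,
    lintegral_finsetSum _ fun κ _ => hmB κ, lintegral_finsetSum _ fun κ _ =>
      Finset.measurable_sum _ fun h _ => Finset.measurable_sum _ fun j _ => hmA κ h j]
  have e1 : ∀ κ : Key D.R n D.N D.Q, ∫⁻ ω, ∑ h : Fin D.H, ∑ j : Fin k,
      (D.hitSet (s₁ κ.2) κ h j ∪ D.alive (s₁ κ.2) (s₂ κ.2) κ).indicator 1 ω ∂D.pubM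
      = ∑ h : Fin D.H, ∑ j : Fin k,
        D.pubM (D.hitSet (s₁ κ.2) κ h j ∪ D.alive (s₁ κ.2) (s₂ κ.2) κ) := by
    intro κ
    rw [lintegral_finsetSum _ fun h _ => Finset.measurable_sum _ fun j _ => hmA κ h j]
    refine Finset.sum_congr rfl fun h _ => ?_
    rw [lintegral_finsetSum _ fun j _ => hmA κ h j]
    refine Finset.sum_congr rfl fun j _ => ?_
    rw [lintegral_indicator_one
      ((D.measurableSet_hitSet _ _ _ _).union (D.measurableSet_alive _ _ _))]
  have e2 : ∀ κ : Key D.R n D.N D.Q, ∫⁻ ω,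
      (D.activeSet (s₁ κ.2) κ ∪ D.alive (s₁ κ.2) (s₂ κ.2) κ).indicator 1 ω ∂D.pubM
      = D.pubM (D.activeSet (s₁ κ.2) κ ∪ D.alive (s₁ κ.2) (s₂ κ.2) κ) := fun κ =>
    lintegral_indicator_one
      ((D.measurableSet_activeSet _ _).union (D.measurableSet_alive _ _ _))
  rw [Finset.sum_congr rfl fun κ _ => e1 κ, Finset.sum_congr rfl fun κ _ => e2 κ,
    lintegral_const, measure_univ, mul_one]
  have e3 : ENNReal.ofReal ((D.w + 3) *
      (D.hitCost M Z + D.activeCost M * (6 * k * (D.G + 2)) + k * (D.G + 2)))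
      = (D.w + 3 : ℕ) * (ENNReal.ofReal (D.hitCost M Z)
        + ENNReal.ofReal (D.activeCost M) * (6 * k * (D.G + 2) : ℕ) + (k * (D.G + 2) : ℕ)) := by
    rw [← ENNReal.ofReal_natCast, ← ENNReal.ofReal_natCast, ← ENNReal.ofReal_natCast,
      ← ENNReal.ofReal_mul hac, ← ENNReal.ofReal_add hhc (by positivity),
      ← ENNReal.ofReal_add (by positivity) (by positivity), ← ENNReal.ofReal_mul (by positivity)]
    push_cast
    rfl
  rw [e3]
  gcongr

end SamplerParams

namespace SamplerParams

variable {n k : ℕ} (D : SamplerParams n k)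

theorem cost_le {M T : ℝ} {Z P : ℕ} (hT : 1 ≤ T) (hM0 : 0 ≤ M) (hP : D.p ≤ P)
    (hH : (D.H : ℝ) ≤ T) (hZ : (Z : ℝ) + 1 ≤ T) (hρ : D.ρ ≤ T) (hR : (D.R : ℝ) ≤ T)
    (hQ : (D.Q : ℝ) + 1 ≤ T) (hM : M ≤ T) (hw : (D.w : ℝ) + 3 ≤ T) (hG : (D.G : ℝ) + 2 ≤ T)
    (hhit : D.H * (Fintype.card (Key D.R n D.N D.Q)
      * ((1 / 2) ^ Z + (Real.exp (-(M / 2)) + D.missBound))) ≤ 3)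
    (hact : Fintype.card (Key D.R n D.N D.Q)
      * ((1 / 8) ^ D.H + (Real.exp (-(M / 2)) + D.missBound)) ≤ 3) :
    (D.w + 3) * (D.hitCost M Z + D.activeCost M * (6 * k * (D.G + 2)) + k * (D.G + 2))
      ≤ (2 * 4 ^ (D.p - 1) * (2 ^ D.p + 1) + 6 * 8 ^ P * (2 ^ D.p + 1) + 22) * T ^ (P + 7)
        * (k + (k : ℝ) ^ (D.p - 1)) := by
  have hρ0 := D.ρ_pos
  have hk0 : (0 : ℝ) ≤ k := Nat.cast_nonneg k
  have hT0 : 0 ≤ T := by linarith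
  set B : ℝ := 2 ^ D.p + 1 with hB
  have hB0 : 0 ≤ B := by positivity
  set E : ℝ := 4 ^ (D.p - 1) with hE
  have hE0 : 0 ≤ E := by positivity
  set y : ℝ := (k : ℝ) ^ (D.p - 1) with hy
  have hy0 : 0 ≤ y := by positivity
  have h1 : D.hitCost M Z ≤ 2 * E * B * T ^ 6 * y + 3 * k := by
    have e : D.hitCost M Z = D.H * (2 * (Z + 1) * (D.ρ * (E * y)) * (D.R * (D.Q + 1) * (B * M)))
        + D.H * (Fintype.card (Key D.R n D.N D.Q)
          * ((1 / 2) ^ Z + (Real.exp (-(M / 2)) + D.missBound))) * k := by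
      rw [hitCost, Real.mul_rpow (by norm_num) hk0]; ring
    rw [e]
    refine add_le_add ?_ (by gcongr)
    calc D.H * (2 * (Z + 1) * (D.ρ * (E * y)) * (D.R * (D.Q + 1) * (B * M)))
        ≤ T * (2 * T * (T * (E * y)) * (T * T * (B * T))) := by gcongr
      _ = 2 * E * B * T ^ 6 * y := by ring
  have h2 : D.activeCost M ≤ 8 ^ P * B * T ^ (P + 3) + 3 := by
    rw [activeCost]
    refine add_le_add ?_ hact
    have h3 : (8 * D.ρ) ^ D.p ≤ (8 * T) ^ P := by
      rw [← Real.rpow_natCast]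
      exact (Real.rpow_le_rpow (by positivity) (by gcongr) (by linarith [D.one_le_p])).trans
        (Real.rpow_le_rpow_of_exponent_le (by linarith) hP)
    calc (8 * D.ρ) ^ D.p * (D.R * (D.Q + 1) * (B * M))
        ≤ (8 * T) ^ P * (T * T * (B * T)) := by gcongr
      _ = 8 ^ P * B * T ^ (P + 3) := by rw [mul_pow]; ring
  have hmb := D.missBound_nonneg
  have hhc : 0 ≤ D.hitCost M Z := by unfold hitCost; positivity
  have hac : 0 ≤ D.activeCost M := by unfold activeCost; positivity
  calc (D.w + 3) * (D.hitCost M Z + D.activeCost M * (6 * k * (D.G + 2)) + k * (D.G + 2))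
      ≤ T * ((2 * E * B * T ^ 6 * y + 3 * k) + (8 ^ P * B * T ^ (P + 3) + 3) * (6 * k * T)
        + k * T) := by gcongr
    _ = 2 * E * B * T ^ 7 * y + 3 * T ^ 1 * k + 6 * 8 ^ P * B * T ^ (P + 5) * k
        + 19 * T ^ 2 * k := by ring
    _ ≤ 2 * E * B * T ^ (P + 7) * y + 3 * T ^ (P + 7) * k + 6 * 8 ^ P * B * T ^ (P + 7) * k
        + 19 * T ^ (P + 7) * k := by
      gcongr <;> first | exact hT | omega
    _ ≤ _ := by
      have t1 : 0 ≤ 2 * E * B * T ^ (P + 7) * k := by positivity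
      have t2 : 0 ≤ 6 * 8 ^ P * B * T ^ (P + 7) * y := by positivity
      have t3 : 0 ≤ 22 * T ^ (P + 7) * y := by positivity
      nlinarith

end SamplerParams

/-! ### The choice of the parameters -/

/-- A bound for the number of keys, as a power of `2 ^ L`. -/
def keyExp (P a c : ℕ) : ℕ := 16 * (c + 3) + 1 + (a * P + c + 2) + a * P

theorem card_key_le (P a c : ℕ) {n L : ℕ} (hn : n ≤ 2 ^ L) :
    Fintype.card (Key (16 * (c + 3) * L) n (2 ^ ((a * P + c + 2) * L)) (a * P * L))
      ≤ 2 ^ (keyExp P a c * L) := by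
  have h1 : 16 * (c + 3) * L ≤ 2 ^ (16 * (c + 3) * L) := Nat.lt_two_pow_self.le
  have h2 : a * P * L + 1 ≤ 2 ^ (a * P * L) := Nat.lt_two_pow_self
  simp only [Fintype.card_prod, Fintype.card_fin]
  calc 16 * (c + 3) * L * (n * 2 ^ ((a * P + c + 2) * L)) * (a * P * L + 1)
      ≤ 2 ^ (16 * (c + 3) * L) * (2 ^ L * 2 ^ ((a * P + c + 2) * L)) * 2 ^ (a * P * L) := by
        gcongr
    _ = 2 ^ (keyExp P a c * L) := by
        rw [← pow_add, ← pow_add, ← pow_add]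
        congr 1
        unfold keyExp
        ring

theorem card_tAtom_le {R n N Q H G x L : ℕ} (hn : n ≤ 2 ^ L)
    (hkey : Fintype.card (Key R n N Q) ≤ 2 ^ x) (hH : H ≤ 2 ^ x) :
    Fintype.card (TAtom R n N Q H G) ≤ 2 ^ (2 * x + 2 * G + L + 3) := by
  have h1 : G + 1 ≤ 2 ^ G := Nat.lt_two_pow_self
  have h2 : G + 2 ≤ 2 ^ (G + 1) := Nat.lt_two_pow_self
  have e : Fintype.card (TAtom R n N Q H G) = Fintype.card (Key R n N Q) * H
      + (Fintype.card (Key R n N Q) * ((G + 1) * 2 ^ G) + n * (G + 2)) := by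
    simp only [TAtom, Fintype.card_sum, Fintype.card_prod, Fintype.card_fin]
  rw [e]
  have a1 : Fintype.card (Key R n N Q) * H ≤ 2 ^ (2 * x + 2 * G + L + 1) := by
    calc _ ≤ 2 ^ x * 2 ^ x := Nat.mul_le_mul hkey hH
      _ = 2 ^ (x + x) := (pow_add _ _ _).symm
      _ ≤ _ := Nat.pow_le_pow_right (by norm_num) (by omega)
  have a2 : Fintype.card (Key R n N Q) * ((G + 1) * 2 ^ G) ≤ 2 ^ (2 * x + 2 * G + L + 1) := by
    calc _ ≤ 2 ^ x * (2 ^ G * 2 ^ G) := by gcongr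
      _ = 2 ^ (x + (G + G)) := by rw [← pow_add, ← pow_add]
      _ ≤ _ := Nat.pow_le_pow_right (by norm_num) (by omega)
  have a3 : n * (G + 2) ≤ 2 ^ (2 * x + 2 * G + L + 1) := by
    calc _ ≤ 2 ^ L * 2 ^ (G + 1) := by gcongr
      _ = 2 ^ (L + (G + 1)) := (pow_add _ _ _).symm
      _ ≤ _ := Nat.pow_le_pow_right (by norm_num) (by omega)
  have e2 : 2 ^ (2 * x + 2 * G + L + 3) = 4 * 2 ^ (2 * x + 2 * G + L + 1) := by
    rw [show 2 * x + 2 * G + L + 3 = (2 * x + 2 * G + L + 1) + 2 by ring, pow_add]; ring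
  omega

theorem card_tCmd_le {R n N Q G x L : ℕ} (hkey : Fintype.card (Key R n N Q) ≤ 2 ^ x) :
    Fintype.card (TCmd R n N Q G) ≤ 2 ^ (2 * x + 2 * G + L + 3) := by
  have h2 : G + 2 ≤ 2 ^ (G + 1) := Nat.lt_two_pow_self
  have e : Fintype.card (TCmd R n N Q G) = Fintype.card (Key R n N Q) * (G + 2) := by
    simp only [TCmd, Fintype.card_prod, Fintype.card_fin]
  rw [e]
  calc _ ≤ 2 ^ x * 2 ^ (G + 1) := by gcongr
    _ = 2 ^ (x + (G + 1)) := (pow_add _ _ _).symm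
    _ ≤ _ := Nat.pow_le_pow_right (by norm_num) (by omega)

theorem exp_neg_natCast_le (y : ℕ) {x : ℝ} (h : y ≤ x) : Real.exp (-x) ≤ (1 / 2) ^ y := by
  have h1 : Real.exp (-1) ≤ 1 / 2 := by
    rw [Real.exp_neg, one_div]
    exact inv_anti₀ (by norm_num) (by linarith [Real.add_one_le_exp 1])
  calc Real.exp (-x) ≤ Real.exp (-(y : ℝ)) := Real.exp_le_exp.2 (by linarith)
    _ = Real.exp (-1) ^ y := by rw [← Real.exp_nat_mul]; congr 1; ring
    _ ≤ (1 / 2) ^ y := by gcongr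

/-- The parameters of the sampler, with `L` about `log n`. -/
noncomputable def samplerParams (p : ℝ) (hp : 1 ≤ p) (P a c L n k : ℕ) (hn : 1 ≤ n)
    (hnL : n ≤ 2 ^ L) (hL : 1 ≤ L) (hk : 1 ≤ k) : SamplerParams n k where
  p := p
  ρ := (2 * ((4 * keyExp P a c + c + 2) * L) : ℕ)
  R := 16 * (c + 3) * L
  N := 2 ^ ((a * P + c + 2) * L)
  Q := a * P * L
  H := keyExp P a c * L
  G := a * L + 1
  w := 2 * (keyExp P a c * L) + 2 * (a * L + 1) + L + 3
  one_le_p := hp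
  ρ_pos := by positivity
  one_le_n := hn
  one_le_k := hk
  one_le_R := Nat.mul_pos (by omega) hL
  one_le_N := Nat.one_le_two_pow
  one_le_H := Nat.mul_pos (by unfold keyExp; omega) hL
  card_atom_le := card_tAtom_le hnL (card_key_le P a c hnL) Nat.lt_two_pow_self.le
  card_cmd_le := card_tCmd_le (card_key_le P a c hnL)

section
variable {p : ℝ} {hp : 1 ≤ p} {P a c L n k : ℕ} {hn : 1 ≤ n}
    {hnL : n ≤ 2 ^ L} {hL : 1 ≤ L} {hk : 1 ≤ k}

theorem card_key_samplerParams : (Fintype.card (Key (samplerParams p hp P a c L n k hn hnL hL hk).R n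
    (samplerParams p hp P a c L n k hn hnL hL hk).N
    (samplerParams p hp P a c L n k hn hnL hL hk).Q) : ℝ) ≤ 2 ^ (keyExp P a c * L) := by
  exact_mod_cast card_key_le P a c hnL

theorem H_samplerParams_le :
    ((samplerParams p hp P a c L n k hn hnL hL hk).H : ℝ) ≤ 2 ^ (keyExp P a c * L) := by
  exact_mod_cast (Nat.lt_two_pow_self (n := keyExp P a c * L)).le

theorem missBound_samplerParams_le : (samplerParams p hp P a c L n k hn hnL hL hk).missBound
    ≤ (1 / 2) ^ ((2 * keyExp P a c + c + 2) * L) := by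
  unfold SamplerParams.missBound
  have h1 : Real.exp (-(3 / 4 * (samplerParams p hp P a c L n k hn hnL hL hk).ρ))
      ≤ (1 / 2) ^ ((4 * keyExp P a c + c + 2) * L) := by
    refine exp_neg_natCast_le _ ?_
    simp only [samplerParams]
    push_cast
    have : (0 : ℝ) ≤ (4 * keyExp P a c + c + 2) * L := by positivity
    linarith
  calc _ ≤ (2 : ℝ) ^ (keyExp P a c * L) * (2 ^ (keyExp P a c * L)
        * (1 / 2) ^ ((4 * keyExp P a c + c + 2) * L)) := by
        gcongr
        · exact card_key_samplerParams
        · exact H_samplerParams_le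
    _ = (1 / 2) ^ ((2 * keyExp P a c + c + 2) * L) := by
        rw [show (4 * keyExp P a c + c + 2) * L = keyExp P a c * L + keyExp P a c * L
          + (2 * keyExp P a c + c + 2) * L by ring, pow_add, pow_add, one_div, inv_pow]
        field_simp

theorem two_pow_mul_half_pow (x : ℕ) : (2 : ℝ) ^ x * (1 / 2) ^ x = 1 := by
  rw [← mul_pow]; norm_num

theorem lintegral_comm_samplerParams_le (hP : p ≤ P) {s : DStream n k} (hs : s.length ≤ 2 ^ (a * L))
    (hQ : (s.length : ℝ) ^ p ≤ 2 ^ (a * P * L)) :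
    ∫⁻ ω, ((samplerParams p hp P a c L n k hn hnL hL hk).prot.comm s ω : ℝ≥0∞)
      ∂(samplerParams p hp P a c L n k hn hnL hL hk).prot.law
    ≤ ENNReal.ofReal ((2 * 4 ^ (p - 1) * (2 ^ p + 1) + 6 * 8 ^ P * (2 ^ p + 1) + 22)
      * ((8 * keyExp P a c + 2 * c + 2 * a + 9) * L) ^ (P + 7) * (k + (k : ℝ) ^ (p - 1))) := by
  set D := samplerParams p hp P a c L n k hn hnL hL hk with hD
  have hL' : (1 : ℝ) ≤ L := by exact_mod_cast hL
  have hκ : 16 * (c + 3) + a * P ≤ keyExp P a c := by unfold keyExp; omega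
  have hκ' : (16 * (c + 3) + a * P : ℝ) ≤ keyExp P a c := by exact_mod_cast hκ
  have hκc := card_key_samplerParams (p := p) (hp := hp) (P := P) (a := a) (c := c)
    (hn := hn) (hnL := hnL) (hL := hL) (hk := hk)
  have hH := H_samplerParams_le (p := p) (hp := hp) (P := P) (a := a) (c := c)
    (hn := hn) (hnL := hnL) (hL := hL) (hk := hk)
  have hmb := missBound_samplerParams_le (p := p) (hp := hp) (P := P) (a := a) (c := c)
    (hn := hn) (hnL := hnL) (hL := hL) (hk := hk)
  rw [← hD] at hκc hH hmb
  set κ := keyExp P a c with hκdef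
  have hDH : D.H = κ * L := rfl
  have hβ : Real.exp (-((4 * κ * L : ℕ) / 2 : ℝ)) + D.missBound
      ≤ 2 * (1 / 2) ^ (2 * κ * L) := by
    have h1 : Real.exp (-((4 * κ * L : ℕ) / 2 : ℝ)) ≤ (1 / 2) ^ (2 * κ * L) := by
      refine exp_neg_natCast_le _ (le_of_eq ?_)
      push_cast
      ring
    have h2 : ((1 : ℝ) / 2) ^ ((2 * κ + c + 2) * L) ≤ (1 / 2) ^ (2 * κ * L) :=
      pow_le_pow_of_le_one (by norm_num) (by norm_num) (Nat.mul_le_mul_right _ (by omega))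
    linarith
  have hsplit : ((1 : ℝ) / 2) ^ (2 * κ * L) = (1 / 2) ^ (κ * L) * (1 / 2) ^ (κ * L) := by
    rw [← pow_add]; congr 1; ring
  have h22 := two_pow_mul_half_pow (κ * L)
  have hpos : (0 : ℝ) < (1 / 2) ^ (κ * L) := by positivity
  have hle1 : ((1 : ℝ) / 2) ^ (κ * L) ≤ 1 := pow_le_one₀ (by norm_num) (by norm_num)
  have hβ0 : 0 ≤ Real.exp (-((4 * κ * L : ℕ) / 2 : ℝ)) + D.missBound :=
    add_nonneg (Real.exp_pos _).le D.missBound_nonneg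
  refine (D.lintegral_comm_le (M := (4 * κ * L : ℕ)) (Z := 2 * κ * L) ?_ hQ ?_).trans
    (ENNReal.ofReal_le_ofReal
      (D.cost_le (P := P) ?_ (by positivity) hP ?_ ?_ ?_ ?_ ?_ ?_ ?_ ?_ ?_ ?_))
  · exact hs.trans_lt (Nat.pow_lt_pow_right (by norm_num) (Nat.lt_succ_self _))
  · have : 1 ≤ 4 * κ * L := Nat.mul_pos (by omega) hL
    exact_mod_cast this
  · nlinarith
  · rw [hDH]; push_cast; nlinarith
  · push_cast; nlinarith
  · rw [show D.ρ = (2 * ((4 * κ + c + 2) * L) : ℕ) from rfl]; push_cast; nlinarith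
  · rw [show D.R = 16 * (c + 3) * L from rfl]
    push_cast
    have haP : (0 : ℝ) ≤ a * P := by positivity
    refine mul_le_mul_of_nonneg_right ?_ (by positivity)
    linarith
  · rw [show D.Q = a * P * L from rfl]; push_cast; nlinarith
  · push_cast; nlinarith
  · rw [show D.w = 2 * (κ * L) + 2 * (a * L + 1) + L + 3 from rfl]; push_cast; nlinarith
  · rw [show D.G = a * L + 1 from rfl]; push_cast; nlinarith
  · calc D.H * (Fintype.card (Key D.R n D.N D.Q) * ((1 / 2) ^ (2 * κ * L)
          + (Real.exp (-((4 * κ * L : ℕ) / 2 : ℝ)) + D.missBound)))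
        ≤ 2 ^ (κ * L) * (2 ^ (κ * L) * ((1 / 2) ^ (2 * κ * L) + 2 * (1 / 2) ^ (2 * κ * L))) := by
          gcongr
      _ = 3 * ((2 ^ (κ * L) * (1 / 2) ^ (κ * L)) * (2 ^ (κ * L) * (1 / 2) ^ (κ * L))) := by
          rw [hsplit]; ring
      _ ≤ 3 := by rw [h22]; norm_num
  · have h8 : ((1 : ℝ) / 8) ^ D.H ≤ (1 / 2) ^ (κ * L) := by
      rw [hDH]; gcongr; norm_num
    calc Fintype.card (Key D.R n D.N D.Q) * ((1 / 8) ^ D.H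
          + (Real.exp (-((4 * κ * L : ℕ) / 2 : ℝ)) + D.missBound))
        ≤ 2 ^ (κ * L) * ((1 / 2) ^ (κ * L) + 2 * ((1 / 2) ^ (κ * L) * (1 / 2) ^ (κ * L))) := by
          rw [hsplit] at hβ
          gcongr
      _ = (2 ^ (κ * L) * (1 / 2) ^ (κ * L)) * (1 + 2 * (1 / 2) ^ (κ * L)) := by ring
      _ ≤ 3 := by rw [h22]; linarith

theorem errors_samplerParams_le {Λ : ℝ} (hΛ : Λ ≤ 2 ^ (a * P * L)) :
    Λ / (samplerParams p hp P a c L n k hn hnL hL hk).N ≤ (1 / 2) ^ (c * L) / 4 ∧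
    ((15 : ℝ) / 16) ^ (samplerParams p hp P a c L n k hn hnL hL hk).R ≤ (1 / 2) ^ (c * L) / 8 ∧
    (samplerParams p hp P a c L n k hn hnL hL hk).missBound ≤ (1 / 2) ^ (c * L) / 4 := by
  have hhalf : ∀ b : ℕ, ((1 : ℝ) / 2) ^ ((c + b) * L) ≤ (1 / 2) ^ (c * L) * (1 / 2) ^ b := by
    intro b
    rw [← pow_add]
    refine pow_le_pow_of_le_one (by norm_num) (by norm_num) ?_
    nlinarith
  refine ⟨?_, ?_, ?_⟩
  · have h1 : ((samplerParams p hp P a c L n k hn hnL hL hk).N : ℝ)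
        = 2 ^ (a * P * L) * 2 ^ ((c + 2) * L) := by
      rw [← pow_add, ← add_mul, ← add_assoc]
      simp [samplerParams]
    rw [h1, div_le_iff₀ (by positivity)]
    have h2 := two_pow_mul_half_pow ((c + 2) * L)
    have h3 := hhalf 2
    have h4 : (1 : ℝ) ≤ (1 / 2) ^ (c * L) / 4 * 2 ^ ((c + 2) * L) := by
      refine h2.symm.le.trans ?_
      rw [mul_comm]
      gcongr
      linarith
    calc Λ ≤ 2 ^ (a * P * L) * 1 := by rwa [mul_one]
      _ ≤ 2 ^ (a * P * L) * ((1 / 2) ^ (c * L) / 4 * 2 ^ ((c + 2) * L)) := by gcongr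
      _ = _ := by ring
  · have h1 : ((15 : ℝ) / 16) ^ (16 * (c + 3) * L) ≤ (1 / 2) ^ ((c + 3) * L) := by
      rw [mul_assoc, pow_mul]
      gcongr
      norm_num
    have h3 := hhalf 3
    exact h1.trans (by linarith)
  · refine missBound_samplerParams_le.trans ?_
    have h1 : ((1 : ℝ) / 2) ^ ((2 * keyExp P a c + c + 2) * L) ≤ (1 / 2) ^ ((c + 2) * L) :=
      pow_le_pow_of_le_one (by norm_num) (by norm_num) (Nat.mul_le_mul_right _ (by omega))
    have h3 := hhalf 2
    linarith

end

theorem clog_le_mul_log {n : ℕ} (hn : 2 ≤ n) : (Nat.clog 2 n : ℝ) ≤ 3 * Real.log n := by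
  have h1 : 2 ^ (Nat.clog 2 n - 1) < n := Nat.pow_pred_clog_lt_self (by norm_num) (by omega)
  have h1' : (2 : ℝ) ^ (Nat.clog 2 n - 1) ≤ n := by exact_mod_cast h1.le
  have h2 : ((Nat.clog 2 n - 1 : ℕ) : ℝ) * Real.log 2 ≤ Real.log n := by
    rw [← Real.log_pow]
    exact Real.log_le_log (by positivity) h1'
  have h3 : Real.log 2 ≤ Real.log n :=
    Real.log_le_log (by norm_num) (by exact_mod_cast hn)
  have h4 : (Nat.clog 2 n : ℝ) ≤ (Nat.clog 2 n - 1 : ℕ) + 1 := by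
    have : Nat.clog 2 n ≤ (Nat.clog 2 n - 1) + 1 := by omega
    exact_mod_cast this
  have h5 := Real.log_two_gt_d9
  have h6 : (Nat.clog 2 n : ℝ) * Real.log 2 ≤ 2 * Real.log n := by nlinarith
  have h7 : (0 : ℝ) ≤ Nat.clog 2 n := Nat.cast_nonneg _
  nlinarith

theorem half_pow_le_rpow_neg {n L c : ℕ} {C : ℝ} (hn : 1 ≤ n) (hnL : n ≤ 2 ^ L) (hC : C ≤ c) :
    ((1 : ℝ) / 2) ^ (c * L) ≤ (n : ℝ) ^ (-C) := by
  have hn1 : (1 : ℝ) ≤ n := by exact_mod_cast hn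
  have hnL' : (n : ℝ) ≤ 2 ^ L := by exact_mod_cast hnL
  rw [Real.rpow_neg (by positivity), one_div, inv_pow]
  refine inv_anti₀ (Real.rpow_pos_of_pos (by linarith) _) ?_
  calc (n : ℝ) ^ C ≤ (n : ℝ) ^ (c : ℝ) := Real.rpow_le_rpow_of_exponent_le hn1 hC
    _ = (n : ℝ) ^ c := Real.rpow_natCast _ _
    _ ≤ (2 ^ L) ^ c := by gcongr
    _ = 2 ^ (c * L) := by rw [← pow_mul, mul_comm]

theorem natCast_rpow_le_two_pow {p : ℝ} (hp : 1 ≤ p) {P a L m : ℕ} (hP : p ≤ P)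
    (hm : m ≤ 2 ^ (a * L)) : (m : ℝ) ^ p ≤ 2 ^ (a * P * L) := by
  have hm' : (m : ℝ) ≤ 2 ^ (a * L) := by exact_mod_cast hm
  calc (m : ℝ) ^ p ≤ ((2 : ℝ) ^ (a * L)) ^ p :=
        Real.rpow_le_rpow (by positivity) hm' (by linarith)
    _ ≤ ((2 : ℝ) ^ (a * L)) ^ (P : ℝ) :=
        Real.rpow_le_rpow_of_exponent_le (one_le_pow₀ (by norm_num)) hP
    _ = 2 ^ (a * P * L) := by rw [Real.rpow_natCast, ← pow_mul]; congr 1; ring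

theorem SamplerParams.one_le_sum_lam {n k : ℕ} (D : SamplerParams n k) {s : DStream n k}
    (hs : s ≠ []) : 1 ≤ ∑ i, D.lam s i := by
  obtain ⟨u, hu⟩ := List.exists_mem_of_ne_nil s hs
  have h1 : 1 ≤ freq s u.1 := by
    have h2 : 1 ≤ localFreq s u.2 u.1 := List.count_pos_iff.2 hu
    exact h2.trans (Finset.single_le_sum (f := fun j => localFreq s j u.1)
      (fun _ _ => Nat.zero_le _) (Finset.mem_univ u.2))
  have h3 : 1 ≤ D.lam s u.1 :=
    Real.one_le_rpow (by exact_mod_cast h1) (by linarith [D.one_le_p])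
  exact h3.trans (Finset.single_le_sum (f := D.lam s) (fun i _ => D.lam_nonneg s i)
    (Finset.mem_univ u.1))

theorem SamplerParams.correctAt {n k : ℕ} (D : SamplerParams n k) {s : DStream n k} (hne : s ≠ [])
    (hlt : s.length < 2 ^ D.G) (hQ : ∑ i, D.lam s i ≤ 2 ^ D.Q) {δ : ℝ} (h1 : δ ≤ 1)
    (hN : (∑ i, D.lam s i) / D.N ≤ δ / 4) (hR : (15 / 16) ^ D.R ≤ δ / 8)
    (hm : D.missBound ≤ δ / 4) :
    Measurable (D.prot.result s) ∧ D.prot.PerfectAt D.p δ s ∧ D.prot.MaximizesAt D.p δ D.scale s ∧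
      D.prot.EstimatesScaledAt D.p 4 D.scale s ∧ D.prot.EstimatesFreqAt D.p D.scale s := by
  have h0 : (0 : ℝ) ≤ (15 / 16) ^ D.R := by positivity
  refine ⟨D.measurable_result hlt, fun i => ?_, ?_, D.estimatesScaledAt hlt,
    D.estimatesFreqAt hlt⟩
  · refine (D.perfectAt hlt (D.one_le_sum_lam hne) hQ (by linarith) hN i).trans ?_
    linarith
  · refine le_trans ?_ (D.maximizesAt hlt (D.one_le_sum_lam hne) hQ (by linarith) hN)
    linarith

theorem exists_samplerParams (p : ℝ) (hp : 1 ≤ p) (a : ℕ) (C : ℝ) :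
    ∃ (K : ℝ) (d : ℕ), ∀ n k : ℕ, 2 ≤ n → 1 ≤ k → ∃ D : SamplerParams n k, D.p = p ∧
      ∃ δ : ℝ, δ ≤ 1 ∧ δ ≤ (n : ℝ) ^ (-C) ∧ (15 / 16) ^ D.R ≤ δ / 8 ∧ D.missBound ≤ δ / 4 ∧
      ∀ s : DStream n k, s.length ≤ n ^ a →
        s.length < 2 ^ D.G ∧ ∑ i, D.lam s i ≤ 2 ^ D.Q ∧ (∑ i, D.lam s i) / D.N ≤ δ / 4 ∧
        ∫⁻ ω, (D.prot.comm s ω : ℝ≥0∞) ∂D.prot.law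
          ≤ ENNReal.ofReal (K * ((k : ℝ) + (k : ℝ) ^ (p - 1)) * Real.log n ^ d) := by
  set P := ⌈p⌉₊
  set c := ⌈C⌉₊
  have hP : p ≤ P := Nat.le_ceil p
  have hc : C ≤ c := Nat.le_ceil C
  refine ⟨(2 * 4 ^ (p - 1) * (2 ^ p + 1) + 6 * 8 ^ P * (2 ^ p + 1) + 22)
    * ((8 * keyExp P a c + 2 * c + 2 * a + 9) * 3) ^ (P + 7), P + 7, fun n k hn hk => ?_⟩
  set L := Nat.clog 2 n
  have hnL : n ≤ 2 ^ L := Nat.le_pow_clog (by norm_num) n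
  have hL : 1 ≤ L := Nat.clog_pos (by norm_num) hn
  have hlog : (L : ℝ) ≤ 3 * Real.log n := clog_le_mul_log hn
  have hna : n ^ a ≤ 2 ^ (a * L) := by
    calc n ^ a ≤ (2 ^ L) ^ a := Nat.pow_le_pow_left hnL a
      _ = 2 ^ (a * L) := by rw [← pow_mul, mul_comm]
  have hn1 : 1 ≤ n := by omega
  have herr := fun {Λ : ℝ} => errors_samplerParams_le (p := p) (hp := hp) (hn := hn1)
    (hnL := hnL) (hL := hL) (hk := hk) (c := c) (P := P) (a := a) (Λ := Λ)
  have hcomm := fun (s : DStream n k) => lintegral_comm_samplerParams_le (p := p) (hp := hp)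
    (hn := hn1) (hnL := hnL) (hL := hL) (hk := hk) (c := c) (P := P) (a := a) (s := s) hP
  refine ⟨samplerParams p hp P a c L n k hn1 hnL hL hk, rfl, (1 / 2) ^ (c * L),
    pow_le_one₀ (by norm_num) (by norm_num), half_pow_le_rpow_neg hn1 hnL hc,
    (herr le_rfl).2.1, (herr le_rfl).2.2, fun s hs => ?_⟩
  have hs' := hs.trans hna
  have hQ := natCast_rpow_le_two_pow hp hP hs'
  have hlam := ((samplerParams p hp P a c L n k hn1 hnL hL hk).sum_lam_le s).trans hQ
  refine ⟨hs'.trans_lt (Nat.pow_lt_pow_right (by norm_num) (Nat.lt_succ_self _)), hlam,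
    (herr hlam).1, (hcomm s hs' hQ).trans (ENNReal.ofReal_le_ofReal ?_)⟩
  have h1 : ((8 * keyExp P a c + 2 * c + 2 * a + 9) * L : ℝ) ^ (P + 7)
      ≤ ((8 * keyExp P a c + 2 * c + 2 * a + 9) * 3) ^ (P + 7) * Real.log n ^ (P + 7) := by
    rw [← mul_pow, mul_assoc]
    gcongr
  calc _ ≤ (2 * 4 ^ (p - 1) * (2 ^ p + 1) + 6 * 8 ^ P * (2 ^ p + 1) + 22)
        * (((8 * keyExp P a c + 2 * c + 2 * a + 9) * 3) ^ (P + 7) * Real.log n ^ (P + 7))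
        * (k + (k : ℝ) ^ (p - 1)) := by gcongr
    _ = _ := by ring

theorem mainTheorem1 (p : ℝ) (hp : 1 ≤ p) (a : ℕ) (C : ℝ) (hC : 0 < C) :
    ∃ (K B : ℝ) (d : ℕ), ∀ n k : ℕ, 2 ≤ n → 1 ≤ k →
      ∃ (R N : ℕ) (P : Protocol n k (SampleOut R n N)) (e : Coord R n N → P.Pub → ℝ),
        P.StdExponentials e ∧
        ∀ s : DStream n k, s.length ≤ n ^ a →
          (Measurable (P.comm s) ∧
            ∫⁻ ω, (P.comm s ω : ℝ≥0∞) ∂P.law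
              ≤ ENNReal.ofReal (K * ((k : ℝ) + (k : ℝ) ^ (p - 1)) * Real.log n ^ d)) ∧
          ∀ t : ℕ, 1 ≤ t → t ≤ s.length →
            Measurable (P.result (s.take t)) ∧
            P.PerfectAt p ((n : ℝ) ^ (-C)) (s.take t) ∧
            P.MaximizesAt p ((n : ℝ) ^ (-C)) e (s.take t) ∧
            P.EstimatesScaledAt p B e (s.take t) ∧
            P.EstimatesFreqAt p e (s.take t) := by
  obtain ⟨K, d, h⟩ := exists_samplerParams p hp a C
  refine ⟨K, 4, d, fun n k hn hk => ?_⟩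
  obtain ⟨D, rfl, δ, h1, hδ, hR, hm, hD⟩ := h n k hn hk
  refine ⟨D.R, D.N, D.prot, D.scale, D.stdExponentials, fun s hs =>
    ⟨⟨D.measurable_comm s, (hD s hs).2.2.2⟩, fun t ht1 ht2 => ?_⟩⟩
  have hlen : (s.take t).length ≤ n ^ a := by
    rw [List.length_take]
    exact (min_le_right _ _).trans hs
  have hne : s.take t ≠ [] := by
    rw [← List.length_pos_iff, List.length_take]
    omega
  obtain ⟨hlt, hQ, hN, -⟩ := hD _ hlen
  obtain ⟨r1, r2, r3, r4, r5⟩ := D.correctAt hne hlt hQ h1 hN hR hm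
  exact ⟨r1, fun i => (r2 i).trans hδ, le_trans (by linarith) r3, r4, r5⟩
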